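/- **Setting.** Let $G$ be an undirected graph on $n$ vertices in which every edge $e$ has a level $\ell(e)\in\{1,\dots,L_{\max}\}$, $L_{\max}=\lceil\log_2 n\rceil$. For $j\ge 0$ the *level $j$ clusters* are the vertex sets of the connected components of the graph $G_j$ of all edges of level at most $j$; $n(C)$ is the number of vertices of a cluster $C$. The *children* of a level $j+1$ cluster $A$ are the level $j$ clusters contained in $A$; they are the vertices of the *cluster graph* $CG(A)$, whose edges are the level $j+1$ edges inside $A$. A level $j+1$ edge $uw$ is *blocked* if $u,w$ lie in distinct level $j$ clusters $C_u\ne C_w$ and $n(C_u)+n(C_w)>2^{j}$. *Pushing down* an unblocked edge means decreasing its level by one. *Size invariant*: every level $j$ cluster $C$ has $n(C)\le 2^j$. *Blocked edge invariant for $CG(A)$*: every child of $A$ is incident to a blocked level $j+1$ edge, or $A$ has only one child. **Time** is measured on a word RAM with words of $O(\log n)$ bits which accesses the levelled graph only through the operations of the cluster forest. An elementary RAM instruction costs $1$; each of the following forest operations costs $\lceil\log_2 n\rceil+1$: find the cluster of a given level containing a vertex; its size; the level of an edge; the first level $j+1$ edge incident to a level $j$ cluster, and the next edge after a given one, in an order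 of which the program knows nothing; push down an unblocked edge by one level (merging clusters); mark or unmark a child of the forest node being processed (a child formed by merging is marked if one of its parts was); return a smallest unmarked child of that node. **Lemma.** There are a program and a constant $K$ with the following property. Let $0\le i<L_{\max}$, let $c$ be a level $i+1$ cluster in a state that satisfies the size invariant and in which $CG(c)$ satisfies the blocked edge invariant, and suppose that one child $X$ of $c$ is split: in the new state, which again satisfies the size invariant, $X$ is replaced by two disjoint level $i$ clusters $X_1,X_2$ with $X_1\cup X_2=X$, while the other children of $c$ and the level $i+1$ edges incident to $c$ are the same as before. Then the program, started in the new state with input $i$, a vertex of $X_1$ and a vertex of $X_2$, halts after time at most $$K\,(k+1)\log_2 n ,$$ where $k$ is the total number of pushes it performs (an edge that moves down by $d$ levels counts $d$ times). It changes nothing but the levels of level $i+1$ edges inside $c$, which it pushes down. In the final state the size invariant holds and every level $i+1$ cluster contained in $c$ (the cluster $c$ may have been disconnected by the split) satisfies the blocked edge invariant. Moreover, if before the run all clusters of levels $1,\dots,i$ contained in $c$ satisfied the blocked edge invariant, then so they do afterwards. -/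

import Mathlib

/-! ### Leveled graphs, clusters and the two invariants -/

/-- The number of levels, `⌈log₂ n⌉`. -/
def maxLevel (n : ℕ) : ℕ := Nat.clog 2 n

/-- An undirected graph on `n` vertices whose edges carry levels in `[1, ⌈log₂ n⌉]`.
(The value of `level` on pairs that are not edges is irrelevant.) -/
structure LeveledGraph (n : ℕ) where
  graph : SimpleGraph (Fin n)
  level : Sym2 (Fin n) → ℕ
  one_le_level : ∀ e ∈ graph.edgeSet, 1 ≤ level e
  level_le : ∀ e ∈ graph.edgeSet, level e ≤ maxLevel n

namespace LeveledGraph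

variable {n : ℕ}

/-- `u w` is an edge of level `j`. -/
def IsEdge (S : LeveledGraph n) (j : ℕ) (u w : Fin n) : Prop :=
  S.graph.Adj u w ∧ S.level s(u, w) = j

/-- The graph `G_j` of all edges of level at most `j`. -/
def upTo (S : LeveledGraph n) (j : ℕ) : SimpleGraph (Fin n) where
  Adj u w := S.graph.Adj u w ∧ S.level s(u, w) ≤ j
  symm := ⟨fun u w h => ⟨h.1.symm, by rw [Sym2.eq_swap]; exact h.2⟩⟩
  loopless := ⟨fun u h => S.graph.loopless.irrefl u h.1⟩

/-- The level `j` cluster containing `v`: the vertex set of its connected component in `G_j`. -/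
def cluster (S : LeveledGraph n) (j : ℕ) (v : Fin n) : Set (Fin n) :=
  ((S.upTo j).connectedComponentMk v).supp

/-- The size `n(C)` of the level `j` cluster `C` containing `v`. -/
noncomputable def size (S : LeveledGraph n) (j : ℕ) (v : Fin n) : ℕ := (S.cluster j v).ncard

/-- `A` is a cluster of level `j`. -/
def IsCluster (S : LeveledGraph n) (j : ℕ) (A : Set (Fin n)) : Prop := ∃ v, A = S.cluster j v

/-- Size invariant: every level `j` cluster has at most `2 ^ j` vertices. -/
def SizeInvariant (S : LeveledGraph n) : Prop := ∀ j v, S.size j v ≤ 2 ^ j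

/-- `Y` is a vertex of the cluster graph of the level `j + 1` cluster `A`, i.e. a level `j` cluster
contained in `A`. The edges of the cluster graph are the level `j + 1` edges inside `A`. -/
def IsChild (S : LeveledGraph n) (j : ℕ) (Y A : Set (Fin n)) : Prop := S.IsCluster j Y ∧ Y ⊆ A

/-- The level `j + 1` edge `u w` is blocked: pushing it to level `j` would merge two distinct
level `j` clusters into one with more than `2 ^ j` vertices. (A self-loop of the cluster graph,
i.e. an edge with both ends in one level `j` cluster, can always be pushed.) -/
def IsBlocked (S : LeveledGraph n) (j : ℕ) (u w : Fin n) : Prop :=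
  S.IsEdge (j + 1) u w ∧ S.cluster j u ≠ S.cluster j w ∧ 2 ^ j < S.size j u + S.size j w

/-- Blocked edge invariant for the cluster graph of the level `j + 1` cluster `A`: every child is
incident to a blocked level `j + 1` edge, or `A` has only one child. -/
def BlockedInvariant (S : LeveledGraph n) (j : ℕ) (A : Set (Fin n)) : Prop :=
  (∀ Y, S.IsChild j Y A → ∃ u ∈ Y, ∃ w, S.IsBlocked j u w) ∨ ∃! Y, S.IsChild j Y A

open Classical in
/-- Pushing the edge `e` down by one level. (It is only applied to unblocked edges; these have
level at least two, so the `max` never matters.) -/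
noncomputable def pushDown (S : LeveledGraph n) (e : Sym2 (Fin n)) : LeveledGraph n where
  graph := S.graph
  level := Function.update S.level e (max 1 (S.level e - 1))
  one_le_level := by
    intro f hf
    by_cases h : f = e
    · subst h; simp
    · rw [Function.update_of_ne h]; exact S.one_le_level f hf
  level_le := by
    intro f hf
    by_cases h : f = e
    · subst h
      have h1 := S.one_le_level f hf
      have h2 := S.level_le f hf
      simp only [Function.update_self]
      omega
    · rw [Function.update_of_ne h]; exact S.level_le f hf

/-- The number of edge pushes that lead from `S` to `S'`, an edge that moves down by `d` levels
being pushed `d` times. -/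
def pushCount (S S' : LeveledGraph n) : ℕ := ∑ e : Sym2 (Fin n), (S.level e - S'.level e)

/-- Between the states `S₀` and `S₁` the child `X` of the level `i + 1` cluster `c` has been split
into the two level `i` clusters `X₁` and `X₂`; the other children of `c` and the level `i + 1`
edges at `c` are the same in both states. -/
structure IsSplit (S₀ S₁ : LeveledGraph n) (i : ℕ) (c X X₁ X₂ : Set (Fin n)) : Prop where
  isCluster : S₀.IsCluster (i + 1) c
  isChild : S₀.IsChild i X c
  left : S₁.IsCluster i X₁
  right : S₁.IsCluster i X₂
  disjoint : Disjoint X₁ X₂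
  union : X₁ ∪ X₂ = X
  others : ∀ Y, S₀.IsChild i Y c → Y ≠ X → S₁.IsCluster i Y
  edges : ∀ u ∈ c, ∀ w, S₁.IsEdge (i + 1) u w ↔ S₀.IsEdge (i + 1) u w

/-- `S₂` arises from `S₁` by pushing down level `i + 1` edges inside `c`; everything else is
unchanged. -/
structure PushedWithin (S₁ S₂ : LeveledGraph n) (i : ℕ) (c : Set (Fin n)) : Prop where
  graph_eq : S₂.graph = S₁.graph
  level_le : ∀ e, S₂.level e ≤ S₁.level e
  frame : ∀ e, S₂.level e ≠ S₁.level e →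
    ∃ u ∈ c, ∃ w ∈ c, e = s(u, w) ∧ S₁.IsEdge (i + 1) u w

/-- Every cluster of level at most `i` inside `c` satisfies the blocked edge invariant. -/
def BlockedBelow (S : LeveledGraph n) (i : ℕ) (c : Set (Fin n)) : Prop :=
  ∀ j < i, ∀ A ⊆ c, S.IsCluster (j + 1) A → S.BlockedInvariant j A

end LeveledGraph

/-! ### The machine

A word RAM with words of `O(log n)` bits that operates on a cluster forest through the operations
of the forest. Everything the forest is free to choose (names of nodes, the order in which the
edges at a cluster are listed, which of several smallest clusters is returned) is collected
in a `Layout`, about which a program knows nothing. -/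

structure Layout (n : ℕ) where
  /-- The name of the level `j` cluster containing `v`; it is one of the vertices of the cluster. -/
  node : LeveledGraph n → ℕ → Fin n → Fin n
  node_mem : ∀ S j v, node S j v ∈ S.cluster j v
  node_eq : ∀ S j u v, S.cluster j u = S.cluster j v → node S j u = node S j v
  /-- The level `j + 1` edges incident to the level `j` cluster containing `v`, each listed as
  `(u, w)` with `u` in the cluster. (So a self-loop is listed in both directions.) -/
  edgeList : LeveledGraph n → ℕ → Fin n → List (Fin n × Fin n)
  edgeList_nodup : ∀ S j v, (edgeList S j v).Nodup
  mem_edgeList : ∀ S j v u w,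
    (u, w) ∈ edgeList S j v ↔ u ∈ S.cluster j v ∧ S.IsEdge (j + 1) u w
  edgeList_eq : ∀ S j u v, S.cluster j u = S.cluster j v → edgeList S j u = edgeList S j v
  /-- A vertex of a smallest unmarked level `j` cluster inside `c`, if there is any. A cluster is
  marked if it contains an element of the set `M` of marked vertices. -/
  smallest : LeveledGraph n → (M : Set (Fin n)) → ℕ → (c : Set (Fin n)) → Option (Fin n)
  smallest_none : ∀ S M j c, smallest S M j c = none →
    ∀ v ∈ c, ¬ Disjoint (S.cluster j v) M
  smallest_some : ∀ S M j c v, smallest S M j c = some v →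
    v ∈ c ∧ Disjoint (S.cluster j v) M ∧
      ∀ w ∈ c, Disjoint (S.cluster j w) M → S.size j v ≤ S.size j w

/-- Layouts exist. -/
theorem Layout.nonempty (n : ℕ) : Nonempty (Layout n) := by
  classical
  have hs : ∀ (S : LeveledGraph n) (M : Set (Fin n)) (j : ℕ) (c : Set (Fin n)),
      ∃ o : Option (Fin n), (o = none → ∀ v ∈ c, ¬ Disjoint (S.cluster j v) M) ∧
        ∀ v, o = some v → v ∈ c ∧ Disjoint (S.cluster j v) M ∧
          ∀ w ∈ c, Disjoint (S.cluster j w) M → S.size j v ≤ S.size j w := by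
    intro S M j c
    by_cases h : ∃ v, v ∈ c ∧ Disjoint (S.cluster j v) M
    · obtain ⟨v, hv, hmin⟩ := Set.exists_min_image {v | v ∈ c ∧ Disjoint (S.cluster j v) M}
        (S.size j) (Set.toFinite _) h
      exact ⟨some v, by simp, fun w hw => by
        cases hw; exact ⟨hv.1, hv.2, fun w h1 h2 => hmin w ⟨h1, h2⟩⟩⟩
    · exact ⟨none, fun _ v hv hd => h ⟨v, hv, hd⟩, by simp⟩
  choose sm h1 h2 using hs
  have hself : ∀ (S : LeveledGraph n) j v, v ∈ S.cluster j v := fun S j v => rfl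
  let nd : Set (Fin n) → Fin n → Fin n := fun A v => if h : A.Nonempty then h.some else v
  refine ⟨⟨fun S j v => nd (S.cluster j v) v, ?_, ?_,
    fun S j v => (Finset.univ.filter fun p : Fin n × Fin n =>
      p.1 ∈ S.cluster j v ∧ S.IsEdge (j + 1) p.1 p.2).toList, ?_, ?_, ?_, sm, h1, h2⟩⟩
  · intro S j v
    have h : (S.cluster j v).Nonempty := ⟨v, hself S j v⟩
    simp only [nd, dif_pos h]
    exact h.some_mem
  · intro S j u v h
    have hv : (S.cluster j v).Nonempty := ⟨v, hself S j v⟩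
    simp only [nd, h, dif_pos hv]
  · intro S j v; exact Finset.nodup_toList _
  · intro S j v u w; simp
  · intro S j u v h; simp only [h]

/-- Basic instructions; the arguments are numbers of registers (`k` is a literal). -/
inductive Instr where
  /-- `x := k` -/
  | const (x k : ℕ)
  /-- `x := y + z` -/
  | add (x y z : ℕ)
  /-- `x := y - z`, and `0` if `y < z` -/
  | sub (x y z : ℕ)
  /-- `x := mem[y]` -/
  | load (x y : ℕ)
  /-- `mem[x] := y` -/
  | store (x y : ℕ)
  /-- `x :=` name of the level `l` cluster containing `v` -/
  | cluster (x v l : ℕ)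
  /-- `x :=` size of the level `l` cluster containing `v` -/
  | size (x v l : ℕ)
  /-- `x :=` level of the edge `u w`, and `0` if there is no such edge -/
  | level (x u w : ℕ)
  /-- `(u, w) :=` first level `l + 1` edge at the level `l` cluster containing `v`;
  `f :=` whether there is one -/
  | firstEdge (f u w v l : ℕ)
  /-- `(u, w) :=` the edge that follows the edge `(u, w)` of level `j + 1` in the list of the
  level `j` cluster containing `u`; `f :=` whether there is one -/
  | nextEdge (f u w : ℕ)
  /-- push the unblocked edge `u w` down by one level, merging clusters as needed -/
  | push (u w : ℕ)
  /-- mark the child of `c` that contains `v` -/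
  | mark (v : ℕ)
  /-- unmark the child of `c` that contains `v` -/
  | unmark (v : ℕ)
  /-- `v :=` a vertex of a smallest unmarked child of `c`; `f :=` whether there is one -/
  | smallest (f v : ℕ)

/-- The time of an instruction: `1` for the instructions of the RAM, `⌈log₂ n⌉ + 1` for the
operations of the forest. -/
def Instr.time (n : ℕ) : Instr → ℕ
  | .const _ _ => 1
  | .add _ _ _ => 1
  | .sub _ _ _ => 1
  | .load _ _ => 1
  | .store _ _ => 1
  | _ => Nat.clog 2 n + 1

/-- Structured programs. -/
inductive Program where
  | skip
  | instr (a : Instr)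
  | seq (p q : Program)
  /-- run `p` if register `x` is nonzero, and `q` otherwise -/
  | ite (x : ℕ) (p q : Program)
  /-- run `p` as long as register `x` is nonzero -/
  | loop (x : ℕ) (p : Program)

/-- A configuration: the cluster forest (given by the leveled graph), the set of marked vertices,
the registers and the working memory. -/
structure Config (n : ℕ) where
  forest : LeveledGraph n
  marks : Set (Fin n)
  reg : ℕ → ℕ
  mem : ℕ → ℕ

namespace Config

variable {n : ℕ}

/-- Write a word (a number below `(n + 2) ^ 8`, larger numbers wrap around) to a register. -/
def set (σ : Config n) (x a : ℕ) : Config n :=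
  { σ with reg := Function.update σ.reg x (a % (n + 2) ^ 8) }

/-- Write a word to the working memory. -/
def write (σ : Config n) (x a : ℕ) : Config n :=
  { σ with mem := Function.update σ.mem x (a % (n + 2) ^ 8) }

/-- Write the result of an edge query. -/
def setEdge (σ : Config n) (f u w : ℕ) : Option (Fin n × Fin n) → Config n
  | none => σ.set f 0
  | some (a, b) => ((σ.set u a).set w b).set f 1

/-- Write the result of a vertex query. -/
def setVertex (σ : Config n) (f v : ℕ) : Option (Fin n) → Config n
  | none => σ.set f 0
  | some a => (σ.set v a).set f 1

/-- The initial configuration: registers `0`, `1`, `2` hold the level `i` and two vertices,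
everything else is zero and nothing is marked. -/
def init (S : LeveledGraph n) (i : ℕ) (x₁ x₂ : Fin n) : Config n where
  forest := S
  marks := ∅
  reg r := if r = 0 then i else if r = 1 then x₁ else if r = 2 then x₂ else 0
  mem _ := 0

end Config

/-- One instruction, executed while working on the cluster graph of the forest node with vertex
set `c`, whose children have level `i`. A forest operation whose arguments make no sense, in
particular a push of a blocked edge, has no result. -/
inductive Step {n : ℕ} (Λ : Layout n) (i : ℕ) (c : Set (Fin n)) :
    Instr → Config n → Config n → Prop where
  | const (σ : Config n) (x k : ℕ) : Step Λ i c (.const x k) σ (σ.set x k)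
  | add (σ : Config n) (x y z : ℕ) : Step Λ i c (.add x y z) σ (σ.set x (σ.reg y + σ.reg z))
  | sub (σ : Config n) (x y z : ℕ) : Step Λ i c (.sub x y z) σ (σ.set x (σ.reg y - σ.reg z))
  | load (σ : Config n) (x y : ℕ) : Step Λ i c (.load x y) σ (σ.set x (σ.mem (σ.reg y)))
  | store (σ : Config n) (x y : ℕ) : Step Λ i c (.store x y) σ (σ.write (σ.reg x) (σ.reg y))
  | cluster (σ : Config n) (x v l : ℕ) (a : Fin n) (ha : σ.reg v = (a : ℕ)) :
      Step Λ i c (.cluster x v l) σ (σ.set x (Λ.node σ.forest (σ.reg l) a))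
  | size (σ : Config n) (x v l : ℕ) (a : Fin n) (ha : σ.reg v = (a : ℕ)) :
      Step Λ i c (.size x v l) σ (σ.set x (σ.forest.size (σ.reg l) a))
  | level (σ : Config n) (x u w j : ℕ) (a b : Fin n) (ha : σ.reg u = (a : ℕ)) (hb : σ.reg w = (b : ℕ))
      (h : σ.forest.IsEdge j a b) :
      Step Λ i c (.level x u w) σ (σ.set x j)
  | level_none (σ : Config n) (x u w : ℕ) (a b : Fin n) (ha : σ.reg u = (a : ℕ)) (hb : σ.reg w = (b : ℕ))
      (h : ¬ σ.forest.graph.Adj a b) :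
      Step Λ i c (.level x u w) σ (σ.set x 0)
  | firstEdge (σ : Config n) (f u w v l : ℕ) (a : Fin n) (ha : σ.reg v = (a : ℕ)) :
      Step Λ i c (.firstEdge f u w v l) σ
        (σ.setEdge f u w (Λ.edgeList σ.forest (σ.reg l) a)[0]?)
  | nextEdge (σ : Config n) (f u w j : ℕ) (a b : Fin n) (ha : σ.reg u = (a : ℕ)) (hb : σ.reg w = (b : ℕ))
      (h : σ.forest.IsEdge (j + 1) a b) :
      Step Λ i c (.nextEdge f u w) σ
        (σ.setEdge f u w
          (Λ.edgeList σ.forest j a)[(Λ.edgeList σ.forest j a).idxOf (a, b) + 1]?)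
  | push (σ : Config n) (u w j : ℕ) (a b : Fin n) (ha : σ.reg u = (a : ℕ)) (hb : σ.reg w = (b : ℕ))
      (h : σ.forest.IsEdge (j + 1) a b) (hu : ¬ σ.forest.IsBlocked j a b) :
      Step Λ i c (.push u w) σ { σ with forest := σ.forest.pushDown s(a, b) }
  | mark (σ : Config n) (v : ℕ) (a : Fin n) (ha : σ.reg v = (a : ℕ)) :
      Step Λ i c (.mark v) σ { σ with marks := σ.marks ∪ σ.forest.cluster i a }
  | unmark (σ : Config n) (v : ℕ) (a : Fin n) (ha : σ.reg v = (a : ℕ)) :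
      Step Λ i c (.unmark v) σ { σ with marks := σ.marks \ σ.forest.cluster i a }
  | smallest (σ : Config n) (f v : ℕ) :
      Step Λ i c (.smallest f v) σ
        (σ.setVertex f v (Λ.smallest σ.forest σ.marks i c))

/-- `Exec Λ i c p σ σ' t`: the program `p`, started in `σ`, halts in `σ'` after time `t`. -/
inductive Exec {n : ℕ} (Λ : Layout n) (i : ℕ) (c : Set (Fin n)) :
    Program → Config n → Config n → ℕ → Prop where
  | skip (σ) : Exec Λ i c .skip σ σ 1
  | instr {a σ σ'} (h : Step Λ i c a σ σ') : Exec Λ i c (.instr a) σ σ' (a.time n)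
  | seq {p q σ σ' σ'' s t} (hp : Exec Λ i c p σ σ' s) (hq : Exec Λ i c q σ' σ'' t) :
      Exec Λ i c (.seq p q) σ σ'' (s + t)
  | ite_true {x p q σ σ' t} (hx : σ.reg x ≠ 0) (h : Exec Λ i c p σ σ' t) :
      Exec Λ i c (.ite x p q) σ σ' (t + 1)
  | ite_false {x p q σ σ' t} (hx : σ.reg x = 0) (h : Exec Λ i c q σ σ' t) :
      Exec Λ i c (.ite x p q) σ σ' (t + 1)
  | loop_false {x p σ} (hx : σ.reg x = 0) : Exec Λ i c (.loop x p) σ σ 1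
  | loop_true {x p σ σ' σ'' s t} (hx : σ.reg x ≠ 0) (h : Exec Λ i c p σ σ' s)
      (hl : Exec Λ i c (.loop x p) σ' σ'' t) : Exec Λ i c (.loop x p) σ σ'' (s + t + 1)

/-! ### Connectivity after adding one edge -/

/-! Let `A` and `B` be the two halves, `B` not larger than `A`. Then `n(A) + n(B) ≤ 2^i`, because
their union was one cluster, and `n(c) ≤ 2 · 2^i`. Another child `v` can lose all its blocked edges
only if these led to `X`; then `n(v) + n(A) + n(B) > 2^i` and `v` still has an edge to `A` or `B`
(`IsSplit.halves`, recorded in `Halves.free`). A child is settled when it has a blocked edge or is a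
whole level `i + 1` cluster; the goal is to settle every child.

The basic move pushes an edge down until it is blocked (`FullPush`). It keeps the size invariant and
the invariants of lower levels (`FullPush.blockedBelow`), and settled children stay settled
(`Settled.reach`): the ends of a blocked edge can never be merged, as the result would be too large.
One child is settled by pushing its first edge repeatedly until an attempt fails or no edge is left;
all attempts but the last are paid for by pushes (`Runs.settle`). The difficulty is that many
children may need attention while few pushes are possible.

Light case: some other child `o` has `n(o) + n(A) + n(B) ≤ 2^i`. Then every other child still has a
blocked edge, since otherwise five disjoint clusters would exceed `n(c)` (`Halves.good_of_light`),
and only `A` and `B` have to be settled.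

Heavy case: every other child is too large to be merged with both halves. The edges at `B` are
scanned up to the first blocked one, without being pushed. The `k` edges met are recorded, their far
clusters are marked and distributed by next fit over bins of capacity `2^i`, each of which also
contains `B`. As `n(B) ≤ 2^i / 2`, there are at most six bins (`BinTable.bin_le_six`), so the
fullest one holds at least `k / 6` of the records. If its edges can all be pushed, the pushes pay
for the scan (`Scan.count_le`).

If the fullest bin contains `A`, pushing its edges reunites `A` and `B`, which repairs all other
children (`Halves.good_of_merged`). Otherwise unmarked children are counted up to `k`. If there are
fewer, each of them is settled individually at cost `O(k)`. If there are `k`, the first edge of a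
smallest unmarked child is pushed, again and again, until this fails. Then all unmarked children
have blocked edges (`Halves.merge_event`). Moreover, either merging has made about `k / 2` pushes,
or the child where it stopped and `A` together exceed `2^i`, so that the rest of `c` fits into one
cluster and the edges of the fullest bin can still all be pushed (`Halves.merge_count`).

Finally all recorded edges are tried, which leaves each marked cluster merged with `B` or incident
to a blocked edge, and then `A` and `B` are settled. -/

theorem SimpleGraph.reachable_subset {V : Type*} {G : SimpleGraph V} {D : Set V}
    (hD : ∀ a ∈ D, ∀ b, G.Adj a b → b ∈ D) {x y : V} (h : G.Reachable x y) (hx : x ∈ D) :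
    y ∈ D := by
  obtain ⟨p⟩ := h
  induction p with
  | nil => exact hx
  | cons hadj _ ih => exact ih (hD _ hx _ hadj)

/-- For fixed `x`, the set of `y` described on the right is closed under the edges of `G'`. -/
theorem SimpleGraph.reachable_of_insert_edge {V : Type*} {G G' : SimpleGraph V} {u w : V}
    (hle : G ≤ G') (hnew : G'.Adj u w)
    (hold : ∀ a b, G'.Adj a b → G.Adj a b ∨ (a = u ∧ b = w) ∨ (a = w ∧ b = u)) {x y : V} :
    G'.Reachable x y ↔ G.Reachable x y ∨
      (G.Reachable u x ∨ G.Reachable w x) ∧ (G.Reachable u y ∨ G.Reachable w y) := by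
  constructor
  · intro h
    refine SimpleGraph.reachable_subset (D := {y | G.Reachable x y ∨
      (G.Reachable u x ∨ G.Reachable w x) ∧ (G.Reachable u y ∨ G.Reachable w y)}) ?_ h
      (Or.inl (SimpleGraph.Reachable.refl _))
    intro a ha b hab
    rcases hold a b hab with h1 | ⟨rfl, rfl⟩ | ⟨rfl, rfl⟩
    · rcases ha with ha | ⟨h2, h3⟩
      · exact Or.inl (ha.trans h1.reachable)
      · exact Or.inr ⟨h2, h3.imp (·.trans h1.reachable) (·.trans h1.reachable)⟩
    · rcases ha with ha | ⟨h2, h3⟩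
      · exact Or.inr ⟨Or.inl ha.symm, Or.inr (SimpleGraph.Reachable.refl _)⟩
      · exact Or.inr ⟨h2, Or.inr (SimpleGraph.Reachable.refl _)⟩
    · rcases ha with ha | ⟨h2, h3⟩
      · exact Or.inr ⟨Or.inr ha.symm, Or.inl (SimpleGraph.Reachable.refl _)⟩
      · exact Or.inr ⟨h2, Or.inl (SimpleGraph.Reachable.refl _)⟩
  · rintro (h | ⟨h1, h2⟩)
    · exact h.mono hle
    · have huw : G'.Reachable u w := hnew.reachable
      have h1' : G'.Reachable u x := by
        rcases h1 with h1 | h1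
        · exact h1.mono hle
        · exact huw.trans (h1.mono hle)
      have h2' : G'.Reachable u y := by
        rcases h2 with h2 | h2
        · exact h2.mono hle
        · exact huw.trans (h2.mono hle)
      exact h1'.symm.trans h2'

namespace LeveledGraph

variable {n : ℕ} {S S' S'' : LeveledGraph n} {i j l m : ℕ} {u v w x y : Fin n}
  {c D : Set (Fin n)}

/-! ### Clusters -/

theorem mem_cluster : y ∈ S.cluster j x ↔ (S.upTo j).Reachable x y := by
  unfold cluster
  rw [SimpleGraph.ConnectedComponent.mem_supp_iff, SimpleGraph.ConnectedComponent.eq]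
  exact ⟨fun h => h.symm, fun h => h.symm⟩

theorem self_mem_cluster (S : LeveledGraph n) (j : ℕ) (x : Fin n) : x ∈ S.cluster j x :=
  mem_cluster.2 (SimpleGraph.Reachable.refl _)

theorem cluster_eq_iff : S.cluster j x = S.cluster j y ↔ y ∈ S.cluster j x := by
  constructor
  · intro h; rw [h]; exact self_mem_cluster S j y
  · intro h
    have h := mem_cluster.1 h
    ext z
    rw [mem_cluster, mem_cluster]
    exact ⟨fun k => h.symm.trans k, fun k => h.trans k⟩

theorem cluster_eq_of_mem (h : y ∈ S.cluster j x) : S.cluster j y = S.cluster j x :=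
  (cluster_eq_iff.2 h).symm

theorem mem_cluster_comm : y ∈ S.cluster j x ↔ x ∈ S.cluster j y := by
  rw [← cluster_eq_iff, ← cluster_eq_iff, eq_comm]

theorem disjoint_cluster (h : S.cluster j x ≠ S.cluster j y) :
    Disjoint (S.cluster j x) (S.cluster j y) := by
  rw [Set.disjoint_left]
  intro z hz hz'
  exact h ((cluster_eq_of_mem hz).symm.trans (cluster_eq_of_mem hz'))

theorem size_congr (h : S.cluster j x = S.cluster j y) : S.size j x = S.size j y := by
  unfold size; rw [h]

theorem one_le_size (S : LeveledGraph n) (j : ℕ) (x : Fin n) : 1 ≤ S.size j x := by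
  unfold size
  exact (Set.ncard_pos).2 ⟨x, self_mem_cluster S j x⟩

theorem size_le (S : LeveledGraph n) (j : ℕ) (x : Fin n) : S.size j x ≤ n := by
  unfold size
  calc (S.cluster j x).ncard ≤ (Set.univ : Set (Fin n)).ncard :=
        Set.ncard_le_ncard (Set.subset_univ _)
    _ = n := by rw [Set.ncard_univ, Nat.card_eq_fintype_card, Fintype.card_fin]

theorem IsEdge.symm (h : S.IsEdge j u w) : S.IsEdge j w u :=
  ⟨h.1.symm, by rw [Sym2.eq_swap]; exact h.2⟩

theorem IsBlocked.symm (h : S.IsBlocked j u w) : S.IsBlocked j w u :=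
  ⟨h.1.symm, h.2.1.symm, by rw [add_comm]; exact h.2.2⟩

theorem upTo_mono (h : j ≤ m) : S.upTo j ≤ S.upTo m := fun _ _ hab => ⟨hab.1, hab.2.trans h⟩

theorem cluster_mono (h : j ≤ m) : S.cluster j x ⊆ S.cluster m x := fun _ hy =>
  mem_cluster.2 ((mem_cluster.1 hy).mono (upTo_mono h))

theorem mem_cluster_of_level_le (h : S.graph.Adj u w) (hl : S.level s(u, w) ≤ j) :
    w ∈ S.cluster j u :=
  mem_cluster.2 (SimpleGraph.Adj.reachable (G := S.upTo j) ⟨h, hl⟩)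

theorem cluster_congr_upTo (h : S'.upTo j = S.upTo j) (x : Fin n) :
    S'.cluster j x = S.cluster j x := by
  unfold cluster; rw [h]

theorem size_congr_upTo (h : S'.upTo j = S.upTo j) (x : Fin n) :
    S'.size j x = S.size j x := by
  unfold size; rw [cluster_congr_upTo h]

/-- Levels start at one, so `G_0` has no edges. This is what makes a level one edge always blocked.
-/
theorem not_mem_cluster_zero (h : u ≠ w) : w ∉ S.cluster 0 u := by
  intro hm
  refine h ?_
  refine (SimpleGraph.reachable_subset (G := S.upTo 0) (D := {u}) ?_ (mem_cluster.1 hm) rfl).symm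
  rintro a rfl b hab
  have := S.one_le_level s(a, b) hab.1
  have := hab.2
  omega

/-- `D` is a union of level `j` clusters. -/
def Closed (S : LeveledGraph n) (j : ℕ) (D : Set (Fin n)) : Prop := ∀ v ∈ D, S.cluster j v ⊆ D

theorem closed_of_adj (h : ∀ a ∈ D, ∀ b, S.graph.Adj a b → S.level s(a, b) ≤ j → b ∈ D) :
    S.Closed j D := fun _ hv _ hy =>
  SimpleGraph.reachable_subset (G := S.upTo j) (fun a ha b hab => h a ha b hab.1 hab.2)
    (mem_cluster.1 hy) hv

theorem closed_cluster (S : LeveledGraph n) (j : ℕ) (x : Fin n) : S.Closed j (S.cluster j x) :=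
  fun _ hv => (cluster_eq_of_mem hv).subset

theorem Closed.diff {E : Set (Fin n)} (hD : S.Closed j D) (hE : S.Closed j E) :
    S.Closed j (D \ E) := by
  intro v hv y hy
  refine ⟨hD v hv.1 hy, fun h => hv.2 ?_⟩
  exact hE y h (mem_cluster_comm.1 hy)

theorem Closed.union {E : Set (Fin n)} (hD : S.Closed j D) (hE : S.Closed j E) :
    S.Closed j (D ∪ E) := by
  rintro v (hv | hv) y hy
  · exact Or.inl (hD v hv hy)
  · exact Or.inr (hE v hv hy)

/-- The sizes of distinct clusters inside a set add up to at most its size. -/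
theorem sum_size_le {L : List (Fin n)} :
    ∀ {D : Set (Fin n)}, (∀ v ∈ L, S.cluster j v ⊆ D) →
      L.Pairwise (fun a b => S.cluster j a ≠ S.cluster j b) →
      (L.map (S.size j)).sum ≤ D.ncard := by
  induction L with
  | nil => intro D _ _; simp
  | cons a L ih =>
    intro D hD hp
    rw [List.pairwise_cons] at hp
    have h1 : ∀ v ∈ L, S.cluster j v ⊆ D \ S.cluster j a := by
      intro v hv
      refine Set.subset_sdiff.2 ⟨hD v (List.mem_cons_of_mem _ hv), ?_⟩
      exact disjoint_cluster (hp.1 v hv).symm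
    have h2 := ih h1 hp.2
    have h3 : (D \ S.cluster j a).ncard + (S.cluster j a).ncard = D.ncard :=
      Set.ncard_sdiff_add_ncard_of_subset (hD a List.mem_cons_self)
    rw [List.map_cons, List.sum_cons]
    unfold size at *
    omega

theorem size_add_size_le (h : S.cluster j u ≠ S.cluster j w) (hu : S.cluster j u ⊆ D)
    (hw : S.cluster j w ⊆ D) : S.size j u + S.size j w ≤ D.ncard := by
  have := sum_size_le (S := S) (j := j) (L := [u, w]) (D := D) (by simp [hu, hw]) (by simp [h])
  simpa using this

theorem size_eq_add (h : S.cluster j u ≠ S.cluster j w) (hD : D = S.cluster j u ∪ S.cluster j w) :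
    D.ncard = S.size j u + S.size j w := by
  rw [hD, Set.ncard_union_eq (disjoint_cluster h)]; rfl

/-! ### Lowering one edge -/

/-- `S'` arises from `S` by lowering the level `i + 1` edge `u w` to level `l + 1`, where it was
unblocked at every level it left. -/
structure Lowered (S S' : LeveledGraph n) (i l : ℕ) (u w : Fin n) : Prop where
  edge : S.IsEdge (i + 1) u w
  le : l ≤ i
  graph_eq : S'.graph = S.graph
  level_self : S'.level s(u, w) = l + 1
  level_ne : ∀ e ≠ s(u, w), S'.level e = S.level e
  unblocked : ∀ k, l < k → k ≤ i →
    S.cluster k u = S.cluster k w ∨ S.size k u + S.size k w ≤ 2 ^ k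

theorem Lowered.refl (h : S.IsEdge (i + 1) u w) : Lowered S S i i u w :=
  ⟨h, le_rfl, rfl, h.2, fun _ _ => rfl, fun k h1 _ => by omega⟩

theorem Lowered.upTo_le (h : Lowered S S' i l u w) (hm : m ≤ l) : S'.upTo m = S.upTo m := by
  ext a b
  simp only [upTo, h.graph_eq]
  refine and_congr_right fun _ => ?_
  by_cases he : s(a, b) = s(u, w)
  · rw [he, h.level_self, h.edge.2]; have := h.le; omega
  · rw [h.level_ne _ he]

theorem Lowered.upTo_ge (h : Lowered S S' i l u w) (hm : i < m) : S'.upTo m = S.upTo m := by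
  ext a b
  simp only [upTo, h.graph_eq]
  refine and_congr_right fun _ => ?_
  by_cases he : s(a, b) = s(u, w)
  · rw [he, h.level_self, h.edge.2]; have := h.le; omega
  · rw [h.level_ne _ he]

/-- The edge enters `G_m` exactly for `l < m ≤ i`. For `m > i` it was there before, and then the
second alternative implies the first one. -/
theorem Lowered.mem_cluster_iff (h : Lowered S S' i l u w) (h1 : l < m) :
    y ∈ S'.cluster m x ↔ y ∈ S.cluster m x ∨
      (x ∈ S.cluster m u ∨ x ∈ S.cluster m w) ∧ (y ∈ S.cluster m u ∨ y ∈ S.cluster m w) := by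
  simp only [mem_cluster]
  refine SimpleGraph.reachable_of_insert_edge (u := u) (w := w) ?_ ?_ ?_
  · intro a b hab
    refine ⟨by rw [h.graph_eq]; exact hab.1, ?_⟩
    by_cases he : s(a, b) = s(u, w)
    · rw [he, h.level_self]; omega
    · rw [h.level_ne _ he]; exact hab.2
  · exact ⟨by rw [h.graph_eq]; exact h.edge.1, by rw [h.level_self]; omega⟩
  · intro a b hab
    by_cases he : s(a, b) = s(u, w)
    · rw [Sym2.eq_iff] at he; exact Or.inr he
    · have h3 := hab.2
      rw [h.level_ne _ he] at h3
      exact Or.inl ⟨by rw [← h.graph_eq]; exact hab.1, h3⟩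

theorem Lowered.cluster_subset (h : Lowered S S' i l u w) (m : ℕ) (x : Fin n) :
    S.cluster m x ⊆ S'.cluster m x := by
  rcases Nat.lt_or_ge l m with h1 | h1
  · rcases Nat.lt_or_ge i m with h2 | h2
    · exact (cluster_congr_upTo (h.upTo_ge h2) x).symm.subset
    · intro y hy; exact (h.mem_cluster_iff h1).2 (Or.inl hy)
  · exact (cluster_congr_upTo (h.upTo_le h1) x).symm.subset

theorem Lowered.cluster_of_mem (h : Lowered S S' i l u w) (h1 : l < m)
    (hx : x ∈ S.cluster m u ∨ x ∈ S.cluster m w) :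
    S'.cluster m x = S.cluster m u ∪ S.cluster m w := by
  ext y
  rw [h.mem_cluster_iff h1, Set.mem_union]
  constructor
  · rintro (hy | ⟨_, hy⟩)
    · rcases hx with hx | hx
      · left; rwa [cluster_eq_of_mem hx] at hy
      · right; rwa [cluster_eq_of_mem hx] at hy
    · exact hy
  · exact fun hy => Or.inr ⟨hx, hy⟩

theorem Lowered.cluster_of_not_mem (h : Lowered S S' i l u w)
    (hx : ¬ (x ∈ S.cluster m u ∨ x ∈ S.cluster m w)) :
    S'.cluster m x = S.cluster m x := by
  rcases Nat.lt_or_ge l m with h1 | h1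
  · rcases Nat.lt_or_ge i m with h2 | h2
    · exact cluster_congr_upTo (h.upTo_ge h2) x
    · ext y
      rw [h.mem_cluster_iff h1]
      simp [hx]
  · exact cluster_congr_upTo (h.upTo_le h1) x

theorem Lowered.sizeInvariant (h : Lowered S S' i l u w) (hS : S.SizeInvariant) :
    S'.SizeInvariant := by
  intro m x
  rcases Nat.lt_or_ge l m with h1 | h1
  · rcases Nat.lt_or_ge i m with h2 | h2
    · rw [size_congr_upTo (h.upTo_ge h2)]; exact hS m x
    · by_cases hx : x ∈ S.cluster m u ∨ x ∈ S.cluster m w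
      · unfold size
        rw [h.cluster_of_mem h1 hx]
        rcases h.unblocked m h1 h2 with h3 | h3
        · rw [h3, Set.union_self]; exact hS m w
        · exact (Set.ncard_union_le _ _).trans h3
      · unfold size; rw [h.cluster_of_not_mem hx]; exact hS m x
  · rw [size_congr_upTo (h.upTo_le h1)]; exact hS m x

/-- The level `i + 1` edge `u w` is pushed down as far as possible, by at least one level. -/
def FullPush (S S' : LeveledGraph n) (i : ℕ) (u w : Fin n) : Prop :=
  ∃ l < i, Lowered S S' i l u w ∧ S'.IsBlocked l u w

theorem FullPush.edge (h : FullPush S S' i u w) : S.IsEdge (i + 1) u w := by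
  obtain ⟨l, _, h, _⟩ := h; exact h.edge

theorem FullPush.cluster_of_mem (h : FullPush S S' i u w)
    (hx : x ∈ S.cluster i u ∨ x ∈ S.cluster i w) :
    S'.cluster i x = S.cluster i u ∪ S.cluster i w := by
  obtain ⟨l, hl, h, _⟩ := h; exact h.cluster_of_mem hl hx

theorem FullPush.cluster_of_not_mem (h : FullPush S S' i u w)
    (hx : ¬ (x ∈ S.cluster i u ∨ x ∈ S.cluster i w)) :
    S'.cluster i x = S.cluster i x := by
  obtain ⟨l, hl, h, _⟩ := h; exact h.cluster_of_not_mem hx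

/-- A push only merges the clusters of its two ends. This keeps a set that contains a whole bin
closed while the edges of the bin are pushed. -/
theorem FullPush.closed (h : FullPush S S' i u w) (hD : S.Closed i D) (huw : u ∈ D ↔ w ∈ D) :
    S'.Closed i D := by
  intro v hv
  by_cases hx : v ∈ S.cluster i u ∨ v ∈ S.cluster i w
  · rw [h.cluster_of_mem hx]
    have hu : u ∈ D := by
      rcases hx with hx | hx
      · exact hD v hv (mem_cluster_comm.1 hx)
      · exact huw.2 (hD v hv (mem_cluster_comm.1 hx))
    exact Set.union_subset (hD u hu) (hD w (huw.1 hu))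
  · rw [h.cluster_of_not_mem hx]; exact hD v hv

/-- Pushing down an edge as far as possible keeps the blocked edge invariant on all lower
levels. -/
theorem FullPush.blockedBelow (h : FullPush S S' i u w) (hS : S.BlockedBelow i c) : S'.BlockedBelow i c := by
  obtain ⟨l, hl, h, hb⟩ := h
  intro j hj A hA hcl
  obtain ⟨v, rfl⟩ := hcl
  -- the cluster and its children before the push
  have hsub : ∀ x ∈ S'.cluster (j + 1) v, S.cluster (j + 1) x ⊆ c := by
    intro x hx
    refine (h.cluster_subset _ x).trans ?_
    rw [cluster_eq_of_mem hx]; exact hA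
  have hBI : ∀ x ∈ S'.cluster (j + 1) v, S.BlockedInvariant j (S.cluster (j + 1) x) :=
    fun x hx => hS j hj _ (hsub x hx) ⟨x, rfl⟩
  have hlev : ∀ a b, S.IsEdge (j + 1) a b → S'.IsEdge (j + 1) a b := by
    intro a b hab
    refine ⟨by rw [h.graph_eq]; exact hab.1, ?_⟩
    rw [h.level_ne _ ?_]; · exact hab.2
    intro he
    have h1 := hab.2
    rw [he, h.edge.2] at h1
    omega
  have hsz : ∀ m x, S.size m x ≤ S'.size m x := fun m x =>
    Set.ncard_le_ncard (h.cluster_subset m x)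
  -- blocked edges stay blocked
  have hkeep : ∀ a b, S.IsBlocked j a b → S'.IsBlocked j a b := by
    intro a b hab
    refine ⟨hlev a b hab.1, ?_, hab.2.2.trans_le (Nat.add_le_add (hsz j a) (hsz j b))⟩
    rcases Nat.lt_or_ge l j with h1 | h1
    · intro heq
      have hb' : b ∈ S'.cluster j a := cluster_eq_iff.1 heq
      rw [h.mem_cluster_iff h1] at hb'
      rcases hb' with hb' | ⟨ha, hb'⟩
      · exact hab.2.1 (cluster_eq_iff.2 hb')
      -- If the push had united the ends of the blocked edge `a b`, their clusters would be those of
      -- `u` and `w`, whose sizes add up to at most `2 ^ j` because `u w` was unblocked here.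
      · rcases h.unblocked j h1 hj.le with h3 | h3
        · rw [h3, or_self] at ha hb'
          exact hab.2.1 ((cluster_eq_of_mem ha).trans (cluster_eq_of_mem hb').symm)
        · have hlt := hab.2.2
          have hne := hab.2.1
          rcases ha with ha | ha <;> rcases hb' with hb' | hb' <;>
            have e1 := cluster_eq_of_mem ha <;> have e2 := cluster_eq_of_mem hb' <;>
            have s1 := size_congr e1 <;> have s2 := size_congr e2
          · exact hne (e1.trans e2.symm)
          · omega
          · omega
          · exact hne (e1.trans e2.symm)
    · rw [cluster_congr_upTo (h.upTo_le h1), cluster_congr_upTo (h.upTo_le h1)]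
      exact hab.2.1
  -- a child with a blocked edge before the push
  have hgood : ∀ y, (∃ a ∈ S.cluster j y, ∃ b, S.IsBlocked j a b) →
      ∃ a ∈ S'.cluster j y, ∃ b, S'.IsBlocked j a b := by
    rintro y ⟨a, ha, b, hab⟩
    exact ⟨a, h.cluster_subset j y ha, b, hkeep a b hab⟩
  have hchild : ∀ x ∈ S'.cluster (j + 1) v,
      (∃ a ∈ S.cluster j x, ∃ b, S.IsBlocked j a b) ∨ S.cluster j x = S.cluster (j + 1) x := by
    intro x hx
    rcases hBI x hx with h1 | ⟨Y, -, hY⟩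
    · exact Or.inl (h1 _ ⟨⟨x, rfl⟩, cluster_mono (Nat.le_succ j)⟩)
    · right
      refine Set.Subset.antisymm (cluster_mono (Nat.le_succ j)) fun z hz => ?_
      have h1 := hY (S.cluster j x) ⟨⟨x, rfl⟩, cluster_mono (Nat.le_succ j)⟩
      have h2 := hY (S.cluster j z) ⟨⟨z, rfl⟩, by
        rw [← cluster_eq_of_mem hz]; exact cluster_mono (Nat.le_succ j)⟩
      rw [h1, ← h2]; exact self_mem_cluster S j z
  by_cases hex : ∃ x ∈ S'.cluster (j + 1) v,
      ¬ (∃ a ∈ S'.cluster j x, ∃ b, S'.IsBlocked j a b)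
  · -- a child without blocked edge is the only child
    obtain ⟨x, hx, hxb⟩ := hex
    have hx1 : S.cluster j x = S.cluster (j + 1) x :=
      (hchild x hx).resolve_left fun h1 => hxb (hgood x h1)
    suffices hone : S'.cluster j x = S'.cluster (j + 1) v by
      right
      refine ⟨S'.cluster j x, ⟨⟨x, rfl⟩, hone.subset⟩, ?_⟩
      rintro Y ⟨⟨y, rfl⟩, hy⟩
      rw [← cluster_eq_iff.2]
      rw [hone]; exact hy (self_mem_cluster _ _ _)
    rw [← cluster_eq_of_mem hx]
    rcases Nat.lt_or_ge l (j + 1) with h1 | h1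
    · by_cases hxu : x ∈ S.cluster (j + 1) u ∨ x ∈ S.cluster (j + 1) w
      · have hxu' : x ∈ S.cluster j u ∨ x ∈ S.cluster j w := by
          refine hxu.imp (fun h2 => ?_) (fun h2 => ?_) <;>
          · rw [mem_cluster_comm, hx1, mem_cluster_comm]; exact h2
        have hall : S'.cluster (j + 1) x = S.cluster (j + 1) u ∪ S.cluster (j + 1) w :=
          h.cluster_of_mem h1 hxu
        have hu' : u ∈ S'.cluster (j + 1) v := by
          rw [← cluster_eq_of_mem hx, hall]; exact Or.inl (self_mem_cluster _ _ _)
        have hw' : w ∈ S'.cluster (j + 1) v := by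
          rw [← cluster_eq_of_mem hx, hall]; exact Or.inr (self_mem_cluster _ _ _)
        rcases Nat.lt_or_ge l j with h2 | h2
        · have hj' : S'.cluster j x = S.cluster j u ∪ S.cluster j w :=
            h.cluster_of_mem h2 hxu'
          -- The merged child would inherit a blocked edge from either part. So both parts were the
          -- only children of their level `j + 1` clusters, and their union is the only child of the
          -- merged one.
          have hno : ∀ z, z ∈ S.cluster j u ∨ z ∈ S.cluster j w →
              ¬ (∃ a ∈ S.cluster j z, ∃ b, S.IsBlocked j a b) := by
            intro z hz h3
            apply hxb
            rw [hj', ← h.cluster_of_mem h2 hz]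
            exact hgood z h3
          have hu1 := (hchild u hu').resolve_left (hno u (Or.inl (self_mem_cluster _ _ _)))
          have hw1 := (hchild w hw').resolve_left (hno w (Or.inr (self_mem_cluster _ _ _)))
          rw [hj', hall, hu1, hw1]
        · -- the pushed edge is blocked on this level
          have hjl : j = l := by omega
          subst hjl
          exfalso
          apply hxb
          rw [cluster_congr_upTo (h.upTo_le le_rfl)]
          rcases hxu' with h3 | h3
          · exact ⟨u, mem_cluster_comm.1 h3, w, hb⟩
          · exact ⟨w, mem_cluster_comm.1 h3, u, hb.symm⟩
      · rw [h.cluster_of_not_mem hxu, ← hx1]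
        rw [h.cluster_of_not_mem]
        exact fun h2 => hxu (h2.imp (fun h3 => cluster_mono (Nat.le_succ j) h3)
          (fun h3 => cluster_mono (Nat.le_succ j) h3))
    · rw [cluster_congr_upTo (h.upTo_le h1), cluster_congr_upTo (h.upTo_le (by omega)), hx1]
  · push Not at hex
    left
    rintro Y ⟨⟨y, rfl⟩, hy⟩
    exact hex y (hy (self_mem_cluster _ _ _))

end LeveledGraph

namespace LeveledGraph

variable {n : ℕ} {S S' S'' : LeveledGraph n} {i j l m : ℕ} {u v w x y : Fin n}
  {c D : Set (Fin n)}

/-! ### Sequences of pushes -/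

/-- `S'` arises from `S` by pushing down level `i + 1` edges inside `c`, while keeping the size
invariant and the blocked edge invariants on lower levels. -/
structure Reach (i : ℕ) (c : Set (Fin n)) (S S' : LeveledGraph n) : Prop where
  graph_eq : S'.graph = S.graph
  level_le : ∀ e, S'.level e ≤ S.level e
  frame : ∀ e, S'.level e ≠ S.level e →
    S'.level e ≤ i ∧ ∃ u ∈ c, ∃ w ∈ c, e = s(u, w) ∧ S.IsEdge (i + 1) u w
  sizeInvariant : S'.SizeInvariant
  below : S.BlockedBelow i c → S'.BlockedBelow i c

theorem Reach.refl (h : S.SizeInvariant) : Reach i c S S :=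
  ⟨rfl, fun _ => le_rfl, fun _ he => absurd rfl he, h, id⟩

theorem Reach.trans (h : Reach i c S S') (h' : Reach i c S' S'') : Reach i c S S'' := by
  refine ⟨h'.graph_eq.trans h.graph_eq, fun e => (h'.level_le e).trans (h.level_le e), ?_,
    h'.sizeInvariant, h'.below ∘ h.below⟩
  intro e he
  by_cases h1 : S'.level e = S.level e
  · obtain ⟨h2, u, hu, w, hw, rfl, h3⟩ := h'.frame e (by rw [h1]; exact he)
    refine ⟨h2, u, hu, w, hw, rfl, ?_, ?_⟩
    · rw [← h.graph_eq]; exact h3.1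
    · rw [← h1]; exact h3.2
  · obtain ⟨h2, h3⟩ := h.frame e h1
    exact ⟨(h'.level_le e).trans h2, h3⟩

theorem FullPush.reach (h : FullPush S S' i u w) (hS : S.SizeInvariant) (hu : u ∈ c)
    (hw : w ∈ c) : Reach i c S S' := by
  have hb := h.blockedBelow (c := c)
  obtain ⟨l, hl, h, hbl⟩ := h
  refine ⟨h.graph_eq, fun e => ?_, fun e he => ?_, h.sizeInvariant hS, hb⟩
  · by_cases he : e = s(u, w)
    · rw [he, h.level_self, h.edge.2]; omega
    · exact (h.level_ne e he).le
  · by_cases h1 : e = s(u, w)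
    · subst h1; exact ⟨by rw [h.level_self]; omega, u, hu, w, hw, rfl, h.edge⟩
    · exact absurd (h.level_ne e h1) he

theorem FullPush.level_le (h : FullPush S S' i u w) : S'.level s(u, w) ≤ i := by
  obtain ⟨l, hl, h, hbl⟩ := h
  rw [h.level_self]; omega

namespace Reach

theorem pushedWithin (h : Reach i c S S') : PushedWithin S S' i c :=
  ⟨h.graph_eq, h.level_le, fun e he => (h.frame e he).2⟩

theorem cluster_subset (h : Reach i c S S') (x : Fin n) : S.cluster i x ⊆ S'.cluster i x := by
  intro y hy
  refine mem_cluster.2 ((mem_cluster.1 hy).mono ?_)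
  intro a b hab
  exact ⟨by rw [h.graph_eq]; exact hab.1, (h.level_le _).trans hab.2⟩

theorem size_le (h : Reach i c S S') (x : Fin n) : S.size i x ≤ S'.size i x :=
  Set.ncard_le_ncard (h.cluster_subset x)

/-- Edges only move from level `i + 1` to lower levels, which is invisible in `G_{i+1}`. -/
theorem upTo_succ (h : Reach i c S S') : S'.upTo (i + 1) = S.upTo (i + 1) := by
  ext a b
  simp only [upTo, h.graph_eq]
  refine and_congr_right fun _ => ?_
  by_cases he : S'.level s(a, b) = S.level s(a, b)
  · rw [he]
  · obtain ⟨h1, u, _, w, _, h2, h3⟩ := h.frame _ he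
    rw [h2] at h1 ⊢
    rw [h3.2]
    omega

theorem cluster_succ (h : Reach i c S S') (x : Fin n) :
    S'.cluster (i + 1) x = S.cluster (i + 1) x := cluster_congr_upTo h.upTo_succ x

/-- The ends of a lowered edge are in one cluster. -/
theorem mem_cluster_of_level (h : Reach i c S S') (hab : S.graph.Adj u w)
    (hl : S'.level s(u, w) ≠ S.level s(u, w)) : w ∈ S'.cluster i u :=
  mem_cluster_of_level_le (by rw [h.graph_eq]; exact hab) (h.frame _ hl).1

theorem isEdge (h : Reach i c S S') (he : S.IsEdge (i + 1) u w)
    (hne : w ∉ S'.cluster i u) : S'.IsEdge (i + 1) u w := by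
  refine ⟨by rw [h.graph_eq]; exact he.1, ?_⟩
  by_contra h1
  exact hne (h.mem_cluster_of_level he.1 (by rw [he.2]; exact h1))

theorem isEdge_of (h : Reach i c S S') (he : S'.IsEdge (i + 1) u w) : S.IsEdge (i + 1) u w := by
  refine ⟨by rw [← h.graph_eq]; exact he.1, ?_⟩
  by_contra h1
  have h2 : S'.level s(u, w) ≠ S.level s(u, w) := by rw [he.2]; exact Ne.symm h1
  have := (h.frame _ h2).1
  rw [he.2] at this
  omega

/-- Two clusters that are too large for one cluster can never be merged while the size invariant
holds. Hence blocked edges of level `i + 1` stay blocked. -/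
theorem ne_of_lt (h : Reach i c S S') (hne : S.cluster i u ≠ S.cluster i w)
    (hs : 2 ^ i < S.size i u + S.size i w) : S'.cluster i u ≠ S'.cluster i w := by
  intro heq
  have h1 := size_add_size_le hne (h.cluster_subset u) (heq ▸ h.cluster_subset w)
  have h2 := h.sizeInvariant i u
  unfold size at h1 h2 hs
  omega

theorem isBlocked (h : Reach i c S S') (hb : S.IsBlocked i u w) : S'.IsBlocked i u w := by
  have hne := h.ne_of_lt hb.2.1 hb.2.2
  exact ⟨h.isEdge hb.1 fun h1 => hne (cluster_eq_iff.2 h1), hne,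
    hb.2.2.trans_le (Nat.add_le_add (h.size_le u) (h.size_le w))⟩

end Reach

/-- The level `i` cluster of `v` is incident to a blocked edge. -/
def Good (S : LeveledGraph n) (i : ℕ) (v : Fin n) : Prop :=
  ∃ u ∈ S.cluster i v, ∃ w, S.IsBlocked i u w

/-- The level `i` cluster of `v` is incident to a blocked edge, or it is a whole level `i + 1`
cluster. -/
def Settled (S : LeveledGraph n) (i : ℕ) (v : Fin n) : Prop :=
  S.Good i v ∨ S.cluster i v = S.cluster (i + 1) v

theorem Good.congr (h : S.Good i v) (he : x ∈ S.cluster i v) : S.Good i x := by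
  unfold Good; rw [cluster_eq_of_mem he]; exact h

theorem IsBlocked.good_left (h : S.IsBlocked i u w) : S.Good i u :=
  ⟨u, self_mem_cluster _ _ _, w, h⟩

theorem IsBlocked.good_right (h : S.IsBlocked i u w) : S.Good i w := h.symm.good_left

theorem Settled.congr (h : S.Settled i v) (he : x ∈ S.cluster i v) : S.Settled i x := by
  rcases h with h | h
  · exact Or.inl (h.congr he)
  · right
    rw [cluster_eq_of_mem he, h]
    exact (cluster_eq_of_mem (cluster_mono (Nat.le_succ i) he)).symm

theorem Good.reach (h : S.Good i v) (hr : Reach i c S S') : S'.Good i v := by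
  obtain ⟨u, hu, w, hb⟩ := h
  exact ⟨u, hr.cluster_subset v hu, w, hr.isBlocked hb⟩

/-- Both alternatives survive further pushes: blocked edges stay blocked, and level `i + 1` clusters
do not change. So children can be settled one after another. -/
theorem Settled.reach (h : S.Settled i v) (hr : Reach i c S S') : S'.Settled i v := by
  rcases h with h | h
  · exact Or.inl (h.reach hr)
  · right
    refine Set.Subset.antisymm (cluster_mono (Nat.le_succ i)) ?_
    rw [hr.cluster_succ, ← h]
    exact hr.cluster_subset v

/-- A child that fills its level `i + 1` cluster is the only one there. If no child does, all of
them must have blocked edges. -/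
theorem blockedInvariant_of_settled (h : ∀ v ∈ c, S.Settled i v) {A : Set (Fin n)} (hA : A ⊆ c)
    (hcl : S.IsCluster (i + 1) A) : S.BlockedInvariant i A := by
  obtain ⟨v, rfl⟩ := hcl
  by_cases hex : ∃ x ∈ S.cluster (i + 1) v, S.cluster i x = S.cluster (i + 1) x
  · obtain ⟨x, hx, hx1⟩ := hex
    right
    rw [cluster_eq_of_mem hx] at hx1
    refine ⟨S.cluster i x, ⟨⟨x, rfl⟩, hx1.subset⟩, ?_⟩
    rintro Y ⟨⟨y, rfl⟩, hy⟩
    refine cluster_eq_of_mem ?_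
    rw [hx1]; exact hy (self_mem_cluster _ _ _)
  · left
    rintro Y ⟨⟨y, rfl⟩, hy⟩
    have hy' := hy (self_mem_cluster _ _ _)
    exact (h y (hA hy')).resolve_right fun h1 => hex ⟨y, hy', h1⟩

theorem settled_of_no_edge (h : ∀ u ∈ S.cluster i v, ∀ w, ¬ S.IsEdge (i + 1) u w) :
    S.Settled i v := by
  right
  refine Set.Subset.antisymm (cluster_mono (Nat.le_succ i)) ?_
  refine closed_of_adj (j := i + 1) ?_ v (self_mem_cluster _ _ _)
  intro a ha b hab hl
  rcases Nat.lt_or_ge (S.level s(a, b)) (i + 1) with h1 | h1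
  · exact closed_cluster S i v a ha (mem_cluster_of_level_le hab (by omega))
  · exact absurd ⟨hab, by omega⟩ (h a ha b)

/-! ### Counting pushes -/

theorem pushCount_self (S : LeveledGraph n) : pushCount S S = 0 := by simp [pushCount]

/-- Levels only decrease along the two stages, so the truncated differences add up. -/
theorem Reach.pushCount_add (h : Reach i c S S') (h' : Reach i c S' S'') :
    pushCount S S'' = pushCount S S' + pushCount S' S'' := by
  unfold pushCount
  rw [← Finset.sum_add_distrib]
  refine Finset.sum_congr rfl fun e _ => ?_
  have := h.level_le e
  have := h'.level_le e
  omega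

theorem Lowered.pushCount_eq (h : Lowered S S' i l u w) : pushCount S S' = i - l := by
  unfold pushCount
  rw [Finset.sum_eq_single s(u, w)]
  · rw [h.level_self, h.edge.2]; omega
  · intro e _ he; rw [h.level_ne e he]; omega
  · intro he; exact absurd (Finset.mem_univ _) he

theorem FullPush.one_le_pushCount (h : FullPush S S' i u w) : 1 ≤ pushCount S S' := by
  obtain ⟨l, hl, h, _⟩ := h
  rw [h.pushCount_eq]; omega

/-- Distinct ordered pairs whose edges have been lowered: at most two for each push. -/
theorem Reach.card_le (h : Reach i c S S') {ι : Type*} (K : Finset ι) (f : ι → Fin n × Fin n)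
    (hf : Set.InjOn f K) (hl : ∀ k ∈ K, S'.level s((f k).1, (f k).2) ≠ S.level s((f k).1, (f k).2)) :
    K.card ≤ 2 * pushCount S S' := by
  classical
  let g : ι → Sym2 (Fin n) := fun k => s((f k).1, (f k).2)
  have h1 : (K.image g).card ≤ pushCount S S' := by
    unfold pushCount
    calc (K.image g).card = ∑ e ∈ K.image g, 1 := by simp
      _ ≤ ∑ e ∈ K.image g, (S.level e - S'.level e) := by
          refine Finset.sum_le_sum fun e he => ?_
          obtain ⟨k, hk, rfl⟩ := Finset.mem_image.1 he
          have h2 := hl k hk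
          have h3 := h.level_le (g k)
          simp only [g] at h3 ⊢
          omega
      _ ≤ _ := Finset.sum_le_sum_of_subset (Finset.subset_univ _)
  -- An unordered edge arises from at most its two orientations; edge lists contain a self-loop of
  -- the cluster graph in both of them.
  have h2 : K.card ≤ 2 * (K.image g).card := by
    refine Finset.card_le_mul_card_image K 2 fun e _ => ?_
    rw [← Finset.card_image_of_injOn (hf.mono (Finset.coe_subset.2 (Finset.filter_subset _ _)))]
    induction e using Sym2.ind with
    | _ a b =>
      calc _ ≤ ({(a, b), (b, a)} : Finset (Fin n × Fin n)).card := by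
            refine Finset.card_le_card fun p hp => ?_
            obtain ⟨k, hk, rfl⟩ := Finset.mem_image.1 hp
            have h3 := (Finset.mem_filter.1 hk).2
            simp only [g, Sym2.eq_iff] at h3
            rcases h3 with ⟨h4, h5⟩ | ⟨h4, h5⟩
            · simp [Prod.ext_iff, h4, h5]
            · simp [Prod.ext_iff, h4, h5]
        _ ≤ 2 := Finset.card_le_two
  omega

/-- A cluster that has grown is left by a lowered edge. -/
theorem Reach.exists_lowered (h : Reach i c S S') (hne : S'.cluster i x ≠ S.cluster i x) :
    ∃ a ∈ S.cluster i x, ∃ b, S'.level s(a, b) ≠ S.level s(a, b) := by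
  by_contra hcon
  push Not at hcon
  refine hne (Set.Subset.antisymm ?_ (h.cluster_subset x))
  refine closed_of_adj (j := i) ?_ x (self_mem_cluster _ _ _)
  intro a ha b hab hl
  rw [h.graph_eq] at hab
  rw [hcon a ha b] at hl
  exact closed_cluster S i x a ha (mem_cluster_of_level_le hab hl)

end LeveledGraph

/-! ### Verification of programs -/

/-- Writing a value that is known to fit into a word. -/
def Config.put {n : ℕ} (σ : Config n) (x a : ℕ) : Config n :=
  { σ with reg := Function.update σ.reg x a }

/-- Writing a value that is known to fit into a word to the memory. -/
def Config.poke {n : ℕ} (σ : Config n) (x a : ℕ) : Config n :=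
  { σ with mem := Function.update σ.mem x a }

namespace Config

variable {n : ℕ}

@[simp] theorem put_reg (σ : Config n) (x a y : ℕ) :
    (σ.put x a).reg y = if y = x then a else σ.reg y := by
  simp [put, Function.update_apply]

@[simp] theorem put_forest (σ : Config n) (x a : ℕ) : (σ.put x a).forest = σ.forest := rfl
@[simp] theorem put_marks (σ : Config n) (x a : ℕ) : (σ.put x a).marks = σ.marks := rfl
@[simp] theorem put_mem (σ : Config n) (x a : ℕ) : (σ.put x a).mem = σ.mem := rfl
@[simp] theorem poke_reg (σ : Config n) (x a : ℕ) : (σ.poke x a).reg = σ.reg := rfl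
@[simp] theorem poke_forest (σ : Config n) (x a : ℕ) : (σ.poke x a).forest = σ.forest := rfl
@[simp] theorem poke_marks (σ : Config n) (x a : ℕ) : (σ.poke x a).marks = σ.marks := rfl

@[simp] theorem poke_mem (σ : Config n) (x a y : ℕ) :
    (σ.poke x a).mem y = if y = x then a else σ.mem y := by
  simp [poke, Function.update_apply]

theorem set_eq_put (σ : Config n) {x a : ℕ} (h : a < (n + 2) ^ 8) : σ.set x a = σ.put x a := by
  rw [set, put, Nat.mod_eq_of_lt h]

theorem write_eq_poke (σ : Config n) {x a : ℕ} (h : a < (n + 2) ^ 8) :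
    σ.write x a = σ.poke x a := by
  rw [write, poke, Nat.mod_eq_of_lt h]

end Config

/-- The largest numbers that occur are addresses near `8 k` with `k ≤ n * n`, since an edge list
consists of distinct ordered pairs. They fit into a word without wrapping around. -/
theorem word_bound (n : ℕ) : 64 * (n * n + 4 * n + 4) ≤ (n + 2) ^ 8 := by
  have h1 : 2 ^ 6 ≤ (n + 2) ^ 6 := Nat.pow_le_pow_left (by omega) 6
  calc 64 * (n * n + 4 * n + 4) = 2 ^ 6 * (n + 2) ^ 2 := by ring
    _ ≤ (n + 2) ^ 6 * (n + 2) ^ 2 := Nat.mul_le_mul_right _ h1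
    _ = (n + 2) ^ 8 := by ring

theorem lt_word {n a : ℕ} (h : a < 64 * (n * n + 4 * n + 4)) : a < (n + 2) ^ 8 :=
  h.trans_le (word_bound n)

theorem fin_lt_word {n : ℕ} (a : Fin n) : (a : ℕ) < (n + 2) ^ 8 :=
  lt_word (by have := a.2; nlinarith)

theorem lt_word_of_le {n a : ℕ} (h : a ≤ 16 * n + 16) : a < (n + 2) ^ 8 :=
  lt_word (by nlinarith)

theorem two_pow_lt {n j : ℕ} (h : j + 1 ≤ maxLevel n) : 2 ^ j < n := by
  unfold maxLevel at h
  by_contra h1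
  have h2 : Nat.clog 2 n ≤ j := (Nat.clog_le_iff_le_pow (by norm_num)).2 (by omega)
  omega

section Runs

variable {n : ℕ} {Λ : Layout n} {i : ℕ} {c : Set (Fin n)}

/-- The program `p`, started in `σ`, halts in a configuration that satisfies `Q` together with
the time, which is counted from `N` on in units of the time of a forest operation. -/
def Runs (Λ : Layout n) (i : ℕ) (c : Set (Fin n)) (p : Program) (σ : Config n) (N : ℕ)
    (Q : Config n → ℕ → Prop) : Prop :=
  ∃ σ' t k, Exec Λ i c p σ σ' t ∧ t ≤ k * (Nat.clog 2 n + 1) ∧ Q σ' (N + k)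

variable {σ : Config n} {N : ℕ} {Q : Config n → ℕ → Prop}

theorem Instr.time_le (n : ℕ) (a : Instr) : a.time n ≤ 1 * (Nat.clog 2 n + 1) := by
  cases a <;> simp [Instr.time]

theorem Runs.step {a : Instr} {σ' : Config n} (hs : Step Λ i c a σ σ') (h : Q σ' (N + 1)) :
    Runs Λ i c (.instr a) σ N Q :=
  ⟨σ', _, 1, Exec.instr hs, Instr.time_le n a, h⟩

theorem Runs.skip (h : Q σ (N + 1)) : Runs Λ i c .skip σ N Q :=
  ⟨σ, 1, 1, Exec.skip σ, by omega, h⟩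

theorem Runs.seq {p q : Program} (h : Runs Λ i c p σ N fun σ' N' => Runs Λ i c q σ' N' Q) :
    Runs Λ i c (.seq p q) σ N Q := by
  obtain ⟨σ', t, k, h1, h2, σ'', t', k', h3, h4, h5⟩ := h
  refine ⟨σ'', t + t', k + k', Exec.seq h1 h3, by rw [add_mul]; omega, ?_⟩
  rwa [← add_assoc]

theorem Runs.ite {x : ℕ} {p q : Program} (h1 : σ.reg x ≠ 0 → Runs Λ i c p σ (N + 1) Q)
    (h0 : σ.reg x = 0 → Runs Λ i c q σ (N + 1) Q) : Runs Λ i c (.ite x p q) σ N Q := by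
  by_cases hx : σ.reg x = 0
  · obtain ⟨σ', t, k, h2, h3, h4⟩ := h0 hx
    exact ⟨σ', t + 1, k + 1, Exec.ite_false hx h2, by rw [add_mul]; omega, by
      rwa [add_comm k 1, ← add_assoc]⟩
  · obtain ⟨σ', t, k, h2, h3, h4⟩ := h1 hx
    exact ⟨σ', t + 1, k + 1, Exec.ite_true hx h2, by rw [add_mul]; omega, by
      rwa [add_comm k 1, ← add_assoc]⟩

/-- Loops with an invariant and a decreasing measure. -/
theorem Runs.loop {x : ℕ} {p : Program} (Inv : Config n → ℕ → Prop) (μ : Config n → ℕ)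
    (h0 : Inv σ N)
    (hstep : ∀ σ N, Inv σ N → σ.reg x ≠ 0 →
      Runs Λ i c p σ (N + 1) fun σ' N' => Inv σ' N' ∧ μ σ' < μ σ)
    (hexit : ∀ σ N, Inv σ N → σ.reg x = 0 → Q σ (N + 1)) :
    Runs Λ i c (.loop x p) σ N Q := by
  induction hm : μ σ using Nat.strong_induction_on generalizing σ N with
  | _ m ih =>
    by_cases hx : σ.reg x = 0
    · exact ⟨σ, 1, 1, Exec.loop_false hx, by omega, hexit σ N h0 hx⟩
    · obtain ⟨σ', t, k, h1, h2, h3, h4⟩ := hstep σ N h0 hx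
      obtain ⟨σ'', t', k', h5, h6, h7⟩ := ih (μ σ') (hm ▸ h4) h3 rfl
      refine ⟨σ'', t + t' + 1, 1 + k + k', Exec.loop_true hx h1 h5, by
        rw [add_mul, add_mul]; omega, ?_⟩
      rwa [← add_assoc, ← add_assoc]

theorem Runs.mono {p : Program} {Q' : Config n → ℕ → Prop} (h : Runs Λ i c p σ N Q)
    (hQ : ∀ σ' N', Q σ' N' → Q' σ' N') : Runs Λ i c p σ N Q' := by
  obtain ⟨σ', t, k, h1, h2, h3⟩ := h
  exact ⟨σ', t, k, h1, h2, hQ _ _ h3⟩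

theorem Runs.const {x k : ℕ} (hk : k < (n + 2) ^ 8) (h : Q (σ.put x k) (N + 1)) :
    Runs Λ i c (.instr (.const x k)) σ N Q :=
  Runs.step (Step.const σ x k) (by rwa [σ.set_eq_put hk])

theorem Runs.add {x y z : ℕ} (k : ℕ) (hv : σ.reg y + σ.reg z = k) (hk : k < (n + 2) ^ 8)
    (h : Q (σ.put x k) (N + 1)) : Runs Λ i c (.instr (.add x y z)) σ N Q :=
  Runs.step (Step.add σ x y z) (by rwa [hv, σ.set_eq_put hk])

theorem Runs.sub {x y z : ℕ} (k : ℕ) (hv : σ.reg y - σ.reg z = k) (hk : k < (n + 2) ^ 8)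
    (h : Q (σ.put x k) (N + 1)) : Runs Λ i c (.instr (.sub x y z)) σ N Q :=
  Runs.step (Step.sub σ x y z) (by rwa [hv, σ.set_eq_put hk])

theorem Runs.load {x y : ℕ} (k : ℕ) (hv : σ.mem (σ.reg y) = k) (hk : k < (n + 2) ^ 8)
    (h : Q (σ.put x k) (N + 1)) : Runs Λ i c (.instr (.load x y)) σ N Q :=
  Runs.step (Step.load σ x y) (by rwa [hv, σ.set_eq_put hk])

theorem Runs.store {x y : ℕ} (p k : ℕ) (hp : σ.reg x = p) (hv : σ.reg y = k)
    (hk : k < (n + 2) ^ 8) (h : Q (σ.poke p k) (N + 1)) :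
    Runs Λ i c (.instr (.store x y)) σ N Q :=
  Runs.step (Step.store σ x y) (by rwa [hp, hv, σ.write_eq_poke hk])

theorem Runs.cluster {x v l j : ℕ} {a : Fin n} (ha : σ.reg v = a) (hl : σ.reg l = j)
    (h : Q (σ.put x (Λ.node σ.forest j a)) (N + 1)) :
    Runs Λ i c (.instr (.cluster x v l)) σ N Q :=
  Runs.step (Step.cluster σ x v l a ha) (by rwa [σ.set_eq_put (fin_lt_word _), hl])

theorem Runs.size {x v l j : ℕ} {a : Fin n} (ha : σ.reg v = a) (hl : σ.reg l = j)
    (h : Q (σ.put x (σ.forest.size j a)) (N + 1)) :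
    Runs Λ i c (.instr (.size x v l)) σ N Q := by
  refine Runs.step (Step.size σ x v l a ha) ?_
  rw [hl, σ.set_eq_put (lt_word_of_le ?_)]
  · exact h
  · have := σ.forest.size_le j a; omega

theorem Runs.level {x u w j : ℕ} {a b : Fin n} (ha : σ.reg u = a) (hb : σ.reg w = b)
    (he : σ.forest.IsEdge j a b) (h : Q (σ.put x j) (N + 1)) :
    Runs Λ i c (.instr (.level x u w)) σ N Q := by
  refine Runs.step (Step.level σ x u w j a b ha hb he) ?_
  rw [σ.set_eq_put (lt_word_of_le ?_)]
  · exact h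
  · have h1 := σ.forest.level_le s(a, b) he.1
    rw [he.2] at h1
    have h2 : Nat.clog 2 n ≤ n :=
      (Nat.clog_le_iff_le_pow (by norm_num)).2 Nat.lt_two_pow_self.le
    unfold maxLevel at h1
    omega

theorem setEdge_eq {f u w : ℕ} {a b : Fin n} :
    σ.setEdge f u w (some (a, b)) = ((σ.put u a).put w b).put f 1 := by
  simp only [Config.setEdge]
  rw [σ.set_eq_put (fin_lt_word _), Config.set_eq_put _ (fin_lt_word _),
    Config.set_eq_put _ (lt_word_of_le (by omega))]

theorem setEdge_none {f u w : ℕ} : σ.setEdge f u w none = σ.put f 0 :=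
  Config.set_eq_put _ (lt_word_of_le (by omega))

theorem Runs.firstEdge {f u w v l j : ℕ} {a : Fin n} (ha : σ.reg v = a) (hl : σ.reg l = j)
    (h0 : (Λ.edgeList σ.forest j a)[0]? = none → Q (σ.put f 0) (N + 1))
    (h1 : ∀ x y : Fin n, (Λ.edgeList σ.forest j a)[0]? = some (x, y) →
      Q (((σ.put u x).put w y).put f 1) (N + 1)) :
    Runs Λ i c (.instr (.firstEdge f u w v l)) σ N Q := by
  refine Runs.step (Step.firstEdge σ f u w v l a ha) ?_
  rw [hl]
  rcases hL : (Λ.edgeList σ.forest j a)[0]? with _ | ⟨x, y⟩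
  · rw [setEdge_none]; exact h0 hL
  · rw [setEdge_eq]; exact h1 x y hL

theorem Runs.nextEdge {f u w j : ℕ} {a b : Fin n} (ha : σ.reg u = a) (hb : σ.reg w = b)
    (he : σ.forest.IsEdge (j + 1) a b)
    (h0 : (Λ.edgeList σ.forest j a)[(Λ.edgeList σ.forest j a).idxOf (a, b) + 1]? = none →
      Q (σ.put f 0) (N + 1))
    (h1 : ∀ x y : Fin n,
      (Λ.edgeList σ.forest j a)[(Λ.edgeList σ.forest j a).idxOf (a, b) + 1]? = some (x, y) →
      Q (((σ.put u x).put w y).put f 1) (N + 1)) :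
    Runs Λ i c (.instr (.nextEdge f u w)) σ N Q := by
  refine Runs.step (Step.nextEdge σ f u w j a b ha hb he) ?_
  rcases hL : (Λ.edgeList σ.forest j a)[(Λ.edgeList σ.forest j a).idxOf (a, b) + 1]?
    with _ | ⟨x, y⟩
  · rw [setEdge_none]; exact h0 hL
  · rw [setEdge_eq]; exact h1 x y hL

theorem Runs.smallest {f v : ℕ}
    (h0 : Λ.smallest σ.forest σ.marks i c = none → Q (σ.put f 0) (N + 1))
    (h1 : ∀ x : Fin n, Λ.smallest σ.forest σ.marks i c = some x →
      Q ((σ.put v x).put f 1) (N + 1)) :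
    Runs Λ i c (.instr (.smallest f v)) σ N Q := by
  refine Runs.step (Step.smallest σ f v) ?_
  rcases hL : Λ.smallest σ.forest σ.marks i c with _ | x
  · simp only [Config.setVertex]
    rw [Config.set_eq_put _ (lt_word_of_le (by omega))]; exact h0 hL
  · simp only [Config.setVertex]
    rw [σ.set_eq_put (fin_lt_word _), Config.set_eq_put _ (lt_word_of_le (by omega))]
    exact h1 x hL

theorem Layout.node_eq_iff (Λ : Layout n) {S : LeveledGraph n} {j : ℕ} {a b : Fin n} :
    Λ.node S j a = Λ.node S j b ↔ S.cluster j a = S.cluster j b := by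
  refine ⟨fun h => ?_, Λ.node_eq S j a b⟩
  have h1 := LeveledGraph.cluster_eq_of_mem (Λ.node_mem S j a)
  have h2 := LeveledGraph.cluster_eq_of_mem (Λ.node_mem S j b)
  rw [← h1, h, h2]

/-! ### Powers of two -/

infixr:67 ";;" => Program.seq

/-- Register 24 becomes two to the power of register 23. -/
def powProgram : Program :=
  .instr (.const 24 1) ;; .loop 23 (.instr (.add 24 24 24) ;; .instr (.sub 23 23 18))

/-- The time is exact because the accounting of `Runs` charges every instruction as a forest
operation and would give `O(j)` units. These are `O(j)` elementary instructions, which amount to a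
constant number of units. -/
theorem exec_pow_loop {j : ℕ} : ∀ {σ : Config n} {v : ℕ}, σ.reg 18 = 1 →
    σ.reg 23 = j → σ.reg 24 = v → v * 2 ^ j ≤ n → j ≤ n →
    Exec Λ i c (.loop 23 (.instr (.add 24 24 24) ;; .instr (.sub 23 23 18))) σ
      ((σ.put 24 (v * 2 ^ j)).put 23 0) (3 * j + 1) := by
  induction j with
  | zero =>
    intro σ v _ h1 h2 _ _
    have : (σ.put 24 (v * 2 ^ 0)).put 23 0 = σ := by
      unfold Config.put
      cases σ
      simp only [Config.mk.injEq, true_and, and_true] at *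
      funext r
      simp only [Function.update_apply]
      split_ifs <;> simp_all
    rw [this]
    exact Exec.loop_false h1
  | succ j ih =>
    intro σ v h0 h1 h2 h3 h4
    have h3' : v + v ≤ n := by
      refine le_trans ?_ h3
      rw [pow_succ]
      have : 1 ≤ 2 ^ j := Nat.one_le_two_pow
      nlinarith
    have e1 := Step.add (Λ := Λ) (i := i) (c := c) σ 24 24 24
    rw [h2, σ.set_eq_put (lt_word_of_le (by omega))] at e1
    have e2 := Step.sub (Λ := Λ) (i := i) (c := c) (σ.put 24 (v + v)) 23 23 18
    simp only [Config.put_reg, Nat.reduceEqDiff, if_false, h0, h1] at e2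
    rw [Config.set_eq_put _ (lt_word_of_le (by omega))] at e2
    have e3 := ih (σ := (σ.put 24 (v + v)).put 23 (j + 1 - 1)) (v := v + v) (by simp [h0])
      (by simp) (by simp) (by rw [← two_mul, mul_comm 2 v, mul_assoc, ← pow_succ']; exact h3)
      (by omega)
    have e4 := Exec.loop_true (x := 23) (by omega) (Exec.seq (Exec.instr e1) (Exec.instr e2)) e3
    have : ((((σ.put 24 (v + v)).put 23 (j + 1 - 1)).put 24 ((v + v) * 2 ^ j)).put 23 0) =
        (σ.put 24 (v * 2 ^ (j + 1))).put 23 0 := by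
      unfold Config.put
      simp only [Config.mk.injEq, true_and, and_true]
      funext r
      simp only [Function.update_apply]
      split_ifs <;> first | rfl | (rw [pow_succ]; ring)
    rw [this] at e4
    have ht : (Instr.add 24 24 24).time n + (Instr.sub 23 23 18).time n + (3 * j + 1) + 1 =
        3 * (j + 1) + 1 := by simp only [Instr.time]; omega
    rwa [ht] at e4

theorem Runs.pow {j : ℕ} (hj : j + 1 ≤ maxLevel n) (h18 : σ.reg 18 = 1) (h23 : σ.reg 23 = j)
    (h : Q ((σ.put 24 (2 ^ j)).put 23 0) (N + 3)) : Runs Λ i c powProgram σ N Q := by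
  have h1 := two_pow_lt hj
  have hjn : j < 2 ^ j := Nat.lt_two_pow_self
  have e1 := Step.const (Λ := Λ) (i := i) (c := c) σ 24 1
  rw [σ.set_eq_put (lt_word_of_le (by omega))] at e1
  have e2 := exec_pow_loop (Λ := Λ) (i := i) (c := c) (j := j) (σ := σ.put 24 1) (v := 1)
    (by simp [h18]) (by simp [h23]) (by simp) (by omega) (by omega)
  have : ((σ.put 24 1).put 24 (1 * 2 ^ j)).put 23 0 = (σ.put 24 (2 ^ j)).put 23 0 := by
    unfold Config.put
    simp only [one_mul, Function.update_idem]
  rw [this] at e2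
  refine ⟨_, _, 3, Exec.seq (Exec.instr e1) e2, ?_, h⟩
  simp only [Instr.time]
  unfold maxLevel at hj
  omega

end Runs

/-! ### Subroutines

Registers below 20 belong to the main program, where register 0 holds the level, register 18 the
number one and register 19 zero. Subroutines use the registers from 20 on, and loops that call
them the registers from 40 on. -/

/-- The working memory, the marks and all registers outside of `[20, k)` are the same. -/
structure Frame {n : ℕ} (k : ℕ) (σ σ' : Config n) : Prop where
  marks : σ'.marks = σ.marks
  mem : σ'.mem = σ.mem
  reg : ∀ r, r < 20 ∨ k ≤ r → σ'.reg r = σ.reg r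

/-- The conventions on the registers of the main program. -/
structure Base {n : ℕ} (i : ℕ) (σ : Config n) : Prop where
  level : σ.reg 0 = i
  one : σ.reg 18 = 1
  zero : σ.reg 19 = 0

section Subroutines

open LeveledGraph

variable {n : ℕ} {Λ : Layout n} {i : ℕ} {c : Set (Fin n)}
variable {σ σ' σ'' : Config n} {N : ℕ} {Q : Config n → ℕ → Prop} {a b v : Fin n}
  {k : ℕ}

theorem Frame.refl (σ : Config n) : Frame k σ σ := ⟨rfl, rfl, fun _ _ => rfl⟩

theorem Frame.trans (h : Frame k σ σ') (h' : Frame k σ' σ'') : Frame k σ σ'' :=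
  ⟨h'.marks.trans h.marks, h'.mem.trans h.mem, fun r hr => (h'.reg r hr).trans (h.reg r hr)⟩

theorem Frame.weaken {l : ℕ} (h : Frame k σ σ') (hl : k ≤ l) : Frame l σ σ' :=
  ⟨h.marks, h.mem, fun r hr => h.reg r (by omega)⟩

theorem Frame.put {x p : ℕ} (h : Frame k σ σ') (hx : 20 ≤ x ∧ x < k) : Frame k σ (σ'.put x p) :=
  ⟨h.marks, h.mem, fun r hr => by
    rw [Config.put_reg, if_neg (by omega)]; exact h.reg r hr⟩

theorem Frame.put_iff {x p : ℕ} (hx : 20 ≤ x ∧ x < k) :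
    Frame k σ (σ'.put x p) ↔ Frame k σ σ' := by
  refine ⟨fun h => ⟨h.marks, h.mem, fun r hr => ?_⟩, fun h => h.put hx⟩
  have := h.reg r hr
  rwa [Config.put_reg, if_neg (by omega)] at this

theorem Frame.base (h : Frame k σ σ') (hb : Base i σ) : Base i σ' :=
  ⟨(h.reg 0 (by omega)).trans hb.level, (h.reg 18 (by omega)).trans hb.one,
    (h.reg 19 (by omega)).trans hb.zero⟩

/-- Register 22 tells whether the edge with ends in the registers 20 and 21 is unblocked. -/
def checkProgram : Program :=
  .instr (.level 25 20 21) ;; .instr (.sub 23 25 18) ;; .instr (.add 26 23 19) ;;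
  .instr (.cluster 27 20 26) ;; .instr (.cluster 28 21 26) ;; .instr (.sub 29 27 28) ;;
  .instr (.sub 30 28 27) ;; .instr (.add 29 29 30) ;;
  .ite 29
    (.instr (.size 27 20 26) ;; .instr (.size 28 21 26) ;; .instr (.add 27 27 28) ;;
      powProgram ;; .instr (.sub 29 27 24) ;;
      .ite 29 (.instr (.const 22 0)) (.instr (.const 22 1)))
    (.instr (.const 22 1))

/-- Equality of clusters is equality of their names `p` and `q`, tested as `(p - q) + (q - p) = 0`
with truncated differences. The threshold `2 ^ j` is recomputed because `j` varies as the edge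
descends. -/
theorem Runs.check {j : ℕ} (hb : Base i σ) (h20 : σ.reg 20 = a) (h21 : σ.reg 21 = b)
    (he : σ.forest.IsEdge (j + 1) a b)
    (h : ∀ σ' N', N' ≤ N + 20 → Frame 40 σ σ' → σ'.forest = σ.forest → σ'.reg 20 = a →
      σ'.reg 21 = b → σ'.reg 31 = σ.reg 31 →
      (σ'.reg 22 = 1 ∧ ¬ σ.forest.IsBlocked j a b ∨ σ'.reg 22 = 0 ∧ σ.forest.IsBlocked j a b) →
      Q σ' N') :
    Runs Λ i c checkProgram σ N Q := by
  have hj : j + 1 ≤ maxLevel n := he.2 ▸ σ.forest.level_le s(a, b) he.1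
  have hjn := two_pow_lt hj
  have hjn' : j < 2 ^ j := Nat.lt_two_pow_self
  have h18 := hb.one
  have h19 := hb.zero
  have ha := a.2
  have hbn := b.2
  have hna := (Λ.node σ.forest j a).2
  have hnb := (Λ.node σ.forest j b).2
  have hsa := σ.forest.size_le j a
  have hsb := σ.forest.size_le j b
  unfold checkProgram
  refine Runs.seq (Runs.level h20 h21 he ?_)
  refine Runs.seq (Runs.sub j (by simp [h18]) (lt_word_of_le (by omega)) ?_)
  refine Runs.seq (Runs.add j (by simp [h19]) (lt_word_of_le (by omega)) ?_)
  refine Runs.seq (Runs.cluster (a := a) (j := j) (by simp [h20]) (by simp) ?_)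
  refine Runs.seq (Runs.cluster (a := b) (j := j) (by simp [h21]) (by simp) ?_)
  simp only [Config.put_forest]
  generalize hp : ((Λ.node σ.forest j a : Fin n) : ℕ) = p at *
  generalize hq : ((Λ.node σ.forest j b : Fin n) : ℕ) = q at *
  have hpq : p = q ↔ σ.forest.cluster j a = σ.forest.cluster j b := by
    rw [← Λ.node_eq_iff, ← hp, ← hq, Fin.val_inj]
  refine Runs.seq (Runs.sub (p - q) (by simp) (lt_word_of_le (by omega)) ?_)
  refine Runs.seq (Runs.sub (q - p) (by simp) (lt_word_of_le (by omega)) ?_)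
  refine Runs.seq (Runs.add (p - q + (q - p)) (by simp) (lt_word_of_le (by omega)) ?_)
  refine Runs.ite (fun h29 => ?_) (fun h29 => ?_)
  · have hne : σ.forest.cluster j a ≠ σ.forest.cluster j b := by
      intro heq
      rw [← hpq] at heq
      simp [heq] at h29
    refine Runs.seq (Runs.size (a := a) (j := j) (by simp [h20]) (by simp) ?_)
    refine Runs.seq (Runs.size (a := b) (j := j) (by simp [h21]) (by simp) ?_)
    simp only [Config.put_forest]
    generalize hs : σ.forest.size j a = s at *
    generalize ht : σ.forest.size j b = t at *
    refine Runs.seq (Runs.add (s + t) (by simp) (lt_word_of_le (by omega)) ?_)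
    refine Runs.seq (Runs.pow hj (by simp [h18]) (by simp) ?_)
    refine Runs.seq (Runs.sub (s + t - 2 ^ j) (by simp) (lt_word_of_le (by omega)) ?_)
    refine Runs.ite (fun h29 => ?_) (fun h29 => ?_)
    · refine Runs.const (lt_word_of_le (by omega)) (h _ _ (by omega) ?_ ?_ ?_ ?_ ?_ ?_)
      · simp [Frame.put_iff, Frame.refl]
      · simp
      · simp [h20]
      · simp [h21]
      · simp
      · right
        refine ⟨by simp, he, hne, ?_⟩
        simp at h29
        omega
    · refine Runs.const (lt_word_of_le (by omega)) (h _ _ (by omega) ?_ ?_ ?_ ?_ ?_ ?_)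
      · simp [Frame.put_iff, Frame.refl]
      · simp
      · simp [h20]
      · simp [h21]
      · simp
      · left
        refine ⟨by simp, fun hbl => ?_⟩
        have := hbl.2.2
        simp at h29
        omega
  · refine Runs.const (lt_word_of_le (by omega)) (h _ _ (by omega) ?_ ?_ ?_ ?_ ?_ ?_)
    · simp [Frame.put_iff, Frame.refl]
    · simp
    · simp [h20]
    · simp [h21]
    · simp
    · left
      refine ⟨by simp, fun hbl => hbl.2.1 (hpq.1 ?_)⟩
      simp at h29
      omega

/-- Push the edge with ends in the registers 20 and 21 down until it is blocked; register 22 tells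
whether it has been moved. -/
def pushProgram : Program :=
  checkProgram ;; .instr (.add 31 22 19) ;;
  .loop 22 (.instr (.push 20 21) ;; checkProgram) ;; .instr (.add 22 31 19)

theorem LeveledGraph.ext' {S S' : LeveledGraph n} (h1 : S.graph = S'.graph)
    (h2 : S.level = S'.level) : S = S' := by
  cases S; cases S'; simp_all

theorem LeveledGraph.Lowered.eq {S S' : LeveledGraph n} (h : Lowered S S' i i a b) : S' = S := by
  refine LeveledGraph.ext' h.graph_eq (funext fun e => ?_)
  by_cases he : e = s(a, b)
  · rw [he, h.level_self, h.edge.2]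
  · exact h.level_ne e he

/-- The clusters of level at most `l` have not been touched so far, so the test in `S'` certifies
that the edge was unblocked there in `S` as well. -/
theorem LeveledGraph.Lowered.pushDown {S S' : LeveledGraph n} {l : ℕ} (h : Lowered S S' i l a b)
    (hu : ¬ S'.IsBlocked l a b) : ∃ l', l = l' + 1 ∧ Lowered S (S'.pushDown s(a, b)) i l' a b := by
  have hedge : S'.IsEdge (l + 1) a b := ⟨by rw [h.graph_eq]; exact h.edge.1, h.level_self⟩
  have hcl := h.upTo_le (m := l) le_rfl
  -- For `l = 0` the edge has level one and joins two singletons, of total size `2 > 2 ^ 0`: it is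
  -- blocked, so the descent ends at level one at the latest.
  rcases l with _ | l
  · exfalso
    apply hu
    have hab : a ≠ b := hedge.1.ne
    refine ⟨hedge, fun heq => ?_, ?_⟩
    · exact not_mem_cluster_zero hab (cluster_eq_iff.1 heq)
    · have := S'.one_le_size 0 a
      have := S'.one_le_size 0 b
      omega
  · refine ⟨l, rfl, h.edge, by have := h.le; omega, h.graph_eq, ?_, ?_, ?_⟩
    · simp [LeveledGraph.pushDown, h.level_self]
    · intro e he
      simp only [LeveledGraph.pushDown]
      rw [Function.update_of_ne he]
      exact h.level_ne e he
    · intro k h1 h2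
      rcases Nat.lt_or_ge (l + 1) k with h3 | h3
      · exact h.unblocked k h3 h2
      · have hk : k = l + 1 := by omega
        subst hk
        rw [← cluster_congr_upTo hcl, ← cluster_congr_upTo hcl, ← size_congr_upTo hcl,
          ← size_congr_upTo hcl]
        by_contra hcon
        push Not at hcon
        exact hu ⟨hedge, hcon.1, hcon.2⟩

/-- Every check but the first follows a push, so the cost is proportional to the number of levels
descended plus one. Register 31 preserves the outcome of the first check, which decides whether the
edge moves at all. -/
theorem Runs.push (hb : Base i σ) (h20 : σ.reg 20 = a) (h21 : σ.reg 21 = b)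
    (he : σ.forest.IsEdge (i + 1) a b)
    (h : ∀ σ' N', N' ≤ N + 40 * (pushCount σ.forest σ'.forest + 1) → Frame 40 σ σ' →
      (σ'.reg 22 = 0 ∧ σ'.forest = σ.forest ∧ σ.forest.IsBlocked i a b ∨
        σ'.reg 22 = 1 ∧ FullPush σ.forest σ'.forest i a b) → Q σ' N') :
    Runs Λ i c pushProgram σ N Q := by
  unfold pushProgram
  refine Runs.seq (Runs.check hb h20 h21 he fun σ₁ N₁ hN₁ hF hf h20' h21' _ h22 => ?_)
  have hb₁ := hF.base hb
  have h22b : σ₁.reg 22 ≤ 1 := by rcases h22 with h22 | h22 <;> omega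
  refine Runs.seq (Runs.add (σ₁.reg 22) (by rw [hb₁.zero, add_zero]) (lt_word_of_le (by omega)) ?_)
  refine Runs.seq (Runs.loop (fun σ' N' => ∃ l, Lowered σ.forest σ'.forest i l a b ∧
      Frame 40 σ σ' ∧ σ'.reg 20 = a ∧ σ'.reg 21 = b ∧
      (σ'.reg 31 = 1 ∧ ¬ σ.forest.IsBlocked i a b ∨
        σ'.reg 31 = 0 ∧ σ.forest.IsBlocked i a b ∧ σ'.reg 22 = 0 ∧ l = i) ∧
      (σ'.reg 22 = 1 ∧ ¬ σ'.forest.IsBlocked l a b ∨ σ'.reg 22 = 0 ∧ σ'.forest.IsBlocked l a b) ∧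
      N' ≤ N + 25 + 40 * (i - l)) (fun σ' => σ'.forest.level s(a, b)) ?_ ?_ ?_)
  · refine ⟨i, ?_, hF.put (by norm_num), by simp [h20'], by simp [h21'], ?_, ?_, by omega⟩
    · rw [Config.put_forest, hf]; exact Lowered.refl he
    · rcases h22 with ⟨h1, h2⟩ | ⟨h1, h2⟩
      · left; exact ⟨by simp [h1], h2⟩
      · right; exact ⟨by simp [h1], h2, by simp [h1], rfl⟩
    · rw [Config.put_forest, hf]
      simpa using h22
  · rintro σ₂ N₂ ⟨l, hL, hF₂, h20₂, h21₂, h31, h22₂, hN₂⟩ hne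
    have hub : ¬ σ₂.forest.IsBlocked l a b := by
      rcases h22₂ with h1 | h1
      · exact h1.2
      · exact absurd h1.1 hne
    obtain ⟨l', rfl, hL'⟩ := hL.pushDown hub
    have hedge : σ₂.forest.IsEdge (l' + 1 + 1) a b :=
      ⟨by rw [hL.graph_eq]; exact he.1, hL.level_self⟩
    refine Runs.seq (Runs.step (Step.push σ₂ 20 21 (l' + 1) a b h20₂ h21₂ hedge hub) ?_)
    have hF₃ : Frame 40 σ { σ₂ with forest := σ₂.forest.pushDown s(a, b) } :=
      ⟨hF₂.marks, hF₂.mem, hF₂.reg⟩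
    refine Runs.check (j := l') (hF₃.base hb) h20₂ h21₂
      ⟨by rw [hL'.graph_eq]; exact he.1, hL'.level_self⟩ ?_
    intro σ₄ N₄ hN₄ hF₄ hf₄ h20₄ h21₄ h31₄ h22₄
    refine ⟨⟨l', ?_, hF₃.trans hF₄, h20₄, h21₄, ?_, ?_, ?_⟩, ?_⟩
    · rw [hf₄]; exact hL'
    · left
      rcases h31 with h1 | h1
      · exact ⟨by rw [h31₄]; exact h1.1, h1.2⟩
      · exact absurd h1.2.2.1 hne
    · rw [hf₄]; exact h22₄
    · have := hL.le
      omega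
    · rw [hf₄]
      change (σ₂.forest.pushDown s(a, b)).level s(a, b) < _
      rw [hL'.level_self, hL.level_self]; omega
  · rintro σ₂ N₂ ⟨l, hL, hF₂, h20₂, h21₂, h31, h22₂, hN₂⟩ h0
    have hbl : σ₂.forest.IsBlocked l a b := by
      rcases h22₂ with h1 | h1
      · rw [h1.1] at h0; exact absurd h0 one_ne_zero
      · exact h1.2
    have hb₂ := hF₂.base hb
    refine Runs.add (σ₂.reg 31) (by rw [hb₂.zero, add_zero])
      (lt_word_of_le (by rcases h31 with h1 | h1 <;> omega)) ?_
    refine h _ _ ?_ (hF₂.put (by norm_num)) ?_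
    · rw [Config.put_forest, hL.pushCount_eq]; omega
    · rcases h31 with ⟨h1, h2⟩ | ⟨h1, h2, _, h3⟩
      · right
        refine ⟨by simp [h1], l, ?_, hL, hbl⟩
        rcases hL.le.lt_or_eq with h3 | h3
        · exact h3
        · subst h3
          rw [hL.eq] at hbl
          exact absurd hbl h2
      · left
        subst h3
        exact ⟨by simp [h1], hL.eq, h2⟩

/-- Settle the cluster of the vertex in register 43. -/
def settleProgram : Program :=
  .instr (.const 32 1) ;;
  .loop 32 (.instr (.firstEdge 32 20 21 43 0) ;;
    .ite 32 (pushProgram ;; .instr (.add 32 22 19)) .skip)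

theorem LeveledGraph.Closed.edge {S : LeveledGraph n} (hc : S.Closed (i + 1) c) (ha : a ∈ c)
    (he : S.IsEdge (i + 1) a b) : b ∈ c :=
  hc a ha (mem_cluster_of_level_le he.1 he.2.le)

theorem LeveledGraph.Closed.pred {S : LeveledGraph n} (hc : S.Closed (i + 1) c) :
    S.Closed i c := fun v hv => (cluster_mono (Nat.le_succ i)).trans (hc v hv)

theorem LeveledGraph.Closed.reach {S S' : LeveledGraph n} (hc : S.Closed (i + 1) c)
    (h : Reach i c S S') : S'.Closed (i + 1) c := fun v hv => by
  rw [h.cluster_succ]; exact hc v hv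

/-- The measure of progress of loops that push. -/
def LeveledGraph.total (S : LeveledGraph n) : ℕ := ∑ e : Sym2 (Fin n), S.level e

theorem LeveledGraph.Reach.total_eq {S S' : LeveledGraph n} (h : Reach i c S S') :
    S'.total + pushCount S S' = S.total := by
  unfold total pushCount
  rw [← Finset.sum_add_distrib]
  refine Finset.sum_congr rfl fun e _ => ?_
  have := h.level_le e
  omega

theorem LeveledGraph.Reach.total_lt {S S' : LeveledGraph n} (h : Reach i c S S')
    (h' : FullPush S S' i a b) : S'.total < S.total := by
  have := h.total_eq
  have := h'.one_le_pushCount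
  omega

theorem getElem?_zero_mem {α : Type*} {l : List α} {x : α} (h : l[0]? = some x) : x ∈ l :=
  List.mem_of_getElem? h

theorem eq_nil_of_getElem?_zero {α : Type*} {l : List α} (h : l[0]? = none) : l = [] := by
  cases l <;> simp_all

theorem Runs.settle (hb : Base i σ) (h43 : σ.reg 43 = v) (hv : v ∈ c)
    (hc : σ.forest.Closed (i + 1) c) (hS : σ.forest.SizeInvariant)
    (h : ∀ σ' N', N' ≤ N + 100 * (pushCount σ.forest σ'.forest + 1) → Frame 40 σ σ' →
      Reach i c σ.forest σ'.forest → σ'.forest.Settled i v → Q σ' N') :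
    Runs Λ i c settleProgram σ N Q := by
  unfold settleProgram
  refine Runs.seq (Runs.const (lt_word_of_le (by omega)) ?_)
  refine Runs.loop (fun σ' N' => Frame 40 σ σ' ∧ Reach i c σ.forest σ'.forest ∧
      -- A successful round costs at most `90` units for each of its pushes. The extra `49` units
      -- cover the single unsuccessful round, after which the register is zero.
      N' ≤ N + 1 + 90 * pushCount σ.forest σ'.forest + (if σ'.reg 32 = 0 then 49 else 0) ∧
      (σ'.reg 32 = 0 → σ'.forest.Settled i v))
      (fun σ' => if σ'.reg 32 = 0 then 0 else σ'.forest.total + 1) ?_ ?_ ?_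
  · refine ⟨(Frame.refl σ).put (by norm_num), Reach.refl hS, by omega, by simp⟩
  · rintro σ₁ N₁ ⟨hF, hR, hN₁, hset⟩ hne
    rw [if_neg hne] at hN₁
    have hb₁ := hF.base hb
    have hc₁ := hc.reach hR
    have h43₁ : σ₁.reg 43 = v := (hF.reg 43 (by omega)).trans h43
    refine Runs.seq (Runs.firstEdge h43₁ hb₁.level ?_ ?_)
    · intro hL
      have hset' : σ₁.forest.Settled i v := settled_of_no_edge fun u hu w he => by
        have := (Λ.mem_edgeList σ₁.forest i v u w).2 ⟨hu, he⟩
        rw [eq_nil_of_getElem?_zero hL] at this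
        simp at this
      refine Runs.ite (fun h32 => by simp at h32) (fun _ => Runs.skip ?_)
      refine ⟨⟨hF.put (by norm_num), hR, ?_, fun _ => hset'⟩, by simp [hne]⟩
      simp only [Config.put_reg, Config.put_forest, if_true]; omega
    · intro x y hL
      have hxy := (Λ.mem_edgeList σ₁.forest i v x y).1 (getElem?_zero_mem hL)
      have hxc : x ∈ c := hc₁.pred v hv hxy.1
      have hyc : y ∈ c := hc₁.edge hxc hxy.2
      refine Runs.ite (fun _ => ?_) (fun h32 => by simp at h32)
      have hF₂ : Frame 40 σ (((σ₁.put 20 x).put 21 y).put 32 1) :=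
        ((hF.put (by norm_num)).put (by norm_num)).put (by norm_num)
      refine Runs.seq (Runs.push (hF₂.base hb) (a := x) (b := y) (by simp) (by simp)
        hxy.2 ?_)
      intro σ₃ N₃ hN₃ hF₃ hres
      have hF₃' := hF₂.trans hF₃
      simp only [Config.put_forest] at hN₃ hres
      refine Runs.add (σ₃.reg 22) (by rw [(hF₃'.base hb).zero, add_zero])
        (lt_word_of_le (by rcases hres with h1 | h1 <;> omega)) ?_
      rcases hres with ⟨h1, h2, h3⟩ | ⟨h1, h2⟩
      · refine ⟨⟨hF₃'.put (by norm_num), ?_, ?_, fun _ => ?_⟩, ?_⟩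
        · rw [Config.put_forest, h2]; exact hR
        · rw [h2, pushCount_self] at hN₃
          simp only [Config.put_reg, Config.put_forest, if_true, h1, h2]
          omega
        · rw [Config.put_forest, h2]; exact Or.inl ⟨x, hxy.1, y, h3⟩
        · simp [h1, hne]
      · have hR₂ : Reach i c σ₁.forest σ₃.forest := h2.reach hR.sizeInvariant hxc hyc
        have hadd := hR.pushCount_add hR₂
        have hone := h2.one_le_pushCount
        have hlt := hR₂.total_lt h2
        refine ⟨⟨hF₃'.put (by norm_num), hR.trans hR₂, ?_, fun h0 => ?_⟩, ?_⟩
        · simp only [Config.put_reg, Config.put_forest, if_true, h1]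
          simp only [one_ne_zero, if_false]
          omega
        · simp [h1] at h0
        · simp [h1, hne, hlt]
  · rintro σ₁ N₁ ⟨hF, hR, hN₁, hset⟩ h0
    rw [if_pos h0] at hN₁
    exact h _ _ (by omega) hF hR (hset h0)

end Subroutines

section Loops

open LeveledGraph

variable {n : ℕ} {Λ : Layout n} {i : ℕ} {c : Set (Fin n)}
variable {σ σ' σ'' : Config n} {N : ℕ} {Q : Config n → ℕ → Prop} {a b v : Fin n}
  {k : ℕ}

/-! ### Merging small children -/

/-- Push first edges of smallest unmarked children until one is blocked. -/
def mergeProgram : Program :=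
  .instr (.const 33 1) ;;
  .loop 33 (.instr (.smallest 33 34) ;;
    .ite 33
      (.instr (.firstEdge 33 20 21 34 0) ;;
        .ite 33 (pushProgram ;; .instr (.add 33 22 19)) .skip)
      .skip)

/-- All children inside `c` are marked, or a smallest unmarked one has a blocked edge or no edge
at all. -/
def MergeEnd (S : LeveledGraph n) (M : Set (Fin n)) (i : ℕ) (c : Set (Fin n)) : Prop :=
  (∀ v ∈ c, ¬ Disjoint (S.cluster i v) M) ∨
  ∃ o ∈ c, Disjoint (S.cluster i o) M ∧
    (∀ w ∈ c, Disjoint (S.cluster i w) M → S.size i o ≤ S.size i w) ∧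
    ((∀ u ∈ S.cluster i o, ∀ w, ¬ S.IsEdge (i + 1) u w) ∨
      ∃ x ∈ S.cluster i o, ∃ y, S.IsBlocked i x y)

/-- The predicate `P` carries along what the caller has to know about the merges, namely
`Separated`. The set of marked vertices stays fixed: a cluster is marked when it meets this set, so
a merged child inherits the mark of its parts. -/
theorem Runs.merge (hb : Base i σ) (hc : σ.forest.Closed (i + 1) c)
    (hS : σ.forest.SizeInvariant) (P : LeveledGraph n → Prop) (hP0 : P σ.forest)
    (hP : ∀ S S' o x y, P S → Reach i c σ.forest S → Disjoint (S.cluster i o) σ.marks →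
      x ∈ S.cluster i o → FullPush S S' i x y → P S')
    (h : ∀ σ' N', N' ≤ N + 100 * (pushCount σ.forest σ'.forest + 1) → Frame 40 σ σ' →
      Reach i c σ.forest σ'.forest → P σ'.forest → MergeEnd σ'.forest σ.marks i c → Q σ' N') :
    Runs Λ i c mergeProgram σ N Q := by
  unfold mergeProgram
  refine Runs.seq (Runs.const (lt_word_of_le (by omega)) ?_)
  refine Runs.loop (fun σ' N' => Frame 40 σ σ' ∧ Reach i c σ.forest σ'.forest ∧ P σ'.forest ∧
      N' ≤ N + 1 + 90 * pushCount σ.forest σ'.forest + (if σ'.reg 33 = 0 then 59 else 0) ∧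
      (σ'.reg 33 = 0 → MergeEnd σ'.forest σ.marks i c))
      (fun σ' => if σ'.reg 33 = 0 then 0 else σ'.forest.total + 1) ?_ ?_ ?_
  · refine ⟨(Frame.refl σ).put (by norm_num), Reach.refl hS, hP0, by omega, by simp⟩
  · rintro σ₁ N₁ ⟨hF, hR, hP₁, hN₁, hset⟩ hne
    rw [if_neg hne] at hN₁
    have hb₁ := hF.base hb
    have hc₁ := hc.reach hR
    refine Runs.seq (Runs.smallest ?_ ?_)
    · intro hsm
      refine Runs.ite (fun h33 => by simp at h33) (fun _ => Runs.skip ?_)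
      refine ⟨⟨hF.put (by norm_num), hR, hP₁, ?_, fun _ => Or.inl ?_⟩, by simp [hne]⟩
      · simp only [Config.put_reg, Config.put_forest, if_true]; omega
      · have := Λ.smallest_none _ _ _ _ hsm
        rwa [hF.marks] at this
    · intro o hsm
      obtain ⟨hoc, hod, hmin⟩ := Λ.smallest_some _ _ _ _ _ hsm
      rw [hF.marks] at hod hmin
      refine Runs.ite (fun _ => ?_) (fun h33 => by simp at h33)
      refine Runs.seq (Runs.firstEdge (a := o) (j := i) (by simp) (by simp [hb₁.level]) ?_ ?_)
      · intro hL
        simp only [Config.put_forest] at hL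
        refine Runs.ite (fun h33 => by simp at h33) (fun _ => Runs.skip ?_)
        refine ⟨⟨by simpa [Frame.put_iff] using hF, hR, hP₁, ?_,
          fun _ => Or.inr ⟨o, hoc, hod, hmin, Or.inl fun u hu w he => ?_⟩⟩, by simp [hne]⟩
        · simp only [Config.put_reg, Config.put_forest, if_true]; omega
        · have := (Λ.mem_edgeList σ₁.forest i o u w).2 ⟨hu, he⟩
          rw [eq_nil_of_getElem?_zero hL] at this
          simp at this
      · intro x y hL
        simp only [Config.put_forest] at hL
        have hxy := (Λ.mem_edgeList σ₁.forest i o x y).1 (getElem?_zero_mem hL)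
        have hxc : x ∈ c := hc₁.pred o hoc hxy.1
        have hyc : y ∈ c := hc₁.edge hxc hxy.2
        refine Runs.ite (fun _ => ?_) (fun h33 => by simp at h33)
        have hF₂ : Frame 40 σ (((((σ₁.put 34 o).put 33 1).put 20 x).put 21 y).put 33 1) := by
          simpa [Frame.put_iff] using hF
        refine Runs.seq (Runs.push (hF₂.base hb) (a := x) (b := y) (by simp) (by simp)
          hxy.2 ?_)
        intro σ₃ N₃ hN₃ hF₃ hres
        have hF₃' := hF₂.trans hF₃
        simp only [Config.put_forest] at hN₃ hres
        refine Runs.add (σ₃.reg 22) (by rw [(hF₃'.base hb).zero, add_zero])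
          (lt_word_of_le (by rcases hres with h1 | h1 <;> omega)) ?_
        rcases hres with ⟨h1, h2, h3⟩ | ⟨h1, h2⟩
        · refine ⟨⟨hF₃'.put (by norm_num), ?_, ?_, ?_, fun _ => ?_⟩, ?_⟩
          · rw [Config.put_forest, h2]; exact hR
          · rw [Config.put_forest, h2]; exact hP₁
          · rw [h2, pushCount_self] at hN₃
            simp only [Config.put_reg, Config.put_forest, if_true, h1, h2]
            omega
          · rw [Config.put_forest, h2]
            exact Or.inr ⟨o, hoc, hod, hmin, Or.inr ⟨x, hxy.1, y, h3⟩⟩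
          · simp [h1, hne]
        · have hR₂ : Reach i c σ₁.forest σ₃.forest := h2.reach hR.sizeInvariant hxc hyc
          have hadd := hR.pushCount_add hR₂
          have hone := h2.one_le_pushCount
          have hlt := hR₂.total_lt h2
          refine ⟨⟨hF₃'.put (by norm_num), hR.trans hR₂, hP _ _ o x y hP₁ hR hod hxy.1 h2, ?_,
            fun h0 => ?_⟩, ?_⟩
          · simp only [Config.put_reg, Config.put_forest, if_true, h1]
            simp only [one_ne_zero, if_false]
            omega
          · simp [h1] at h0
          · simp [h1, hne, hlt]
  · rintro σ₁ N₁ ⟨hF, hR, hP₁, hN₁, hset⟩ h0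
    rw [if_pos h0] at hN₁
    exact h _ _ (by omega) hF hR hP₁ (hset h0)

/-! ### Loops over stored lists -/

/-- Run `p` with register 40 at `0, 8, 16, …`, below register `lim`. -/
def forProgram (lim : ℕ) (p : Program) : Program :=
  .instr (.const 40 0) ;; .instr (.add 41 lim 19) ;;
  .loop 41 (p ;; .instr (.const 42 8) ;; .instr (.add 40 40 42) ;; .instr (.sub 41 lim 40))

/-- Each round costs a constant plus an amount paid for by its own pushes; the total is linear in
the number of rounds and pushes because pushes add up along `Reach`. -/
theorem Runs.for {lim T : ℕ} {p : Program} (hlim : lim < 20) (hb : Base i σ)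
    (hT : σ.reg lim = 8 * T) (hTW : 8 * T < (n + 2) ^ 8) (hS : σ.forest.SizeInvariant)
    (P : ℕ → LeveledGraph n → Prop) (hP0 : P 0 σ.forest)
    (hp : ∀ r < T, ∀ σ₁ N₁, Frame 50 σ σ₁ → σ₁.reg 40 = 8 * r → Reach i c σ.forest σ₁.forest →
      P r σ₁.forest → Runs Λ i c p σ₁ N₁ fun σ₂ N₂ => Frame 50 σ σ₂ ∧ σ₂.reg 40 = 8 * r ∧
        Reach i c σ₁.forest σ₂.forest ∧ P (r + 1) σ₂.forest ∧
        N₂ ≤ N₁ + 150 * (pushCount σ₁.forest σ₂.forest + 1))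
    (h : ∀ σ' N', Frame 50 σ σ' → Reach i c σ.forest σ'.forest → P T σ'.forest →
      N' ≤ N + 150 * pushCount σ.forest σ'.forest + 160 * T + 10 → Q σ' N') :
    Runs Λ i c (forProgram lim p) σ N Q := by
  unfold forProgram
  refine Runs.seq (Runs.const (lt_word_of_le (by omega)) ?_)
  refine Runs.seq (Runs.add (8 * T) (by
    simp [hb.zero, hT, show lim ≠ 40 by omega]) hTW ?_)
  refine Runs.loop (fun σ' N' => ∃ r ≤ T, Frame 50 σ σ' ∧ σ'.reg 40 = 8 * r ∧
      σ'.reg 41 = 8 * T - 8 * r ∧ Reach i c σ.forest σ'.forest ∧ P r σ'.forest ∧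
      N' ≤ N + 2 + 150 * pushCount σ.forest σ'.forest + 160 * r)
      (fun σ' => σ'.reg 41) ?_ ?_ ?_
  · refine ⟨0, by omega, ?_, by simp, by simp, Reach.refl hS, hP0, by omega⟩
    simp [Frame.put_iff, Frame.refl]
  · rintro σ₁ N₁ ⟨r, hr, hF, h40, h41, hR, hPr, hN₁⟩ hne
    have hrT : r < T := by omega
    refine Runs.seq ((hp r hrT σ₁ (N₁ + 1) hF h40 hR hPr).mono ?_)
    rintro σ₂ N₂ ⟨hF₂, h40₂, hR₂, hP₂, hN₂⟩
    have hadd := hR.pushCount_add hR₂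
    have hl : σ₂.reg lim = 8 * T := (hF₂.reg lim (by omega)).trans hT
    refine Runs.seq (Runs.const (lt_word_of_le (by omega)) ?_)
    refine Runs.seq (Runs.add (8 * (r + 1)) (by simp [h40₂]; ring) (by omega) ?_)
    refine Runs.sub (8 * T - 8 * (r + 1)) (by
      simp [hl, show lim ≠ 40 by omega, show lim ≠ 42 by omega]) (by omega) ?_
    refine ⟨⟨r + 1, hrT, by simpa [Frame.put_iff] using hF₂, by simp, by simp, hR.trans hR₂, hP₂,
      ?_⟩, ?_⟩
    · simp only [Config.put_forest]; omega
    · simp only [Config.put_reg, if_true]; omega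
  · rintro σ₁ N₁ ⟨r, hr, hF, h40, h41, hR, hPr, hN₁⟩ h0
    have hrT : r = T := by omega
    subst hrT
    exact h _ _ hF hR hPr (by omega)

/-- Push the recorded edge with index in register 40, if it still has its level. -/
def recordProgram : Program :=
  .instr (.const 20 2) ;; .instr (.add 35 40 20) ;; .instr (.load 20 35) ;;
  .instr (.add 35 35 18) ;; .instr (.load 21 35) ;; .instr (.level 36 20 21) ;;
  .instr (.sub 36 36 0) ;; .ite 36 pushProgram .skip

/-- Push the recorded edge with index in register 40, if it belongs to the bin in register 11. -/
def recordBinProgram : Program :=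
  .instr (.const 20 4) ;; .instr (.add 35 40 20) ;; .instr (.load 36 35) ;;
  .instr (.sub 37 36 11) ;; .instr (.sub 38 11 36) ;; .instr (.add 37 37 38) ;;
  .ite 37 .skip recordProgram

/-- The edge may have been lowered already, in an earlier pass or through its other orientation. Its
level exceeds `i` exactly when it still has to be tried, and afterwards it is either lowered or
blocked. -/
theorem Runs.record {r : ℕ} (hb : Base i σ) (h40 : σ.reg 40 = 8 * r)
    (hr : 8 * r + 8 < (n + 2) ^ 8) (h2 : σ.mem (8 * r + 2) = a) (h3 : σ.mem (8 * r + 3) = b)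
    (hab : σ.forest.graph.Adj a b) (hl : σ.forest.level s(a, b) ≤ i + 1) (ha : a ∈ c) (hbc : b ∈ c)
    (hS : σ.forest.SizeInvariant)
    (h : ∀ σ' N', N' ≤ N + 60 * (pushCount σ.forest σ'.forest + 1) → Frame 40 σ σ' →
      Reach i c σ.forest σ'.forest →
      (σ'.forest = σ.forest ∨ FullPush σ.forest σ'.forest i a b) →
      (σ'.forest.level s(a, b) ≤ i ∨ σ'.forest.IsBlocked i a b) → Q σ' N') :
    Runs Λ i c recordProgram σ N Q := by
  have h1 := σ.forest.one_le_level s(a, b) hab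
  obtain ⟨j, hj⟩ : ∃ j, σ.forest.level s(a, b) = j := ⟨_, rfl⟩
  have hjn : j ≤ n := by
    have h4 := σ.forest.level_le s(a, b) hab
    have h5 : Nat.clog 2 n ≤ n :=
      (Nat.clog_le_iff_le_pow (by norm_num)).2 Nat.lt_two_pow_self.le
    unfold maxLevel at h4
    omega
  unfold recordProgram
  refine Runs.seq (Runs.const (lt_word_of_le (by omega)) ?_)
  refine Runs.seq (Runs.add (8 * r + 2) (by simp [h40]) (by omega) ?_)
  refine Runs.seq (Runs.load a (by simp [h2]) (fin_lt_word a) ?_)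
  refine Runs.seq (Runs.add (8 * r + 3) (by simp [hb.one]) (by omega) ?_)
  refine Runs.seq (Runs.load b (by simp [h3]) (fin_lt_word b) ?_)
  refine Runs.seq (Runs.level (a := a) (b := b) (j := j) (by simp) (by simp) ⟨hab, hj⟩ ?_)
  refine Runs.seq (Runs.sub (j - i) (by simp [hb.level]) (lt_word_of_le (by omega)) ?_)
  refine Runs.ite (fun h36 => ?_) (fun h36 => Runs.skip ?_)
  · simp at h36
    refine Runs.push (a := a) (b := b) ⟨by simp [hb.level], by simp [hb.one], by simp [hb.zero]⟩
      (by simp) (by simp) ⟨hab, by simp only [Config.put_forest]; omega⟩ ?_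
    intro σ' N' hN' hF' hres
    simp only [Config.put_forest] at hN' hres
    have hF : Frame 40 σ σ' := by
      refine Frame.trans ?_ hF'
      simp [Frame.put_iff, Frame.refl]
    rcases hres with ⟨_, h4, h5⟩ | ⟨_, h4⟩
    · exact h _ _ (by omega) hF (by rw [h4]; exact Reach.refl hS) (Or.inl h4)
        (Or.inr (by rw [h4]; exact h5))
    · exact h _ _ (by omega) hF (h4.reach hS ha hbc) (Or.inr h4) (Or.inl h4.level_le)
  · simp at h36
    refine h _ _ ?_ (by simp [Frame.put_iff, Frame.refl]) ?_ (Or.inl ?_) (Or.inl ?_)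
    · omega
    · simp only [Config.put_forest]; exact Reach.refl hS
    · simp only [Config.put_forest]
    · simp only [Config.put_forest]; omega

theorem Runs.recordBin {r p q : ℕ} (h40 : σ.reg 40 = 8 * r)
    (hr : 8 * r + 8 < (n + 2) ^ 8) (h4 : σ.mem (8 * r + 4) = p) (hp : p ≤ 16 * n)
    (h11 : σ.reg 11 = q) (hq : q ≤ 16 * n)
    (h0 : p ≠ q → ∀ σ', Frame 40 σ σ' → σ'.forest = σ.forest → Q σ' (N + 8))
    (h1 : p = q → ∀ σ', Frame 40 σ σ' → σ'.forest = σ.forest →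
      Runs Λ i c recordProgram σ' (N + 7) Q) :
    Runs Λ i c recordBinProgram σ N Q := by
  unfold recordBinProgram
  refine Runs.seq (Runs.const (lt_word_of_le (by omega)) ?_)
  refine Runs.seq (Runs.add (8 * r + 4) (by simp [h40]) (by omega) ?_)
  refine Runs.seq (Runs.load p (by simp [h4]) (lt_word_of_le (by omega)) ?_)
  refine Runs.seq (Runs.sub (p - q) (by simp [h11]) (lt_word_of_le (by omega)) ?_)
  refine Runs.seq (Runs.sub (q - p) (by simp [h11]) (lt_word_of_le (by omega)) ?_)
  refine Runs.seq (Runs.add (p - q + (q - p)) (by simp) (lt_word_of_le (by omega)) ?_)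
  refine Runs.ite (fun h37 => Runs.skip ?_) (fun h37 => ?_)
  · simp at h37
    exact h0 (by omega) _ (by simp [Frame.put_iff, Frame.refl]) (by simp)
  · simp at h37
    exact h1 (by omega) _ (by simp [Frame.put_iff, Frame.refl]) (by simp)

/-- Settle the cluster of the stored vertex with index in register 40. -/
def settleStoredProgram : Program :=
  .instr (.const 43 5) ;; .instr (.add 43 40 43) ;; .instr (.load 43 43) ;; settleProgram

/-! ### Counting unmarked children -/

/-- Mark and store unmarked children, until there are as many as recorded edges. -/
def countProgram : Program :=
  .instr (.const 16 0) ;; .instr (.add 13 10 19) ;;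
  .loop 13 (.instr (.smallest 13 14) ;;
    .ite 13
      (.instr (.mark 14) ;; .instr (.const 20 5) ;; .instr (.add 20 20 16) ;;
        .instr (.store 20 14) ;; .instr (.const 20 8) ;; .instr (.add 16 16 20) ;;
        .instr (.sub 13 10 16))
      .skip)

/-- Unmark the stored children. -/
def unmarkProgram : Program :=
  .instr (.add 13 16 19) ;;
  .loop 13 (.instr (.const 20 8) ;; .instr (.sub 13 13 20) ;; .instr (.const 20 5) ;;
    .instr (.add 20 20 13) ;; .instr (.load 14 20) ;; .instr (.unmark 14))

/-- The first `m` stored vertices lie in distinct unmarked level `i` clusters inside `c`. -/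
structure Stored (S : LeveledGraph n) (M : Set (Fin n)) (i : ℕ) (c : Set (Fin n))
    (mem : ℕ → ℕ) (m : ℕ) (o : ℕ → Fin n) : Prop where
  mem_eq : ∀ k < m, mem (8 * k + 5) = o k
  mem_c : ∀ k < m, o k ∈ c
  disj : ∀ k < m, Disjoint (S.cluster i (o k)) M
  ne : ∀ k < m, ∀ l < k, S.cluster i (o k) ≠ S.cluster i (o l)

/-- The marks after marking stored children. -/
def storedMarks (S : LeveledGraph n) (M : Set (Fin n)) (i m : ℕ) (o : ℕ → Fin n) :
    Set (Fin n) := M ∪ {x | ∃ k < m, x ∈ S.cluster i (o k)}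

theorem storedMarks_succ {S : LeveledGraph n} {M : Set (Fin n)} {m : ℕ} {o : ℕ → Fin n} :
    storedMarks S M i (m + 1) o = storedMarks S M i m o ∪ S.cluster i (o m) := by
  ext x
  simp only [storedMarks, Set.mem_union, Set.mem_ofPred_eq, Order.lt_add_one_iff]
  constructor
  · rintro (h | ⟨k, hk, h⟩)
    · exact Or.inl (Or.inl h)
    · rcases hk.lt_or_eq with h1 | rfl
      · exact Or.inl (Or.inr ⟨k, h1, h⟩)
      · exact Or.inr h
  · rintro ((h | ⟨k, hk, h⟩) | h)
    · exact Or.inl h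
    · exact Or.inr ⟨k, hk.le, h⟩
    · exact Or.inr ⟨m, le_rfl, h⟩

theorem storedMarks_congr {S : LeveledGraph n} {M : Set (Fin n)} {m : ℕ} {o o' : ℕ → Fin n}
    (h : ∀ k < m, o k = o' k) : storedMarks S M i m o = storedMarks S M i m o' := by
  ext x
  simp only [storedMarks, Set.mem_union, Set.mem_ofPred_eq]
  refine or_congr_right (exists_congr fun k => and_congr_right fun hk => ?_)
  rw [h k hk]

/-- Stopping at `T` keeps the cost within that of the scan. The stored children are distinct because
each is unmarked when it is found and marked at once. -/
theorem Runs.count {T : ℕ} (v : Fin n) (hb : Base i σ) (h10 : σ.reg 10 = 8 * T)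
    (hT : 8 * T + 8 < (n + 2) ^ 8)
    (h : ∀ σ' N' m o, N' ≤ N + 12 * m + 10 → σ'.forest = σ.forest →
      (∀ r < 20, r ≠ 13 → r ≠ 14 → r ≠ 16 → σ'.reg r = σ.reg r) →
      (∀ k, k % 8 ≠ 5 → σ'.mem k = σ.mem k) → m ≤ T → σ'.reg 16 = 8 * m →
      Stored σ.forest σ.marks i c σ'.mem m o →
      σ'.marks = storedMarks σ.forest σ.marks i m o →
      (m = T ∨ ∀ v ∈ c, ¬ Disjoint (σ.forest.cluster i v) σ'.marks) → Q σ' N') :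
    Runs Λ i c countProgram σ N Q := by
  unfold countProgram
  refine Runs.seq (Runs.const (lt_word_of_le (by omega)) ?_)
  refine Runs.seq (Runs.add (8 * T) (by simp [hb.zero, h10]) (by omega) ?_)
  refine Runs.loop (fun σ' N' => ∃ m o, N' ≤ N + 2 + 12 * m + (if σ'.reg 13 = 0 then 7 else 0) ∧
      σ'.forest = σ.forest ∧
      (∀ r < 20, r ≠ 13 → r ≠ 14 → r ≠ 16 → σ'.reg r = σ.reg r) ∧
      (∀ k, k % 8 ≠ 5 → σ'.mem k = σ.mem k) ∧ m ≤ T ∧ σ'.reg 16 = 8 * m ∧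
      Stored σ.forest σ.marks i c σ'.mem m o ∧
      σ'.marks = storedMarks σ.forest σ.marks i m o ∧
      (σ'.reg 13 = 0 → (m = T ∨ ∀ v ∈ c, ¬ Disjoint (σ.forest.cluster i v) σ'.marks)) ∧
      (σ'.reg 13 ≠ 0 → m < T))
      (fun σ' => if σ'.reg 13 = 0 then 0 else 8 * T + 1 - σ'.reg 16) ?_ ?_ ?_
  · refine ⟨0, fun _ => v, by omega, rfl, ?_, ?_, by omega, by simp, ?_, ?_, ?_, ?_⟩
    · intro r _ h1 h2 h3; simp [h1, h3]
    · intro k _; simp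
    · constructor <;> intro k hk <;> omega
    · simp [storedMarks]
    · intro h0; left; simp at h0; omega
    · intro h0; simp at h0; omega
  · rintro σ₁ N₁ ⟨m, o, hN₁, hf, hreg, hmem, hmT, h16, hst, hmk, hz, hnz⟩ hne
    rw [if_neg hne] at hN₁
    have hmT' := hnz hne
    have h10₁ : σ₁.reg 10 = 8 * T := (hreg 10 (by omega) (by omega) (by omega) (by omega)).trans h10
    refine Runs.seq (Runs.smallest ?_ ?_)
    · intro hsm
      refine Runs.ite (fun h33 => by simp at h33) (fun _ => Runs.skip ?_)
      refine ⟨⟨m, o, ?_, hf, ?_, hmem, hmT, by simp [h16], hst, hmk, fun _ => Or.inr ?_,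
        fun h0 => by simp at h0⟩, ?_⟩
      · simp only [Config.put_reg, if_true]; omega
      · intro r h1 h2 h3 h4; simp [h2]; exact hreg r h1 h2 h3 h4
      · have := Λ.smallest_none _ _ _ _ hsm
        rwa [hf] at this
      · simp [hne]; omega
    · intro x hsm
      obtain ⟨hxc, hxd, hmin⟩ := Λ.smallest_some _ _ _ _ _ hsm
      rw [hf] at hxd hmin
      refine Runs.ite (fun _ => ?_) (fun h33 => by simp at h33)
      refine Runs.seq (Runs.step (Step.mark _ 14 x (by simp)) ?_)
      refine Runs.seq (Runs.const (lt_word_of_le (by omega)) ?_)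
      refine Runs.seq (Runs.add (8 * m + 5) (by simp [h16]; ring) (by omega) ?_)
      refine Runs.seq (Runs.store (8 * m + 5) x (by simp) (by simp) (fin_lt_word x) ?_)
      refine Runs.seq (Runs.const (lt_word_of_le (by omega)) ?_)
      refine Runs.seq (Runs.add (8 * (m + 1)) (by simp [h16]; ring) (by omega) ?_)
      refine Runs.sub (8 * T - 8 * (m + 1)) (by simp [h10₁]) (by omega) ?_
      have hcong : ∀ k < m, o k = Function.update o m x k := fun k hk => by
        rw [Function.update_of_ne (by omega)]
      refine ⟨⟨m + 1, Function.update o m x, ?_, ?_, ?_, ?_, ?_, ?_, ?_, ?_, ?_, ?_⟩, ?_⟩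
      · simp only [Config.put_reg, if_true]; split_ifs <;> omega
      · simp [hf]
      · intro r h1 h2 h3 h4
        simp [h2, h3, h4, show r ≠ 20 by omega]
        exact hreg r h1 h2 h3 h4
      · intro k hk
        have : k ≠ 8 * m + 5 := by omega
        simp [this]
        exact hmem k hk
      · omega
      · simp
      · refine ⟨?_, ?_, ?_, ?_⟩
        · intro k hk
          rcases Nat.lt_or_ge k m with h1 | h1
          · have : 8 * k + 5 ≠ 8 * m + 5 := by omega
            simp only [Config.put_mem, Config.poke_mem, this, if_false]
            rw [← hcong k h1]; exact hst.mem_eq k h1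
          · have : k = m := by omega
            subst this; simp
        · intro k hk
          rcases Nat.lt_or_ge k m with h1 | h1
          · rw [← hcong k h1]; exact hst.mem_c k h1
          · have : k = m := by omega
            subst this; simpa using hxc
        · intro k hk
          rcases Nat.lt_or_ge k m with h1 | h1
          · rw [← hcong k h1]; exact hst.disj k h1
          · have : k = m := by omega
            subst this
            rw [hmk, storedMarks] at hxd
            simpa using (Set.disjoint_union_right.1 hxd).1
        · intro k hk l hl
          rcases Nat.lt_or_ge k m with h1 | h1
          · rw [← hcong k h1, ← hcong l (by omega)]; exact hst.ne k h1 l hl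
          · have : k = m := by omega
            subst this
            rw [← hcong l hl, Function.update_self]
            intro heq
            rw [hmk, storedMarks] at hxd
            have h5 := (Set.disjoint_union_right.1 hxd).2
            refine Set.disjoint_left.1 h5 (self_mem_cluster _ _ x) ⟨l, hl, ?_⟩
            rw [← heq]; exact self_mem_cluster _ _ x
      · simp only [Config.put_marks, Config.poke_marks, Config.put_forest]
        rw [storedMarks_succ, hmk, hf, Function.update_self, storedMarks_congr hcong]
      · intro h0; left; simp at h0; omega
      · intro h0; simp at h0; omega
      · simp [hne, h16]; split_ifs <;> omega
  · rintro σ₁ N₁ ⟨m, o, hN₁, hf, hreg, hmem, hmT, h16, hst, hmk, hz, hnz⟩ h0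
    rw [if_pos h0] at hN₁
    exact h _ _ m o (by omega) hf hreg hmem hmT h16 hst hmk (hz h0)

/-- The stored clusters are disjoint from each other and from `M`, so removing them restores `M`
exactly. -/
theorem Runs.unmark {m : ℕ} {S : LeveledGraph n} {M : Set (Fin n)} {o : ℕ → Fin n}
    (hb : Base i σ) (h16 : σ.reg 16 = 8 * m)
    (hm : 8 * m + 8 < (n + 2) ^ 8) (hS : σ.forest = S) (hst : Stored S M i c σ.mem m o)
    (hM : σ.marks = storedMarks S M i m o)
    (h : ∀ σ' N', N' ≤ N + 12 * m + 10 → σ'.forest = S →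
      (∀ r < 20, r ≠ 13 → r ≠ 14 → σ'.reg r = σ.reg r) → σ'.mem = σ.mem → σ'.marks = M → Q σ' N') :
    Runs Λ i c unmarkProgram σ N Q := by
  unfold unmarkProgram
  refine Runs.seq (Runs.add (8 * m) (by simp [hb.zero, h16]) (by omega) ?_)
  refine Runs.loop (fun σ' N' => ∃ q ≤ m, N' + 12 * q ≤ N + 1 + 12 * m ∧ σ'.forest = S ∧
      (∀ r < 20, r ≠ 13 → r ≠ 14 → σ'.reg r = σ.reg r) ∧ σ'.mem = σ.mem ∧
      σ'.reg 13 = 8 * q ∧ σ'.marks = storedMarks S M i q o) (fun σ' => σ'.reg 13) ?_ ?_ ?_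
  · refine ⟨m, le_rfl, by omega, hS, ?_, rfl, by simp, hM⟩
    intro r _ h1 _; simp [h1]
  · rintro σ₁ N₁ ⟨q, hq, hN₁, hf, hreg, hmem, h13, hmk⟩ hne
    obtain ⟨q, rfl⟩ : ∃ q', q = q' + 1 := ⟨q - 1, by omega⟩
    refine Runs.seq (Runs.const (lt_word_of_le (by omega)) ?_)
    refine Runs.seq (Runs.sub (8 * q) (by simp [h13]; omega) (by omega) ?_)
    refine Runs.seq (Runs.const (lt_word_of_le (by omega)) ?_)
    refine Runs.seq (Runs.add (8 * q + 5) (by simp; ring) (by omega) ?_)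
    refine Runs.seq (Runs.load (o q) (by
      simp [hmem]; exact hst.mem_eq q (by omega)) (fin_lt_word _) ?_)
    refine Runs.step (Step.unmark _ 14 (o q) (by simp)) ?_
    refine ⟨⟨q, by omega, by omega, hf, ?_, hmem, by simp, ?_⟩, ?_⟩
    · intro r h1 h2 h3
      simp [h2, h3, show r ≠ 20 by omega]
      exact hreg r h1 h2 h3
    · simp only [Config.put_marks, Config.put_forest]
      rw [hmk, hf, storedMarks_succ, Set.union_sdiff_right]
      rw [sdiff_eq_left]
      refine Set.disjoint_union_left.2 ⟨(hst.disj q (by omega)).symm, ?_⟩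
      rw [Set.disjoint_left]
      rintro x ⟨k, hk, hx⟩ hx'
      exact hst.ne q (by omega) k hk ((cluster_eq_of_mem hx').symm.trans (cluster_eq_of_mem hx))
    · simp [h13]
  · rintro σ₁ N₁ ⟨q, hq, hN₁, hf, hreg, hmem, h13, hmk⟩ h0
    have hq0 : q = 0 := by omega
    subst hq0
    refine h _ _ (by omega) hf hreg hmem ?_
    rw [hmk]
    simp [storedMarks]

end Loops

section Bins

open LeveledGraph

variable {n : ℕ}

/-! ### Bins -/

/-- The vertices in bin `j`, together with the cluster of `z`. -/
def binSet (Λ : Layout n) (S : LeveledGraph n) (i : ℕ) (z : Fin n) (mem : ℕ → ℕ) (j : ℕ) :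
    Set (Fin n) := {v | mem (8 * Λ.node S i v) = j} ∪ S.cluster i z

/-- The cells with addresses divisible by eight assign the level `i` clusters inside `W` to
bins of capacity `2 ^ i`, where bin `r` with load `ℓ` is the last one. The cluster of `z` is a part
of every bin. -/
structure BinTable (Λ : Layout n) (S : LeveledGraph n) (i : ℕ) (z : Fin n) (mem : ℕ → ℕ)
    (r ℓ : ℕ) (W : Set (Fin n)) : Prop where
  ne_zero : ∀ v, mem (8 * Λ.node S i v) ≠ 0 ↔ v ∈ W
  closed : S.Closed i W
  mem_W : z ∈ W
  bin_z : mem (8 * Λ.node S i z) = 1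
  one_le : 1 ≤ r
  bin_le : ∀ v, mem (8 * Λ.node S i v) ≤ r
  card_le : ∀ j ≠ 0, (binSet Λ S i z mem j).ncard ≤ 2 ^ i
  card_last : (binSet Λ S i z mem r).ncard ≤ ℓ
  load_le : ℓ ≤ 2 ^ i
  -- The analysis of next fit. A new bin is opened only when the last load and the new cluster
  -- together exceed `2 ^ i`, so charging every cluster twice pays for the closed bin. The cluster
  -- of `z`, repeated in each bin, is subtracted from the capacity.
  potential : (r - 1) * (2 ^ i - S.size i z + 1) + S.size i z + ℓ ≤ 2 * W.ncard

variable {Λ : Layout n} {S : LeveledGraph n} {i : ℕ} {z w : Fin n} {mem mem' : ℕ → ℕ}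
  {r ℓ r' ℓ' : ℕ} {W : Set (Fin n)}

theorem BinTable.congr (h : BinTable Λ S i z mem r ℓ W) (he : ∀ k, mem' (8 * k) = mem (8 * k)) :
    BinTable Λ S i z mem' r ℓ W := by
  have h1 : ∀ j, binSet Λ S i z mem' j = binSet Λ S i z mem j := fun j => by
    unfold binSet; simp only [he]
  refine ⟨?_, h.closed, h.mem_W, ?_, h.one_le, ?_, ?_, ?_, h.load_le, h.potential⟩
  · intro v; rw [he]; exact h.ne_zero v
  · rw [he]; exact h.bin_z
  · intro v; rw [he]; exact h.bin_le v
  · intro j hj; rw [h1]; exact h.card_le j hj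
  · rw [h1]; exact h.card_last

/-- Every bin beyond the first adds at least one to the potential. This crude bound only serves to
keep bin numbers within words and needs no information on `c`. -/
theorem BinTable.bin_bound (h : BinTable Λ S i z mem r ℓ W) : r ≤ 2 * n + 1 := by
  have h1 := h.potential
  have h2 : W.ncard ≤ n := by
    calc W.ncard ≤ (Set.univ : Set (Fin n)).ncard := Set.ncard_le_ncard (Set.subset_univ _)
      _ = n := by rw [Set.ncard_univ, Nat.card_eq_fintype_card, Fintype.card_fin]
  have h3 : (r - 1) * 1 ≤ (r - 1) * (2 ^ i - S.size i z + 1) := Nat.mul_le_mul_left _ (by omega)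
  omega

/-- There are at most six bins. -/
theorem BinTable.bin_le_six (h : BinTable Λ S i z mem r ℓ W) (hW : W.ncard ≤ 2 * 2 ^ i)
    (hz : 2 * S.size i z ≤ 2 ^ i) : r ≤ 6 := by
  by_contra hr
  have h1 := h.potential
  -- With `s` the size of the cluster of `z`, seven bins would give a potential of at least `6 (2^i
  -- - s + 1) + 2 s = 6 · 2^i - 4 s + 6`, which exceeds `4 · 2^i` since `2 s ≤ 2^i`.
  have h2 : 6 * (2 ^ i - S.size i z + 1) ≤ (r - 1) * (2 ^ i - S.size i z + 1) :=
    Nat.mul_le_mul_right _ (by omega)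
  have h3 : S.size i z ≤ ℓ :=
    (Set.ncard_le_ncard Set.subset_union_right).trans h.card_last
  omega

theorem BinTable.assign (h : BinTable Λ S i z mem r ℓ W) (hw : w ∉ W)
    (hr : r' = r ∧ ℓ' = ℓ + S.size i w ∨
      r' = r + 1 ∧ ℓ' = S.size i z + S.size i w ∧ 2 ^ i < ℓ + S.size i w)
    (hℓ : ℓ' ≤ 2 ^ i) :
    BinTable Λ S i z (Function.update mem (8 * Λ.node S i w) r') r' ℓ' (W ∪ S.cluster i w) := by
  classical
  have h0 : 1 ≤ r' := by have := h.one_le; omega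
  have hr' : r ≤ r' := by omega
  have hz : S.size i z ≤ ℓ :=
    (Set.ncard_le_ncard Set.subset_union_right).trans h.card_last
  -- the new table
  have hnew : ∀ v, Function.update mem (8 * (Λ.node S i w : ℕ)) r' (8 * Λ.node S i v) =
      if v ∈ S.cluster i w then r' else mem (8 * Λ.node S i v) := by
    intro v
    rw [Function.update_apply]
    refine if_congr ?_ rfl rfl
    rw [mem_cluster_comm, ← cluster_eq_iff, ← Λ.node_eq_iff, ← Fin.val_inj]
    omega
  have hwz : z ∉ S.cluster i w := fun h1 => hw (h.closed z h.mem_W (mem_cluster_comm.1 h1))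
  have hdisj : Disjoint W (S.cluster i w) := by
    rw [Set.disjoint_left]
    exact fun x hx hx' => hw (h.closed x hx (mem_cluster_comm.1 hx'))
  have hnotr : ∀ v ∈ S.cluster i w, mem (8 * Λ.node S i v) = 0 := fun v hv => by
    by_contra h1
    exact Set.disjoint_left.1 hdisj ((h.ne_zero v).1 h1) hv
  have hbin_ne : ∀ j ≠ 0, j ≠ r' → binSet Λ S i z
      (Function.update mem (8 * (Λ.node S i w : ℕ)) r') j = binSet Λ S i z mem j := by
    intro j hj hjr
    ext v
    simp only [binSet, Set.mem_union, Set.mem_ofPred_eq, hnew]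
    refine or_congr_left ?_
    split_ifs with hv
    · rw [hnotr v hv]
      exact ⟨fun h1 => absurd h1.symm hjr, fun h1 => absurd h1.symm hj⟩
    · rfl
  have hbin_r : binSet Λ S i z (Function.update mem (8 * (Λ.node S i w : ℕ)) r') r' ⊆
      binSet Λ S i z mem r' ∪ S.cluster i w := by
    intro v hv
    simp only [binSet, Set.mem_union, Set.mem_ofPred_eq, hnew] at hv ⊢
    split_ifs at hv with h1
    · exact Or.inr h1
    · exact Or.inl hv
  have hlast : (binSet Λ S i z (Function.update mem (8 * (Λ.node S i w : ℕ)) r') r').ncard ≤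
      ℓ' := by
    refine (Set.ncard_le_ncard hbin_r).trans ((Set.ncard_union_le _ _).trans ?_)
    rcases hr with ⟨h1, h2⟩ | ⟨h1, h2, h3⟩
    · rw [h1, h2]; exact Nat.add_le_add_right h.card_last _
    · rw [h2]
      refine Nat.add_le_add_right ?_ _
      refine Set.ncard_le_ncard ?_
      rintro v (hv | hv)
      · have := h.bin_le v
        have hv : mem (8 * Λ.node S i v) = r' := hv
        omega
      · exact hv
  refine ⟨?_, h.closed.union (closed_cluster S i w), Or.inl h.mem_W, ?_, h0, ?_, ?_, hlast, hℓ, ?_⟩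
  · intro v
    rw [hnew]
    split_ifs with hv
    · simp [hv]; omega
    · rw [h.ne_zero v]; simp [hv]
  · rw [hnew, if_neg hwz]; exact h.bin_z
  · intro v
    rw [hnew]
    split_ifs with hv
    · exact le_rfl
    · exact (h.bin_le v).trans hr'
  · intro j hj
    by_cases hjr : j = r'
    · subst hjr; exact hlast.trans hℓ
    · rw [hbin_ne j hj hjr]; exact h.card_le j hj
  · rw [Set.ncard_union_eq hdisj]
    change _ ≤ 2 * (W.ncard + S.size i w)
    have h1 := h.potential
    have h2 := h.one_le
    rcases hr with ⟨rfl, rfl⟩ | ⟨rfl, rfl, h5⟩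
    · omega
    -- Opening a bin raises the potential by `2^i + 1 + n(w) - ℓ`, which is at most `2 n(w)` because
    -- `2^i < ℓ + n(w)`.
    · obtain ⟨q, rfl⟩ : ∃ q, r = q + 1 := ⟨r - 1, by omega⟩
      simp only [Nat.add_sub_cancel] at h1 ⊢
      rw [add_mul]
      omega

/-! ### Records -/

/-- The first `k` records hold the edges `e 0, …, e (k - 1)`; the records are counted by bins, and
bin `J` has the largest number `q` of records. -/
structure Records (mem : ℕ → ℕ) (e : ℕ → Fin n × Fin n) (k J q : ℕ) : Prop where
  fst : ∀ l < k, mem (8 * l + 2) = (e l).1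
  snd : ∀ l < k, mem (8 * l + 3) = (e l).2
  count : ∀ j, mem (8 * j + 1) = ((Finset.range k).filter fun l => mem (8 * l + 4) = j).card
  best : mem (8 * J + 1) = q
  le_best : ∀ j, mem (8 * j + 1) ≤ q

/-- The memory consists of arrays interleaved by residues modulo eight: `0` the bin of a cluster,
`1` the number of records of a bin, `2`, `3`, `4` the ends and the bin of a record, `5` the stored
children. So the arrays can grow without interfering with each other. -/
theorem Records.congr {e : ℕ → Fin n × Fin n} {k J q : ℕ} (h : Records mem e k J q)
    (he : ∀ l, l % 8 ≠ 0 → l % 8 ≠ 5 → mem' l = mem l) : Records mem' e k J q := by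
  refine ⟨fun l hl => ?_, fun l hl => ?_, fun j => ?_, ?_, fun j => ?_⟩
  · rw [he _ (by omega) (by omega)]; exact h.fst l hl
  · rw [he _ (by omega) (by omega)]; exact h.snd l hl
  · rw [he _ (by omega) (by omega), h.count]
    congr 1
    refine Finset.filter_congr fun l _ => ?_
    rw [he _ (by omega) (by omega)]
  · rw [he _ (by omega) (by omega)]; exact h.best
  · rw [he _ (by omega) (by omega)]; exact h.le_best j

theorem Records.snoc {e : ℕ → Fin n × Fin n} {k J q j : ℕ} (h : Records mem e k J q)
    (h1 : ∀ l, l % 8 ≠ 0 → l ≠ 8 * k + 2 → l ≠ 8 * k + 3 → l ≠ 8 * k + 4 → l ≠ 8 * j + 1 →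
      mem' l = mem l)
    (h2 : mem' (8 * k + 2) = (e k).1) (h3 : mem' (8 * k + 3) = (e k).2)
    (h4 : mem' (8 * k + 4) = j) (h5 : mem' (8 * j + 1) = mem (8 * j + 1) + 1) {J' q' : ℕ}
    (hJ : q < mem (8 * j + 1) + 1 ∧ J' = j ∧ q' = mem (8 * j + 1) + 1 ∨
      mem (8 * j + 1) + 1 ≤ q ∧ J' = J ∧ q' = q) :
    Records mem' e (k + 1) J' q' := by
  have hcell : ∀ p, p ≠ j → mem' (8 * p + 1) = mem (8 * p + 1) := fun p hp =>
    h1 _ (by omega) (by omega) (by omega) (by omega) (by omega)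
  refine ⟨fun l hl => ?_, fun l hl => ?_, fun p => ?_, ?_, fun p => ?_⟩
  · rcases Nat.lt_or_ge l k with h6 | h6
    · rw [h1 _ (by omega) (by omega) (by omega) (by omega) (by omega)]; exact h.fst l h6
    · have : l = k := by omega
      subst this; exact h2
  · rcases Nat.lt_or_ge l k with h6 | h6
    · rw [h1 _ (by omega) (by omega) (by omega) (by omega) (by omega)]; exact h.snd l h6
    · have : l = k := by omega
      subst this; exact h3
  · have hfil : ((Finset.range k).filter fun l => mem' (8 * l + 4) = p) =
        (Finset.range k).filter fun l => mem (8 * l + 4) = p := by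
      refine Finset.filter_congr fun l hl => ?_
      have := Finset.mem_range.1 hl
      rw [h1 _ (by omega) (by omega) (by omega) (by omega) (by omega)]
    rw [Finset.range_add_one, Finset.filter_insert, hfil, h4]
    by_cases hp : j = p
    · subst hp
      rw [if_pos rfl, Finset.card_insert_of_notMem (by simp), ← h.count, h5]
    · rw [if_neg hp, ← h.count, hcell p (Ne.symm hp)]
  · rcases hJ with ⟨_, rfl, rfl⟩ | ⟨h6, rfl, rfl⟩
    · exact h5
    · by_cases hp : J' = j
      · subst hp
        rw [h.best] at h6; omega
      · rw [hcell _ hp]; exact h.best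
  · have h7 := h.le_best p
    by_cases hp : p = j
    · subst hp; rw [h5]; omega
    · rw [hcell p hp]; omega

/-- The largest bin holds a constant fraction of the records. -/
theorem Records.card_le {e : ℕ → Fin n × Fin n} {k J q : ℕ} (h : Records mem e k J q)
    {R : ℕ} (hbin : ∀ l < k, 1 ≤ mem (8 * l + 4) ∧ mem (8 * l + 4) ≤ R) : k ≤ R * q := by
  have h1 : (Finset.range k).card ≤ q * (Finset.Icc 1 R).card := by
    refine Finset.card_le_mul_card_image_of_maps_to (f := fun l => mem (8 * l + 4)) ?_ q ?_
    · intro l hl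
      exact Finset.mem_coe.2 (Finset.mem_Icc.2 (hbin l (Finset.mem_range.1 hl)))
    · intro j _
      rw [← h.count]; exact h.le_best j
  rw [Finset.card_range, Nat.card_Icc, Nat.add_sub_cancel, mul_comm] at h1
  exact h1

end Bins

/-! ### Assigning clusters to bins and recording edges -/

section Recording

open LeveledGraph

variable {n : ℕ} {Λ : Layout n} {i : ℕ} {c : Set (Fin n)}
variable {σ σ' : Config n} {N : ℕ} {Q : Config n → ℕ → Prop}

/-- Put the cluster of the vertex in register 15 into a bin, unless it is in one already, and
store the bin in register 21. -/
def assignProgram : Program :=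
  .instr (.cluster 20 15 0) ;; .instr (.add 20 20 20) ;; .instr (.add 20 20 20) ;;
  .instr (.add 20 20 20) ;; .instr (.load 21 20) ;;
  .ite 21 .skip
    (.instr (.size 23 15 0) ;; .instr (.add 24 9 23) ;; .instr (.sub 25 24 3) ;;
      .ite 25 (.instr (.add 8 8 18) ;; .instr (.add 9 5 23)) (.instr (.add 9 24 19)) ;;
      .instr (.add 21 8 19) ;; .instr (.store 20 21))

/-- A zero cell means that the cluster has no bin yet, which is why bins are numbered from one. Only
the last bin is tried; by `hfit` the cluster always fits into a fresh bin beside the cluster of `z`.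
-/
theorem Runs.assign {S : LeveledGraph n} {z w : Fin n} {r ℓ : ℕ} {W : Set (Fin n)}
    (hb : Base i σ) (hS : σ.forest = S) (hi : i + 1 ≤ maxLevel n)
    (h3 : σ.reg 3 = 2 ^ i) (h5 : σ.reg 5 = S.size i z)
    (h8 : σ.reg 8 = r) (h9 : σ.reg 9 = ℓ) (h15 : σ.reg 15 = w)
    (hT : BinTable Λ S i z σ.mem r ℓ W)
    (hfit : w ∉ W → S.size i z + S.size i w ≤ 2 ^ i)
    (h : ∀ σ' N' r' ℓ', N' ≤ N + 20 → r ≤ r' → σ'.forest = S → σ'.marks = σ.marks →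
      (∀ p < 20, p ≠ 8 → p ≠ 9 → σ'.reg p = σ.reg p) →
      (∀ p, p % 8 ≠ 0 → σ'.mem p = σ.mem p) →
      (∀ v ∈ W, σ'.mem (8 * Λ.node S i v) = σ.mem (8 * Λ.node S i v)) →
      σ'.reg 8 = r' → σ'.reg 9 = ℓ' → σ'.reg 21 = σ'.mem (8 * Λ.node S i w) →
      BinTable Λ S i z σ'.mem r' ℓ' (W ∪ S.cluster i w) → Q σ' N') :
    Runs Λ i c assignProgram σ N Q := by
  subst hS
  set S := σ.forest with hSdef
  have hi' := two_pow_lt hi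
  have hrn := hT.bin_bound
  have hbin := hT.bin_le w
  have hℓ := hT.load_le
  have hsw := S.size_le i w
  have hsz := S.size_le i z
  have hnode := (Λ.node S i w).2
  have hmem0 := hT.ne_zero w
  unfold assignProgram
  refine Runs.seq (Runs.cluster (a := w) (j := i) h15 hb.level ?_)
  rw [← hSdef]
  generalize hy : ((Λ.node S i w : Fin n) : ℕ) = y at hnode
  rw [hy] at hbin hmem0
  refine Runs.seq (Runs.add (2 * y) (by simp; ring) (lt_word_of_le (by omega)) ?_)
  refine Runs.seq (Runs.add (4 * y) (by simp; ring) (lt_word_of_le (by omega)) ?_)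
  refine Runs.seq (Runs.add (8 * y) (by simp; ring) (lt_word_of_le (by omega)) ?_)
  refine Runs.seq (Runs.load (σ.mem (8 * y)) (by simp) (lt_word_of_le (by omega)) ?_)
  refine Runs.ite (fun h21 => Runs.skip ?_) (fun h21 => ?_)
  · simp at h21
    have hw : w ∈ W := hmem0.1 h21
    refine h _ _ r ℓ (by omega) le_rfl (by simp [hSdef]) (by simp) ?_ (by simp) (by simp) (by simp [h8])
      (by simp [h9]) (by simp [hy]) ?_
    · intro p h1 h2 h3
      simp [show p ≠ 20 by omega, show p ≠ 21 by omega]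
    · have : W ∪ S.cluster i w = W := Set.union_eq_left.2 (hT.closed w hw)
      rw [this]
      exact hT
  · simp at h21
    have hw : w ∉ W := fun hw => hmem0.2 hw h21
    have hfit' := hfit hw
    refine Runs.seq (Runs.size (a := w) (j := i) (by simp [h15]) (by simp [hb.level]) ?_)
    simp only [Config.put_forest]
    rw [← hSdef]
    generalize hs : S.size i w = s at *
    refine Runs.seq (Runs.add (ℓ + s) (by simp [h9]) (lt_word_of_le (by omega)) ?_)
    refine Runs.seq (Runs.sub (ℓ + s - 2 ^ i) (by simp [h3]) (lt_word_of_le (by omega)) ?_)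
    have hfinal : ∀ (σ₁ : Config n) (N₁ r' ℓ' : ℕ), N₁ ≤ N + 13 → σ₁.forest = S →
        σ₁.marks = σ.marks → σ₁.mem = σ.mem →
        (∀ p < 20, p ≠ 8 → p ≠ 9 → σ₁.reg p = σ.reg p) → σ₁.reg 20 = 8 * y →
        σ₁.reg 8 = r' → σ₁.reg 9 = ℓ' → r ≤ r' → r' ≤ r + 1 →
        BinTable Λ S i z (Function.update σ.mem (8 * y) r') r' ℓ' (W ∪ S.cluster i w) →
        Runs Λ i c (.instr (.add 21 8 19) ;; .instr (.store 20 21)) σ₁ N₁ Q := by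
      intro σ₁ N₁ r' ℓ' hN₁ hf₁ hm₁ hmem₁ hreg₁ h20 h8' h9' hrr' hr' hT'
      have h19 : σ₁.reg 19 = 0 := (hreg₁ 19 (by omega) (by omega) (by omega)).trans hb.zero
      refine Runs.seq (Runs.add r' (by simp [h8', h19]) (lt_word_of_le (by omega)) ?_)
      refine Runs.store (8 * y) r' (by simp [h20]) (by simp) (lt_word_of_le (by omega)) ?_
      refine h _ _ r' ℓ' (by omega) hrr' (by simp [hf₁]) (by simp [hm₁]) ?_ ?_ ?_ (by simp [h8'])
        (by simp [h9']) (by simp [hy]) ?_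
      · intro p h1 h2 h3
        simp [show p ≠ 21 by omega]
        exact hreg₁ p h1 h2 h3
      · intro p hp
        have : p ≠ 8 * y := by omega
        simp [this, hmem₁]
      · intro v hv
        have : 8 * ((Λ.node S i v : Fin n) : ℕ) ≠ 8 * y := by
          intro heq
          have h1 : Λ.node S i v = Λ.node S i w := Fin.ext (by omega)
          rw [Λ.node_eq_iff] at h1
          exact hw (hT.closed v hv (cluster_eq_iff.1 h1))
        simp only [Config.poke_mem, Config.put_mem, this, if_false, hmem₁]
      · refine hT'.congr fun k => ?_
        simp [hmem₁, Function.update_apply]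
    refine Runs.seq (Runs.ite (fun h25 => ?_) (fun h25 => ?_))
    · simp at h25
      refine Runs.seq (Runs.add (r + 1) (by simp [h8, hb.one]) (lt_word_of_le (by omega)) ?_)
      refine Runs.add (S.size i z + s) (by simp [h5]) (lt_word_of_le (by omega)) ?_
      refine hfinal _ _ (r + 1) (S.size i z + s) (by omega) (by simp [hSdef]) (by simp) (by simp)
        ?_ (by simp) (by simp) (by simp) (by omega) (by omega) ?_
      · intro p h1 h2 h3
        simp [h2, h3, show p ≠ 20 by omega, show p ≠ 21 by omega, show p ≠ 23 by omega,
          show p ≠ 24 by omega, show p ≠ 25 by omega]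
      · rw [← hy]
        exact hT.assign hw (Or.inr ⟨rfl, by rw [hs], by rw [hs]; omega⟩) hfit'
    · simp at h25
      refine Runs.add (ℓ + s) (by simp [hb.zero]) (lt_word_of_le (by omega)) ?_
      refine hfinal _ _ r (ℓ + s) (by omega) (by simp [hSdef]) (by simp) (by simp)
        ?_ (by simp) (by simp [h8]) (by simp) (by omega) (by omega) ?_
      · intro p h1 h2 h3
        simp [h3, show p ≠ 20 by omega, show p ≠ 21 by omega, show p ≠ 23 by omega,
          show p ≠ 24 by omega, show p ≠ 25 by omega]
      · rw [← hy]
        exact hT.assign hw (Or.inl ⟨rfl, by rw [hs]⟩) (by omega)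

/-- Record the edge in the registers 14 and 15, which belongs to the bin in register 21. -/
def storeEdgeProgram : Program :=
  .instr (.const 23 2) ;; .instr (.add 23 23 10) ;; .instr (.store 23 14) ;;
  .instr (.add 23 23 18) ;; .instr (.store 23 15) ;; .instr (.add 23 23 18) ;;
  .instr (.store 23 21) ;; .instr (.const 24 8) ;; .instr (.add 10 10 24) ;;
  .instr (.add 23 21 21) ;; .instr (.add 23 23 23) ;; .instr (.add 23 23 23) ;;
  .instr (.add 23 23 18) ;; .instr (.load 24 23) ;; .instr (.add 24 24 18) ;;
  .instr (.store 23 24) ;; .instr (.sub 25 24 12) ;;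
  .ite 25 (.instr (.add 12 24 19) ;; .instr (.add 11 21 19)) .skip ;; .instr (.mark 15)

/-- Only the count of bin `j` changes, and it grows by one, so a single comparison keeps track of a
fullest bin. -/
theorem Runs.storeEdge {e : ℕ → Fin n × Fin n} {k J q j : ℕ} (hb : Base i σ)
    (hk : k ≤ n * n) (h10 : σ.reg 10 = 8 * k) (h11 : σ.reg 11 = J) (h12 : σ.reg 12 = q)
    (h14 : σ.reg 14 = (e k).1) (h15 : σ.reg 15 = (e k).2) (h21 : σ.reg 21 = j)
    (hj : j ≤ 2 * n + 1) (hR : Records σ.mem e k J q)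
    (h : ∀ σ' N' J' q', N' ≤ N + 25 → σ'.forest = σ.forest →
      σ'.marks = σ.marks ∪ σ.forest.cluster i (e k).2 →
      (∀ p < 20, p ≠ 10 → p ≠ 11 → p ≠ 12 → σ'.reg p = σ.reg p) →
      (∀ p, σ'.mem (8 * p) = σ.mem (8 * p)) →
      (∀ p < k, σ'.mem (8 * p + 4) = σ.mem (8 * p + 4)) → σ'.mem (8 * k + 4) = j →
      σ'.reg 10 = 8 * (k + 1) → σ'.reg 11 = J' → σ'.reg 12 = q' → (J' = J ∨ J' = j) →
      Records σ'.mem e (k + 1) J' q' → Q σ' N') :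
    Runs Λ i c storeEdgeProgram σ N Q := by
  have hq : q ≤ n * n := by
    rw [← hR.best, hR.count]
    refine (Finset.card_filter_le _ _).trans ?_
    rw [Finset.card_range]; exact hk
  have hcj : σ.mem (8 * j + 1) ≤ n * n := (hR.le_best j).trans hq
  have hle := hR.le_best j
  have hw : ∀ {x : ℕ}, x ≤ 8 * (n * n) + 20 * n + 20 → x < (n + 2) ^ 8 := fun hx =>
    lt_word (by nlinarith)
  unfold storeEdgeProgram
  refine Runs.seq (Runs.const (lt_word_of_le (by omega)) ?_)
  refine Runs.seq (Runs.add (8 * k + 2) (by simp [h10]; ring) (hw (by omega)) ?_)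
  refine Runs.seq (Runs.store (8 * k + 2) (e k).1 (by simp) (by simp [h14]) (fin_lt_word _) ?_)
  refine Runs.seq (Runs.add (8 * k + 3) (by simp [hb.one]) (hw (by omega)) ?_)
  refine Runs.seq (Runs.store (8 * k + 3) (e k).2 (by simp) (by simp [h15]) (fin_lt_word _) ?_)
  refine Runs.seq (Runs.add (8 * k + 4) (by simp [hb.one]) (hw (by omega)) ?_)
  refine Runs.seq (Runs.store (8 * k + 4) j (by simp) (by simp [h21]) (hw (by omega)) ?_)
  refine Runs.seq (Runs.const (lt_word_of_le (by omega)) ?_)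
  refine Runs.seq (Runs.add (8 * (k + 1)) (by simp [h10]; ring) (hw (by omega)) ?_)
  refine Runs.seq (Runs.add (2 * j) (by simp [h21]; ring) (hw (by omega)) ?_)
  refine Runs.seq (Runs.add (4 * j) (by simp; ring) (hw (by omega)) ?_)
  refine Runs.seq (Runs.add (8 * j) (by simp; ring) (hw (by omega)) ?_)
  refine Runs.seq (Runs.add (8 * j + 1) (by simp [hb.one]) (hw (by omega)) ?_)
  refine Runs.seq (Runs.load (σ.mem (8 * j + 1)) (by
    simp; rw [if_neg (by omega), if_neg (by omega), if_neg (by omega)]) (hw (by omega)) ?_)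
  refine Runs.seq (Runs.add (σ.mem (8 * j + 1) + 1) (by simp [hb.one]) (hw (by omega)) ?_)
  refine Runs.seq (Runs.store (8 * j + 1) (σ.mem (8 * j + 1) + 1) (by simp) (by simp)
    (hw (by omega)) ?_)
  refine Runs.seq (Runs.sub (σ.mem (8 * j + 1) + 1 - q) (by simp [h12]) (hw (by omega)) ?_)
  -- the remaining part of the program only changes registers
  have hfinal : ∀ (σ₁ : Config n) (N₁ J' q' : ℕ), N₁ ≤ N + 24 → σ₁.forest = σ.forest →
      σ₁.marks = σ.marks → (∀ p < 20, p ≠ 10 → p ≠ 11 → p ≠ 12 → σ₁.reg p = σ.reg p) →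
      (∀ p, σ₁.mem p = if p = 8 * j + 1 then σ.mem (8 * j + 1) + 1 else
        if p = 8 * k + 4 then j else if p = 8 * k + 3 then ((e k).2 : ℕ) else
        if p = 8 * k + 2 then ((e k).1 : ℕ) else σ.mem p) →
      σ₁.reg 10 = 8 * (k + 1) → σ₁.reg 11 = J' → σ₁.reg 12 = q' →
      (q < σ.mem (8 * j + 1) + 1 ∧ J' = j ∧ q' = σ.mem (8 * j + 1) + 1 ∨
        σ.mem (8 * j + 1) + 1 ≤ q ∧ J' = J ∧ q' = q) →
      Runs Λ i c (.instr (.mark 15)) σ₁ N₁ Q := by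
    intro σ₁ N₁ J' q' hN₁ hf₁ hm₁ hreg₁ hmem₁ h10' h11' h12' hJ
    have h15' : σ₁.reg 15 = (e k).2 :=
      (hreg₁ 15 (by omega) (by omega) (by omega) (by omega)).trans h15
    refine Runs.step (Step.mark _ 15 (e k).2 h15') ?_
    refine h _ _ J' q' (by omega) hf₁ (by simp only [hm₁, hf₁]) hreg₁ ?_ ?_ ?_ h10' h11' h12'
      (by omega) ?_
    · intro p
      change σ₁.mem _ = _
      rw [hmem₁, if_neg (by omega), if_neg (by omega), if_neg (by omega), if_neg (by omega)]
    · intro p hp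
      change σ₁.mem _ = _
      rw [hmem₁, if_neg (by omega), if_neg (by omega), if_neg (by omega), if_neg (by omega)]
    · change σ₁.mem _ = _
      rw [hmem₁, if_neg (by omega), if_pos rfl]
    · refine hR.snoc (j := j) (fun l h1 h2 h3 h4 h5 => ?_) ?_ ?_ ?_ ?_ hJ
      · change σ₁.mem _ = _
        rw [hmem₁, if_neg h5, if_neg h4, if_neg h3, if_neg h2]
      · change σ₁.mem _ = _
        rw [hmem₁, if_neg (by omega), if_neg (by omega), if_neg (by omega), if_pos rfl]
      · change σ₁.mem _ = _
        rw [hmem₁, if_neg (by omega), if_neg (by omega), if_pos rfl]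
      · change σ₁.mem _ = _
        rw [hmem₁, if_neg (by omega), if_pos rfl]
      · change σ₁.mem _ = _
        rw [hmem₁, if_pos rfl]
  refine Runs.seq (Runs.ite (fun h25 => ?_) (fun h25 => Runs.skip ?_))
  · simp at h25
    refine Runs.seq (Runs.add (σ.mem (8 * j + 1) + 1) (by simp [hb.zero]) (hw (by omega)) ?_)
    refine Runs.add j (by simp [hb.zero, h21]) (hw (by omega)) ?_
    refine hfinal _ _ j (σ.mem (8 * j + 1) + 1) (by omega) (by simp) (by simp) ?_ (by simp)
      (by simp) (by simp) (by simp) (Or.inl ⟨by omega, rfl, rfl⟩)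
    intro p h1 h2 h3 h4
    simp [h2, h3, h4, show p ≠ 23 by omega, show p ≠ 24 by omega, show p ≠ 25 by omega]
  · simp at h25
    refine hfinal _ _ J q (by omega) (by simp) (by simp) ?_ (by simp)
      (by simp) (by simp [h11]) (by simp [h12]) (Or.inr ⟨by omega, rfl, rfl⟩)
    intro p h1 h2 h3 h4
    simp [h2, show p ≠ 23 by omega, show p ≠ 24 by omega, show p ≠ 25 by omega]

end Recording

/-! ### Scanning the edges at the smaller half -/

section Scanning

open LeveledGraph

variable {n : ℕ} {Λ : Layout n} {i : ℕ} {c : Set (Fin n)}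
variable {σ σ' : Config n} {N : ℕ} {Q : Config n → ℕ → Prop}
variable {S : LeveledGraph n} {z : Fin n} {mem : ℕ → ℕ}

/-- The `q`-th edge at the level `i` cluster of `z`. -/
def scanEdge (Λ : Layout n) (S : LeveledGraph n) (i : ℕ) (z : Fin n) (q : ℕ) : Fin n × Fin n :=
  (Λ.edgeList S i z).getD q (z, z)

/-- The vertices of the clusters at the far ends of the first `k` edges at the cluster of `z`. -/
def scanned (Λ : Layout n) (S : LeveledGraph n) (i : ℕ) (z : Fin n) (k : ℕ) : Set (Fin n) :=
  {v | ∃ q < k, v ∈ S.cluster i (scanEdge Λ S i z q).2}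

theorem scanned_succ {k : ℕ} : scanned Λ S i z (k + 1) =
    scanned Λ S i z k ∪ S.cluster i (scanEdge Λ S i z k).2 := by
  ext v
  simp only [scanned, Set.mem_union, Set.mem_ofPred_eq, Order.lt_add_one_iff]
  constructor
  · rintro ⟨q, hq, h⟩
    rcases hq.lt_or_eq with h1 | rfl
    · exact Or.inl ⟨q, h1, h⟩
    · exact Or.inr h
  · rintro (⟨q, hq, h⟩ | h)
    · exact ⟨q, hq.le, h⟩
    · exact ⟨k, le_rfl, h⟩

theorem scanned_zero : scanned Λ S i z 0 = ∅ := by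
  ext v; simp [scanned]

theorem scanEdge_spec {q : ℕ} (hq : q < (Λ.edgeList S i z).length) :
    (scanEdge Λ S i z q).1 ∈ S.cluster i z ∧
      S.IsEdge (i + 1) (scanEdge Λ S i z q).1 (scanEdge Λ S i z q).2 := by
  refine (Λ.mem_edgeList S i z _ _).1 ?_
  unfold scanEdge
  rw [List.getD_eq_getElem _ _ hq]
  exact List.getElem_mem hq

theorem scanEdge_of_getElem? {q : ℕ} {p : Fin n × Fin n} (h : (Λ.edgeList S i z)[q]? = some p) :
    q < (Λ.edgeList S i z).length ∧ scanEdge Λ S i z q = p := by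
  obtain ⟨h1, h2⟩ := List.getElem?_eq_some_iff.1 h
  refine ⟨h1, ?_⟩
  unfold scanEdge
  rw [List.getD_eq_getElem _ _ h1, h2]

theorem scanEdge_injOn {q q' : ℕ} (hq : q < (Λ.edgeList S i z).length)
    (hq' : q' < (Λ.edgeList S i z).length) (h : scanEdge Λ S i z q = scanEdge Λ S i z q') :
    q = q' := by
  unfold scanEdge at h
  rw [List.getD_eq_getElem _ _ hq, List.getD_eq_getElem _ _ hq'] at h
  exact (Λ.edgeList_nodup S i z).getElem_inj_iff.1 h

theorem idxOf_scanEdge {q : ℕ} (hq : q < (Λ.edgeList S i z).length) :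
    (Λ.edgeList S i z).idxOf (scanEdge Λ S i z q) = q := by
  unfold scanEdge
  rw [List.getD_eq_getElem _ _ hq]
  exact (Λ.edgeList_nodup S i z).idxOf_getElem q hq

theorem edgeList_length_le : (Λ.edgeList S i z).length ≤ n * n := by
  have := (Λ.edgeList_nodup S i z).length_le_card
  simpa using this

/-- The first `k` edges at the cluster of `z` are unblocked, and they are recorded with their
bins. -/
structure Scan (Λ : Layout n) (S : LeveledGraph n) (i : ℕ) (z : Fin n) (mem : ℕ → ℕ)
    (k r ℓ J q : ℕ) : Prop where
  le_length : k ≤ (Λ.edgeList S i z).length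
  unblocked : ∀ l < k, ¬ S.IsBlocked i (scanEdge Λ S i z l).1 (scanEdge Λ S i z l).2
  table : BinTable Λ S i z mem r ℓ (S.cluster i z ∪ scanned Λ S i z k)
  records : Records mem (scanEdge Λ S i z) k J q
  bin_eq : ∀ l < k, mem (8 * l + 4) = mem (8 * Λ.node S i (scanEdge Λ S i z l).2)
  one_le : 1 ≤ J
  le_r : J ≤ r

theorem BinTable.init (h0 : ∀ p, mem p = 0) (hz : S.size i z ≤ 2 ^ i) :
    BinTable Λ S i z (Function.update mem (8 * Λ.node S i z) 1) 1 (S.size i z)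
      (S.cluster i z) := by
  classical
  have hnew : ∀ v, Function.update mem (8 * (Λ.node S i z : ℕ)) 1 (8 * Λ.node S i v) =
      if v ∈ S.cluster i z then 1 else 0 := by
    intro v
    rw [Function.update_apply, h0]
    refine if_congr ?_ rfl rfl
    rw [mem_cluster_comm, ← cluster_eq_iff, ← Λ.node_eq_iff, ← Fin.val_inj]
    omega
  have hbin : ∀ j ≠ 0, binSet Λ S i z (Function.update mem (8 * (Λ.node S i z : ℕ)) 1) j ⊆
      S.cluster i z := by
    rintro j hj v (hv | hv)
    · have hv : Function.update mem (8 * (Λ.node S i z : ℕ)) 1 (8 * Λ.node S i v) = j := hv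
      rw [hnew] at hv
      by_contra h1
      rw [if_neg h1] at hv
      exact hj hv.symm
    · exact hv
  have hcard : ∀ j ≠ 0, (binSet Λ S i z (Function.update mem (8 * (Λ.node S i z : ℕ)) 1) j).ncard ≤
      S.size i z := fun j hj => Set.ncard_le_ncard (hbin j hj)
  refine ⟨?_, closed_cluster S i z, self_mem_cluster _ _ _, ?_, le_rfl, ?_,
    fun j hj => (hcard j hj).trans hz, hcard 1 one_ne_zero, hz, ?_⟩
  · intro v; rw [hnew]; simp
  · rw [hnew, if_pos (self_mem_cluster _ _ _)]
  · intro v; rw [hnew]; split_ifs <;> omega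
  · simp only [Nat.sub_self, zero_mul, zero_add]
    unfold LeveledGraph.size; omega

/-- Record the edges at the cluster of the vertex in register 2 up to the first blocked one. -/
def scanProgram : Program :=
  .instr (.cluster 20 2 0) ;; .instr (.add 20 20 20) ;; .instr (.add 20 20 20) ;;
  .instr (.add 20 20 20) ;; .instr (.store 20 18) ;; .instr (.const 8 1) ;;
  .instr (.add 9 5 19) ;; .instr (.const 11 1) ;; .instr (.const 10 0) ;; .instr (.const 12 0) ;;
  .instr (.firstEdge 13 14 15 2 0) ;;
  .loop 13 (.instr (.add 20 14 19) ;; .instr (.add 21 15 19) ;; checkProgram ;;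
    .ite 22 (assignProgram ;; storeEdgeProgram ;; .instr (.nextEdge 13 14 15))
      (.instr (.const 13 0)))

/-- The forest does not change during the scan, so there is one fixed edge list and each query for
the next edge advances the index by one. Nothing is pushed before the fullest bin is known. -/
theorem Runs.scan (hb : Base i σ) (hi : i + 1 ≤ maxLevel n) (hS : σ.forest = S)
    (h2 : σ.reg 2 = z) (h3 : σ.reg 3 = 2 ^ i) (h5 : σ.reg 5 = S.size i z)
    (hsize : S.SizeInvariant) (h0 : ∀ p, σ.mem p = 0)
    (h : ∀ σ' N' k r ℓ J q, N' ≤ N + 100 * k + 100 → σ'.forest = S →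
      σ'.marks = σ.marks ∪ scanned Λ S i z k →
      (∀ p < 20, p < 8 ∨ 15 < p → σ'.reg p = σ.reg p) → σ'.reg 10 = 8 * k → σ'.reg 11 = J →
      Scan Λ S i z σ'.mem k r ℓ J q →
      (k = (Λ.edgeList S i z).length ∨
        S.IsBlocked i (scanEdge Λ S i z k).1 (scanEdge Λ S i z k).2 ∧
          (scanEdge Λ S i z k).1 ∈ S.cluster i z) → Q σ' N') :
    Runs Λ i c scanProgram σ N Q := by
  have hi' := two_pow_lt hi
  have hnode := (Λ.node S i z).2
  have hsz := S.size_le i z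
  have hlen : (Λ.edgeList S i z).length ≤ n * n := edgeList_length_le
  unfold scanProgram
  refine Runs.seq (Runs.cluster (a := z) (j := i) h2 hb.level ?_)
  rw [hS]
  generalize hy : ((Λ.node S i z : Fin n) : ℕ) = y at hnode
  refine Runs.seq (Runs.add (2 * y) (by simp; ring) (lt_word_of_le (by omega)) ?_)
  refine Runs.seq (Runs.add (4 * y) (by simp; ring) (lt_word_of_le (by omega)) ?_)
  refine Runs.seq (Runs.add (8 * y) (by simp; ring) (lt_word_of_le (by omega)) ?_)
  refine Runs.seq (Runs.store (8 * y) 1 (by simp) (by simp [hb.one]) (lt_word_of_le (by omega)) ?_)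
  refine Runs.seq (Runs.const (lt_word_of_le (by omega)) ?_)
  refine Runs.seq (Runs.add (S.size i z) (by simp [hb.zero, h5]) (lt_word_of_le (by omega)) ?_)
  refine Runs.seq (Runs.const (lt_word_of_le (by omega)) ?_)
  refine Runs.seq (Runs.const (lt_word_of_le (by omega)) ?_)
  refine Runs.seq (Runs.const (lt_word_of_le (by omega)) ?_)
  let Inv : Config n → ℕ → Prop := fun σ' N' => ∃ k r ℓ J q,
      N' ≤ N + 20 + 90 * k + (if σ'.reg 13 = 0 then 70 else 0) ∧ σ'.forest = S ∧
      σ'.marks = σ.marks ∪ scanned Λ S i z k ∧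
      (∀ p < 20, p < 8 ∨ 15 < p → σ'.reg p = σ.reg p) ∧ σ'.reg 8 = r ∧ σ'.reg 9 = ℓ ∧
      σ'.reg 10 = 8 * k ∧ σ'.reg 11 = J ∧ σ'.reg 12 = q ∧ Scan Λ S i z σ'.mem k r ℓ J q ∧
      (σ'.reg 13 = 0 → k = (Λ.edgeList S i z).length ∨
        S.IsBlocked i (scanEdge Λ S i z k).1 (scanEdge Λ S i z k).2 ∧
          (scanEdge Λ S i z k).1 ∈ S.cluster i z) ∧
      (σ'.reg 13 ≠ 0 → k < (Λ.edgeList S i z).length ∧ σ'.reg 14 = (scanEdge Λ S i z k).1 ∧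
        σ'.reg 15 = (scanEdge Λ S i z k).2)
  have hscan0 : ∀ mem : ℕ → ℕ, (∀ p, mem p = if p = 8 * y then 1 else 0) →
      Scan Λ S i z mem 0 1 (S.size i z) 1 0 := by
    intro mem hm
    refine ⟨Nat.zero_le _, by simp, ?_, ⟨by simp, by simp, ?_, ?_, ?_⟩, by simp, le_rfl, le_rfl⟩
    · rw [scanned_zero, Set.union_empty]
      refine (BinTable.init (mem := σ.mem) h0 (hsize i z)).congr fun k => ?_
      rw [hm, Function.update_apply, hy, h0]
    · intro j; rw [hm, if_neg (by omega)]; simp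
    · rw [hm, if_neg (by omega)]
    · intro j; rw [hm, if_neg (by omega)]
  refine Runs.seq (Runs.mono (Q := Inv) (Runs.firstEdge (a := z) (j := i) (by simp [h2])
    (by simp [hb.level]) ?_ ?_) ?_)
  · intro hL
    simp only [Config.put_forest, Config.poke_forest, hS] at hL
    have hnil := eq_nil_of_getElem?_zero hL
    refine ⟨0, 1, S.size i z, 1, 0, ?_, by simp [hS], by simp [scanned_zero], ?_, by simp, by simp,
      by simp, by simp, by simp, hscan0 _ ?_, fun _ => Or.inl (by rw [hnil]; rfl), by simp⟩
    · simp only [Config.put_reg, if_true]; omega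
    · intro p h1 h2
      simp [show p ≠ 8 by omega, show p ≠ 9 by omega, show p ≠ 10 by omega, show p ≠ 11 by omega,
        show p ≠ 12 by omega, show p ≠ 13 by omega, show p ≠ 20 by omega]
    · intro p; simp [h0]
  · intro x w hL
    simp only [Config.put_forest, Config.poke_forest, hS] at hL
    obtain ⟨h4, h5⟩ := scanEdge_of_getElem? hL
    refine ⟨0, 1, S.size i z, 1, 0, ?_, by simp [hS], by simp [scanned_zero], ?_, by simp, by simp,
      by simp, by simp, by simp, hscan0 _ ?_, by simp, fun _ => ⟨h4, by simp [h5], by simp [h5]⟩⟩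
    · simp only [Config.put_reg, if_true, one_ne_zero, if_false]; omega
    · intro p h1 h2
      simp [show p ≠ 8 by omega, show p ≠ 9 by omega, show p ≠ 10 by omega, show p ≠ 11 by omega,
        show p ≠ 12 by omega, show p ≠ 13 by omega, show p ≠ 14 by omega, show p ≠ 15 by omega,
        show p ≠ 20 by omega]
    · intro p; simp [h0]
  intro σ₀ N₀ hinv₀
  refine Runs.loop Inv (fun σ' => if σ'.reg 13 = 0 then 0 else
    8 * (Λ.edgeList S i z).length + 1 - σ'.reg 10) hinv₀ ?_ ?_
  · rintro σ₁ N₁ ⟨k, r, ℓ, J, q, hN₁, hf, hm, hreg, h8, h9, h10, h11, h12, hsc, -, hne1⟩ hne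
    obtain ⟨hk, h14, h15⟩ := hne1 hne
    rw [if_neg hne] at hN₁
    obtain ⟨he1, he2⟩ := scanEdge_spec hk
    have hb₁ : Base i σ₁ := ⟨(hreg 0 (by omega) (by omega)).trans hb.level,
      (hreg 18 (by omega) (by omega)).trans hb.one, (hreg 19 (by omega) (by omega)).trans hb.zero⟩
    generalize hek : scanEdge Λ S i z k = ek at *
    obtain ⟨u, w⟩ := ek
    simp only at he1 he2 h14 h15
    refine Runs.seq (Runs.add u (by simp [hb₁.zero, h14]) (fin_lt_word _) ?_)
    refine Runs.seq (Runs.add w (by simp [hb₁.zero, h15]) (fin_lt_word _) ?_)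
    have hF : Frame 40 σ₁ ((σ₁.put 20 u).put 21 w) := by simp [Frame.put_iff, Frame.refl]
    refine Runs.seq (Runs.check (a := u) (b := w) (j := i) (hF.base hb₁) (by simp) (by simp)
      (by simp only [Config.put_forest, hf]; exact he2) ?_)
    intro σ₂ N₂ hN₂ hF₂ hf₂ _ _ _ h22
    replace hF₂ := hF.trans hF₂
    simp only [Config.put_forest, hf] at hf₂ h22
    refine Runs.ite (fun h22' => ?_) (fun h22' => ?_)
    · have hub : ¬ S.IsBlocked i u w := by
        rcases h22 with h6 | h6
        · exact h6.2
        · exact absurd h6.1 h22'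
      have hb₂ := hF₂.base hb₁
      have hreg₂ : ∀ p < 20, σ₂.reg p = σ₁.reg p := fun p hp => hF₂.reg p (Or.inl hp)
      have hreg₂' : ∀ p < 20, p < 8 ∨ 15 < p → σ₂.reg p = σ.reg p := fun p hp hp' =>
        (hreg₂ p hp).trans (hreg p hp hp')
      refine Runs.seq (Runs.assign (S := S) (z := z) (w := w) (r := r) (ℓ := ℓ) hb₂ hf₂ hi
        ((hreg₂' 3 (by omega) (by omega)).trans h3) ((hreg₂' 5 (by omega) (by omega)).trans h5)
        ((hreg₂ 8 (by omega)).trans h8) ((hreg₂ 9 (by omega)).trans h9)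
        ((hreg₂ 15 (by omega)).trans h15) (by rw [hF₂.mem]; exact hsc.table) ?_ ?_)
      -- A far cluster without a bin differs from the cluster of `z`, so an unblocked edge to it
      -- means that the two fit into one bin.
      · intro hw
        have hne' : S.cluster i u ≠ S.cluster i w := by
          intro heq
          refine hw (Or.inl ?_)
          rw [← cluster_eq_of_mem he1, heq]; exact self_mem_cluster _ _ _
        by_contra hcon
        refine hub ⟨he2, hne', ?_⟩
        rw [size_congr (cluster_eq_of_mem he1)]; omega
      intro σ₃ N₃ r' ℓ' hN₃ hrr hf₃ hm₃ hreg₃ hmem₃ hmemW h8₃ h9₃ h21₃ hT₃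
      have hb₃ : Base i σ₃ := ⟨(hreg₃ 0 (by omega) (by omega) (by omega)).trans hb₂.level,
        (hreg₃ 18 (by omega) (by omega) (by omega)).trans hb₂.one,
        (hreg₃ 19 (by omega) (by omega) (by omega)).trans hb₂.zero⟩
      have hreg₃' : ∀ p < 20, p ≠ 8 → p ≠ 9 → σ₃.reg p = σ₁.reg p := fun p h1 h2 h3 =>
        (hreg₃ p h1 h2 h3).trans (hreg₂ p h1)
      have hrec : Records σ₃.mem (scanEdge Λ S i z) k J q := by
        refine hsc.records.congr fun l hl _ => ?_
        rw [hmem₃ l hl, hF₂.mem]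
      have hjb := hT₃.bin_le w
      have hjb' := hT₃.bin_bound
      refine Runs.seq (Runs.storeEdge (e := scanEdge Λ S i z) (k := k) (J := J) (q := q)
        (j := σ₃.mem (8 * Λ.node S i w)) hb₃ (by omega)
        ((hreg₃' 10 (by omega) (by omega) (by omega)).trans h10)
        ((hreg₃' 11 (by omega) (by omega) (by omega)).trans h11)
        ((hreg₃' 12 (by omega) (by omega) (by omega)).trans h12)
        (by rw [hek]; exact (hreg₃' 14 (by omega) (by omega) (by omega)).trans h14)
        (by rw [hek]; exact (hreg₃' 15 (by omega) (by omega) (by omega)).trans h15)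
        h21₃ (by omega) hrec ?_)
      rw [hek]
      intro σ₄ N₄ J' q' hN₄ hf₄ hm₄ hreg₄ hmem₄ hmem₄' hmemk h10₄ h11₄ h12₄ hJ' hR₄
      rw [hf₃] at hf₄ hm₄
      rw [hm₃, hF₂.marks, hm] at hm₄
      have hW : S.cluster i z ∪ scanned Λ S i z (k + 1) =
          S.cluster i z ∪ scanned Λ S i z k ∪ S.cluster i w := by
        rw [scanned_succ, hek, Set.union_assoc]
      have hr'J : 1 ≤ σ₃.mem (8 * Λ.node S i w) := by
        have := (hT₃.ne_zero w).2 (Or.inr (self_mem_cluster _ _ _))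
        omega
      have hsc' : Scan Λ S i z σ₄.mem (k + 1) r' ℓ' J' q' := by
        refine ⟨hk, ?_, ?_, hR₄, ?_, ?_, ?_⟩
        · intro l hl
          rcases Nat.lt_or_ge l k with h6 | h6
          · exact hsc.unblocked l h6
          · have : l = k := by omega
            subst this; rw [hek]; exact hub
        · rw [hW]
          exact hT₃.congr hmem₄
        · intro l hl
          rw [hmem₄]
          rcases Nat.lt_or_ge l k with h6 | h6
          · rw [hmem₄' l h6, hmem₃ _ (by omega), hmemW, hF₂.mem]
            · exact hsc.bin_eq l h6
            · exact Or.inr ⟨l, h6, self_mem_cluster _ _ _⟩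
          · have : l = k := by omega
            subst this; rw [hek, hmemk]
        · rcases hJ' with h6 | h6
          · rw [h6]; exact hsc.one_le
          · rw [h6]; exact hr'J
        · have := hsc.le_r
          rcases hJ' with h6 | h6 <;> omega
      have hreg₄' : ∀ p < 20, p < 8 ∨ 15 < p → σ₄.reg p = σ.reg p := fun p h1 h2 =>
        ((hreg₄ p h1 (by omega) (by omega) (by omega)).trans
          (hreg₃' p h1 (by omega) (by omega))).trans (hreg p h1 h2)
      have hidx := idxOf_scanEdge hk
      rw [hek] at hidx
      have hL : Λ.edgeList S i u = Λ.edgeList S i z := Λ.edgeList_eq S i u z (cluster_eq_of_mem he1)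
      have h8₄ : σ₄.reg 8 = r' :=
        (hreg₄ 8 (by omega) (by omega) (by omega) (by omega)).trans h8₃
      have h9₄ : σ₄.reg 9 = ℓ' :=
        (hreg₄ 9 (by omega) (by omega) (by omega) (by omega)).trans h9₃
      refine Runs.nextEdge (a := u) (b := w) (j := i)
        ((hreg₄ 14 (by omega) (by omega) (by omega) (by omega)).trans
          ((hreg₃' 14 (by omega) (by omega) (by omega)).trans h14))
        ((hreg₄ 15 (by omega) (by omega) (by omega) (by omega)).trans
          ((hreg₃' 15 (by omega) (by omega) (by omega)).trans h15)) (by rw [hf₄]; exact he2) ?_ ?_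
      · intro hnone
        rw [hf₄, hL, hidx] at hnone
        refine ⟨⟨k + 1, r', ℓ', J', q', ?_, hf₄, ?_, ?_, by simp [h8₄], by simp [h9₄], by simp [h10₄],
          by simp [h11₄], by simp [h12₄], hsc', fun _ => Or.inl ?_, by simp⟩, ?_⟩
        · simp only [Config.put_reg, if_true]; omega
        · rw [Config.put_marks, hm₄, scanned_succ, hek, Set.union_assoc]
        · intro p h1 h2
          rw [Config.put_reg, if_neg (by omega)]; exact hreg₄' p h1 h2
        · have := List.getElem?_eq_none_iff.1 hnone
          omega
        · simp [hne]; omega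
      · intro x y hsome
        rw [hf₄, hL, hidx] at hsome
        obtain ⟨h6, h7⟩ := scanEdge_of_getElem? hsome
        refine ⟨⟨k + 1, r', ℓ', J', q', ?_, hf₄, ?_, ?_, by simp [h8₄], by simp [h9₄], by simp [h10₄],
          by simp [h11₄], by simp [h12₄], hsc', by simp, fun _ => ⟨h6, by simp [h7], by simp [h7]⟩⟩,
          ?_⟩
        · simp only [Config.put_reg, if_true, one_ne_zero, if_false]; omega
        · simp only [Config.put_marks]
          rw [hm₄, scanned_succ, hek, Set.union_assoc]
        · intro p h1 h2
          simp only [Config.put_reg]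
          rw [if_neg (by omega), if_neg (by omega), if_neg (by omega)]; exact hreg₄' p h1 h2
        · simp [hne, h10₄, h10]; omega
    · have hbl : S.IsBlocked i u w := by
        rcases h22 with h6 | h6
        · rw [h6.1] at h22'; exact absurd h22' one_ne_zero
        · exact h6.2
      refine Runs.const (lt_word_of_le (by omega)) ?_
      have hreg₂ : ∀ p < 20, σ₂.reg p = σ₁.reg p := fun p hp => hF₂.reg p (Or.inl hp)
      refine ⟨⟨k, r, ℓ, J, q, ?_, hf₂, ?_, ?_, ?_, ?_, ?_, ?_, ?_, ?_, fun _ => Or.inr ?_, by simp⟩,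
        ?_⟩
      · simp only [Config.put_reg, if_true]; omega
      · simp only [Config.put_marks]; rw [hF₂.marks, hm]
      · intro p h1 h2
        rw [Config.put_reg, if_neg (by omega), hreg₂ p h1]; exact hreg p h1 h2
      · simp [hreg₂, h8]
      · simp [hreg₂, h9]
      · simp [hreg₂, h10]
      · simp [hreg₂, h11]
      · simp [hreg₂, h12]
      · rw [Config.put_mem, hF₂.mem]; exact hsc
      · rw [hek]; exact ⟨hbl, he1⟩
      · simp [hne]; omega
  · rintro σ₁ N₁ ⟨k, r, ℓ, J, q, hN₁, hf, hm, hreg, h8, h9, h10, h11, h12, hsc, hz, -⟩ hzero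
    rw [if_pos hzero] at hN₁
    exact h σ₁ _ k r ℓ J q (by omega) hf hm hreg h10 h11 hsc (hz hzero)

end Scanning

namespace LeveledGraph

variable {n : ℕ} {S S' S'' S₀ S₁ : LeveledGraph n} {i : ℕ} {c X X₁ X₂ M : Set (Fin n)}
  {xa xb u v w x y o : Fin n}

/-! ### The state after a split -/

/-- The clusters of `xa` and `xb` are two children of `c`, the second one not larger than the first
one. Every other child has a blocked edge, or it has an edge to one of the two that was blocked
when the two were one. -/
structure Halves (S : LeveledGraph n) (i : ℕ) (c : Set (Fin n)) (xa xb : Fin n) : Prop where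
  sizeInvariant : S.SizeInvariant
  closed : S.Closed (i + 1) c
  card_le : c.ncard ≤ 2 * 2 ^ i
  mem_left : xa ∈ c
  mem_right : xb ∈ c
  ne : S.cluster i xa ≠ S.cluster i xb
  size_le : S.size i xb ≤ S.size i xa
  add_le : S.size i xa + S.size i xb ≤ 2 ^ i
  free : ∀ v ∈ c, v ∉ S.cluster i xa → v ∉ S.cluster i xb → S.Good i v ∨
    2 ^ i < S.size i v + S.size i xa + S.size i xb ∧
      ∃ u ∈ S.cluster i v, ∃ w, (w ∈ S.cluster i xa ∨ w ∈ S.cluster i xb) ∧ S.IsEdge (i + 1) u w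

theorem IsSplit.symm (h : IsSplit S₀ S₁ i c X X₁ X₂) : IsSplit S₀ S₁ i c X X₂ X₁ :=
  ⟨h.isCluster, h.isChild, h.right, h.left, h.disjoint.symm, by rw [Set.union_comm]; exact h.union,
    h.others, h.edges⟩

theorem IsCluster.eq_cluster (h : S.IsCluster i X) (hx : x ∈ X) : X = S.cluster i x := by
  obtain ⟨v, rfl⟩ := h
  exact (cluster_eq_of_mem hx).symm

/-- The children other than `X` keep their vertices and edges, so blocked edges between them stay
blocked. A blocked edge to `X` now ends in one of the halves, and its former blockedness is the size
inequality in `free`. -/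
theorem IsSplit.halves (h : IsSplit S₀ S₁ i c X X₁ X₂) (hS₀ : S₀.SizeInvariant)
    (hS₁ : S₁.SizeInvariant) (hb : S₀.BlockedInvariant i c) (ha : xa ∈ X₁) (hbx : xb ∈ X₂)
    (hle : S₁.size i xb ≤ S₁.size i xa) : Halves S₁ i c xa xb := by
  have hXc : X ⊆ c := h.isChild.2
  have hXa := h.left.eq_cluster ha
  have hXb := h.right.eq_cluster hbx
  have hXu := h.union
  rw [hXa, hXb] at hXu
  have haX : xa ∈ X := hXu ▸ Or.inl (self_mem_cluster _ _ _)
  have hbX : xb ∈ X := hXu ▸ Or.inr (self_mem_cluster _ _ _)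
  have hne : S₁.cluster i xa ≠ S₁.cluster i xb := by
    intro heq
    have hd := h.disjoint
    rw [hXa, hXb, heq, disjoint_self] at hd
    have := self_mem_cluster S₁ i xb
    rw [hd] at this
    exact this
  have hXS : X = S₀.cluster i xa := h.isChild.1.eq_cluster haX
  have hadd : S₁.size i xa + S₁.size i xb = S₀.size i xa := by
    rw [← size_eq_add hne hXu.symm, hXS]; rfl
  obtain ⟨r, hr⟩ := h.isCluster
  have hc0 : S₀.Closed i c := by
    rw [hr]
    exact fun v hv => (cluster_mono (Nat.le_succ i)).trans (closed_cluster S₀ (i + 1) r v hv)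
  have hcl : ∀ v ∈ c, v ∉ X → S₁.cluster i v = S₀.cluster i v := by
    intro v hv hvX
    refine ((h.others (S₀.cluster i v) ⟨⟨v, rfl⟩, hc0 v hv⟩ ?_).eq_cluster
      (self_mem_cluster _ _ _)).symm
    intro heq
    exact hvX (heq ▸ self_mem_cluster _ _ _)
  have hc1 : S₁.Closed i c := by
    intro v hv
    by_cases hvX : v ∈ X
    · rw [← hXu] at hvX
      refine Set.Subset.trans ?_ hXc
      rcases hvX with h1 | h1
      · rw [cluster_eq_of_mem h1, ← hXu]; exact Set.subset_union_left
      · rw [cluster_eq_of_mem h1, ← hXu]; exact Set.subset_union_right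
    · rw [hcl v hv hvX]; exact hc0 v hv
  have hedge : ∀ u ∈ c, ∀ w, S₀.IsEdge (i + 1) u w → w ∈ c := by
    intro u hu w he
    rw [hr] at hu ⊢
    exact closed_cluster S₀ (i + 1) r u hu (mem_cluster_of_level_le he.1 he.2.le)
  refine ⟨hS₁, ?_, ?_, hXc haX, hXc hbX, hne, hle, ?_, ?_⟩
  -- The set `c` may have been disconnected, so in the new state it is only a union of level `i + 1`
  -- clusters.
  · refine closed_of_adj fun a ha b hab hl => ?_
    rcases Nat.lt_or_ge (S₁.level s(a, b)) (i + 1) with h1 | h1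
    · exact hc1 a ha (mem_cluster_of_level_le hab (by omega))
    · exact hedge a ha b ((h.edges a ha b).1 ⟨hab, by omega⟩)
  · have := hS₀ (i + 1) r
    rw [pow_succ, mul_comm] at this
    rw [hr]; exact this
  · rw [hadd]; exact hS₀ i xa
  · intro v hv hva hvb
    have hvX : v ∉ X := by rw [← hXu]; rintro (h1 | h1) <;> contradiction
    have hvne : S₀.cluster i v ≠ X := fun heq => hvX (heq ▸ self_mem_cluster _ _ _)
    rcases hb with hb | ⟨Y, -, hY⟩
    · obtain ⟨u, hu, w, hbl⟩ := hb (S₀.cluster i v) ⟨⟨v, rfl⟩, hc0 v hv⟩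
      have huc : u ∈ c := hc0 v hv hu
      have hwc : w ∈ c := hedge u huc w hbl.1
      have he := (h.edges u huc w).2 hbl.1
      have huX : u ∉ X := by
        intro h1
        rw [hXS] at h1 hvX
        exact hvX (by
          rw [← cluster_eq_of_mem h1, cluster_eq_of_mem hu]; exact self_mem_cluster _ _ _)
      have hu1 : u ∈ S₁.cluster i v := by rw [hcl v hv hvX]; exact hu
      by_cases hwX : w ∈ X
      · right
        refine ⟨?_, u, hu1, w, ?_, he⟩
        · have h1 := hbl.2.2
          rw [hXS] at hwX
          rw [size_congr (cluster_eq_of_mem hwX), size_congr (cluster_eq_of_mem hu)] at h1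
          rw [add_assoc, hadd]
          unfold size at h1 ⊢
          rw [hcl v hv hvX]; exact h1
        · rw [← hXu] at hwX; exact hwX
      · left
        refine ⟨u, hu1, w, he, ?_, ?_⟩
        · rw [hcl u huc huX, hcl w hwc hwX]; exact hbl.2.1
        · have := hbl.2.2
          unfold size at this ⊢
          rw [hcl u huc huX, hcl w hwc hwX]; exact this
    -- If `X` was the only child, there is no vertex of `c` outside of it.
    · have h1 := hY X h.isChild
      have h2 := hY (S₀.cluster i v) ⟨⟨v, rfl⟩, hc0 v hv⟩
      exact absurd (h2.trans h1.symm) hvne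

/-- If some other child is so small that it could be merged with both, then no child has lost its
blocked edges. -/
theorem Halves.good_of_light (h : Halves S i c xa xb) (ho : o ∈ c) (hoa : o ∉ S.cluster i xa)
    (hob : o ∉ S.cluster i xb) (hs : S.size i o + S.size i xa + S.size i xb ≤ 2 ^ i)
    (hv : v ∈ c) (hva : v ∉ S.cluster i xa) (hvb : v ∉ S.cluster i xb) : S.Good i v := by
  have hcl := h.closed.pred
  have hne : ∀ {p q : Fin n}, p ∉ S.cluster i q → S.cluster i p ≠ S.cluster i q :=
    fun h1 h2 => h1 (h2 ▸ self_mem_cluster _ _ _)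
  rcases h.free o ho hoa hob with ⟨u, hu, w, hb⟩ | h1
  · rcases h.free v hv hva hvb with h2 | ⟨h2, -⟩
    · exact h2
    have hwc : w ∈ c := h.closed.edge (hcl o ho hu) hb.1
    have huo := cluster_eq_of_mem hu
    have hb2 := hb.2.2
    rw [size_congr huo] at hb2
    by_cases hwv : S.cluster i w = S.cluster i v
    · exact hb.good_right.congr (cluster_eq_iff.1 hwv)
    exfalso
    have hab := h.add_le
    have how : S.cluster i o ≠ S.cluster i w := by rw [← huo]; exact hb.2.1
    have hwa : S.cluster i w ≠ S.cluster i xa := by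
      intro heq; rw [size_congr heq] at hb2; omega
    have hwb : S.cluster i w ≠ S.cluster i xb := by
      intro heq; rw [size_congr heq] at hb2; omega
    have hov : S.cluster i o ≠ S.cluster i v := by
      intro heq; rw [← size_congr heq] at h2; omega
    -- The blocked edge makes `o` and `w` exceed `2^i`, and `v` with the two halves exceeds `2^i` by
    -- `h2`. These five disjoint clusters do not fit into `c`.
    have := sum_size_le (S := S) (j := i) (L := [o, w, v, xa, xb]) (D := c)
      (by simp [hcl o ho, hcl w hwc, hcl v hv, hcl xa h.mem_left, hcl xb h.mem_right])
      (by simp [how, hov, hne hoa, hne hob, hwv, hwa, hwb, hne hva, hne hvb, h.ne])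
    simp at this
    have := h.card_le
    omega
  · omega

/-! ### The state after merging -/

/-- Every edge at the cluster of `z` leads to a vertex of `M`. -/
def Exhausted (S : LeveledGraph n) (i : ℕ) (z : Fin n) (M : Set (Fin n)) : Prop :=
  ∀ u ∈ S.cluster i z, ∀ w, S.IsEdge (i + 1) u w → w ∈ M

/-- No two marked clusters of `S` have been merged in `S'`, and the cluster of `z` has not grown
if all its edges lead to marked clusters. -/
def Separated (S : LeveledGraph n) (i : ℕ) (z : Fin n) (M : Set (Fin n))
    (S' : LeveledGraph n) : Prop :=
  (∀ u ∈ M, ∀ w ∈ M, S'.cluster i u = S'.cluster i w → S.cluster i u = S.cluster i w) ∧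
    (S.Exhausted i z M → S'.cluster i z = S.cluster i z)

/-- One end of the push lies in an unmarked cluster, so at most one marked cluster takes part in the
merge. If all edges at `z` lead into `M`, no edge joins its cluster to an unmarked one. -/
theorem Separated.push {z : Fin n} (h : Separated S i z M S') (hz : z ∈ M) (hR : Reach i c S S')
    (ho : Disjoint (S'.cluster i o) M) (hx : x ∈ S'.cluster i o) (hp : FullPush S' S'' i x y) :
    Separated S i z M S'' := by
  have hxo := cluster_eq_of_mem hx
  have hnx : ∀ u ∈ M, u ∉ S'.cluster i x := fun u hu h1 =>
    Set.disjoint_left.1 ho (hxo ▸ h1) hu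
  refine ⟨fun u hu w hw heq => h.1 u hu w hw ?_, fun hE => ?_⟩
  · have hwu := cluster_eq_iff.1 heq
    by_cases huy : u ∈ S'.cluster i y
    · rw [hp.cluster_of_mem (Or.inr huy)] at hwu
      rw [cluster_eq_of_mem huy, cluster_eq_of_mem (hwu.resolve_left (hnx w hw))]
    · rw [hp.cluster_of_not_mem (by rintro (h1 | h1); exacts [hnx u hu h1, huy h1])] at hwu
      exact cluster_eq_iff.2 hwu
  · rw [hp.cluster_of_not_mem, h.2 hE]
    rintro (h1 | h1)
    · exact hnx z hz h1
    · rw [mem_cluster_comm, h.2 hE] at h1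
      exact Set.disjoint_left.1 ho hx (hE y h1 x (hR.isEdge_of hp.edge).symm)

theorem IsEdge.good (he : S.IsEdge (i + 1) u w) (hu : u ∈ S.cluster i v) (hw : w ∈ S.cluster i x)
    (hne : S.cluster i v ≠ S.cluster i x) (hs : 2 ^ i < S.size i v + S.size i x) :
    S.Good i v := by
  have h1 := cluster_eq_of_mem hu
  have h2 := cluster_eq_of_mem hw
  exact ⟨u, hu, w, he, by rw [h1, h2]; exact hne, by rw [size_congr h1, size_congr h2]; exact hs⟩

/-- The situation when merging stops at the cluster of `o`. -/
theorem Halves.merge_event (h : Halves S i c xa xb)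
    (hH : ∀ v ∈ c, v ∉ S.cluster i xa → v ∉ S.cluster i xb →
      2 ^ i < S.size i v + S.size i xa + S.size i xb)
    (hxa : xa ∈ M) (hxb : xb ∈ M) (hR : Reach i c S S') (hsep : Separated S i xb M S')
    (hscan_end : S.Exhausted i xb M ∨ ∃ g ∈ S.cluster i xb, ∃ g', S.IsBlocked i g g')
    (ho : o ∈ c) (hod : Disjoint (S'.cluster i o) M)
    (hmin : ∀ w ∈ c, Disjoint (S'.cluster i w) M → S'.size i o ≤ S'.size i w)
    (hev : (∀ u ∈ S'.cluster i o, ∀ w, ¬ S'.IsEdge (i + 1) u w) ∨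
      ∃ x ∈ S'.cluster i o, ∃ y, S'.IsBlocked i x y) :
    (∀ v ∈ c, Disjoint (S'.cluster i v) M → S'.Good i v) ∧
    ∀ v ∈ c, ∀ v' ∈ c, Disjoint (S'.cluster i v) M → Disjoint (S'.cluster i v') M →
      S'.cluster i o ≠ S'.cluster i v → S'.cluster i o ≠ S'.cluster i v' →
      S'.cluster i v ≠ S'.cluster i v' →
      S.Exhausted i xb M ∧ 2 ^ i < S'.size i o + S'.size i xa := by
  have hc' := h.closed.reach hR
  have hcl := hc'.pred
  have hab : S'.cluster i xa ≠ S'.cluster i xb := fun heq => h.ne (hsep.1 xa hxa xb hxb heq)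
  have hca := hcl xa h.mem_left
  have hcb := hcl xb h.mem_right
  have hcard := h.card_le
  have hne : ∀ v, Disjoint (S'.cluster i v) M → ∀ z ∈ M, S'.cluster i v ≠ S'.cluster i z :=
    fun v hv z hz heq => Set.disjoint_left.1 hv (heq ▸ self_mem_cluster _ _ _) hz
  have hfree : ∀ v, Disjoint (S'.cluster i v) M → ∀ z ∈ M, v ∉ S.cluster i z :=
    fun v hv z hz h1 => hne v hv z hz (cluster_eq_of_mem (hR.cluster_subset z h1))
  have hheavy : ∀ v ∈ c, Disjoint (S'.cluster i v) M →
      2 ^ i < S'.size i v + S'.size i xa + S'.size i xb := by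
    intro v hv hd
    have := hH v hv (hfree v hd xa hxa) (hfree v hd xb hxb)
    have := hR.size_le v
    have := hR.size_le xa
    have := hR.size_le xb
    omega
  have hatt : ∀ v ∈ c, Disjoint (S'.cluster i v) M → S'.Good i v ∨
      ∃ u ∈ S'.cluster i v, ∃ w, (w ∈ S'.cluster i xa ∨ w ∈ S'.cluster i xb) ∧
        S'.IsEdge (i + 1) u w := by
    intro v hv hd
    rcases h.free v hv (hfree v hd xa hxa) (hfree v hd xb hxb) with h1 | ⟨-, u, hu, w, hw, he⟩
    · exact Or.inl (h1.reach hR)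
    · right
      have hu' := hR.cluster_subset v hu
      have hw' : w ∈ S'.cluster i xa ∨ w ∈ S'.cluster i xb :=
        hw.imp (fun h => hR.cluster_subset xa h) (fun h => hR.cluster_subset xb h)
      refine ⟨u, hu', w, hw', hR.isEdge he fun h1 => ?_⟩
      rw [cluster_eq_of_mem hu', ← cluster_eq_iff] at h1
      rcases hw' with h2 | h2
      · exact hne v hd xa hxa (h1.trans (cluster_eq_of_mem h2))
      · exact hne v hd xb hxb (h1.trans (cluster_eq_of_mem h2))
  obtain ⟨x, hx, y, hbl⟩ : ∃ x ∈ S'.cluster i o, ∃ y, S'.IsBlocked i x y := by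
    rcases hev with h1 | h1
    · exfalso
      rcases hatt o ho hod with ⟨u, hu, w, hb⟩ | ⟨u, hu, w, -, he⟩
      · exact h1 u hu w hb.1
      · exact h1 u hu w he
    · exact h1
  have hxo := cluster_eq_of_mem hx
  have hyc : y ∈ c := hc'.edge (hcl o ho hx) hbl.1
  have hoy : S'.cluster i o ≠ S'.cluster i y := by rw [← hxo]; exact hbl.2.1
  have hs := hbl.2.2
  rw [size_congr hxo] at hs
  -- no three further clusters beside the two halves and a pair with a blocked edge
  have hother : S'.cluster i y ≠ S'.cluster i xa → S'.cluster i y ≠ S'.cluster i xb →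
      ∀ v ∈ c, Disjoint (S'.cluster i v) M → S'.cluster i o ≠ S'.cluster i v →
        S'.cluster i y = S'.cluster i v := by
    intro h1 h2 v hv hd h3
    by_contra h4
    have := sum_size_le (S := S') (j := i) (L := [o, y, v, xa, xb]) (D := c)
      (by simp [hcl o ho, hcl y hyc, hcl v hv, hca, hcb])
      (by simp [hoy, h3, hne o hod xa hxa, hne o hod xb hxb, h4, h1, h2, hne v hd xa hxa,
        hne v hd xb hxb, hab])
    simp at this
    have := hheavy v hv hd
    omega
  have hfour : ∀ v ∈ c, S'.cluster i o ≠ S'.cluster i v → S'.cluster i v ≠ S'.cluster i xa →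
      S'.cluster i v ≠ S'.cluster i xb →
      S'.size i o + S'.size i v + S'.size i xa + S'.size i xb ≤ 2 * 2 ^ i := by
    intro v hv h1 h2 h3
    have := sum_size_le (S := S') (j := i) (L := [o, v, xa, xb]) (D := c)
      (by simp [hcl o ho, hcl v hv, hca, hcb])
      (by simp [h1, hne o hod xa hxa, hne o hod xb hxb, h2, h3, hab])
    simp at this
    omega
  -- The scan was stopped by a blocked edge from the smaller half `B` to some `g`. As `n(g) + n(B) >
  -- 2^i ≥ n(A) + n(B)`, the cluster `g` is neither half, and it is too large for `A` as well
  -- because `n(A) ≥ n(B)`. All of this survives merging.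
  have hg : ¬ S.Exhausted i xb M → ∃ g ∈ c, S'.cluster i g ≠ S'.cluster i xa ∧
      S'.cluster i g ≠ S'.cluster i xb ∧ 2 ^ i < S'.size i g + S'.size i xa ∧
      2 ^ i < S'.size i g + S'.size i xb := by
    intro hE
    obtain ⟨g, hgb, g', hb⟩ := hscan_end.resolve_left hE
    have hgb' := cluster_eq_of_mem hgb
    have h1 := hb.2.1
    have h2 := hb.2.2
    rw [hgb'] at h1
    rw [size_congr hgb'] at h2
    have hle := h.size_le
    have hadd := h.add_le
    have h3 : S.cluster i g' ≠ S.cluster i xa := by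
      intro heq; rw [size_congr heq] at h2; omega
    have h4 := hR.ne_of_lt h3 (by omega)
    have h5 := hR.ne_of_lt h1.symm (by omega)
    have := hR.size_le g'
    have := hR.size_le xa
    have := hR.size_le xb
    exact ⟨g', h.closed.edge (h.closed.pred xb h.mem_right hgb) hb.1, h4, h5, by omega, by omega⟩
  have hEb : S.Exhausted i xb M → ∀ v, Disjoint (S'.cluster i v) M → ∀ u ∈ S'.cluster i v,
      ∀ w ∈ S'.cluster i xb, ¬ S'.IsEdge (i + 1) u w := by
    intro hE v hd u hu w hw he
    rw [hsep.2 hE] at hw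
    exact Set.disjoint_left.1 hd hu (hE w hw u (hR.isEdge_of he).symm)
  -- If `o` is blocked towards `A`, minimality of `o` makes every unmarked child too large for `A`,
  -- so an edge to `A` is blocked. An edge from an unmarked child to `B` provides `g`: if `g` is
  -- `o`, the same argument works for `B`; if not, then `o` with `A` and `g` with `B` overfill `c`.
  by_cases hya : S'.cluster i y = S'.cluster i xa
  · rw [size_congr hya] at hs
    refine ⟨fun v hv hd => ?_, fun v hv v' hv' hd hd' h1 h2 h3 => ⟨?_, hs⟩⟩
    · by_cases hov : S'.cluster i o = S'.cluster i v
      · exact hbl.good_left.congr (by rw [hxo, hov]; exact self_mem_cluster _ _ _)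
      have hmv := hmin v hv hd
      rcases hatt v hv hd with h1 | ⟨u, hu, w, hw | hw, he⟩
      · exact h1
      · exact he.good hu hw (hne v hd xa hxa) (by omega)
      · obtain ⟨g, hgc, hga, hgb, h4, h5⟩ := hg fun hE => hEb hE v hd u hu w hw he
        by_cases hog : S'.cluster i o = S'.cluster i g
        · rw [← size_congr hog] at h5
          exact he.good hu hw (hne v hd xb hxb) (by omega)
        · have := hfour g hgc hog hga hgb
          omega
    · by_contra hE
      obtain ⟨g, hgc, hga, hgb, h4, h5⟩ := hg hE
      have hmv := hmin v hv hd
      by_cases hog : S'.cluster i o = S'.cluster i g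
      · rw [← size_congr hog] at h5
        have := hfour v hv h1 (hne v hd xa hxa) (hne v hd xb hxb)
        omega
      · have := hfour g hgc hog hga hgb
        omega
  -- If `o` is blocked towards `B`, then `B` is not exhausted and `g` exists. It must be `o`, since
  -- otherwise `o` with `B` and `g` with `A` overfill `c`. So `o`, and by minimality each unmarked
  -- child, is too large for either half, and there is no room for a second unmarked child.
  by_cases hyb : S'.cluster i y = S'.cluster i xb
  · rw [size_congr hyb] at hs
    obtain ⟨g, hgc, hga, hgb, h4, h5⟩ := hg fun hE =>
      hEb hE o hod x hx y (cluster_eq_iff.1 hyb.symm) hbl.1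
    by_cases hog : S'.cluster i o = S'.cluster i g
    · rw [← size_congr hog] at h4
      refine ⟨fun v hv hd => ?_, fun v hv v' hv' hd hd' h1 h2 h3 => ?_⟩
      · have hmv := hmin v hv hd
        rcases hatt v hv hd with h1 | ⟨u, hu, w, hw | hw, he⟩
        · exact h1
        · exact he.good hu hw (hne v hd xa hxa) (by omega)
        · exact he.good hu hw (hne v hd xb hxb) (by omega)
      · have := hfour v hv h1 (hne v hd xa hxa) (hne v hd xb hxb)
        have hmv := hmin v hv hd
        omega
    · have := hfour g hgc hog hga hgb
      omega
  refine ⟨fun v hv hd => ?_, fun v hv v' hv' hd hd' h1 h2 h3 => ?_⟩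
  · by_cases hov : S'.cluster i o = S'.cluster i v
    · exact hbl.good_left.congr (by rw [hxo, hov]; exact self_mem_cluster _ _ _)
    · exact hbl.good_right.congr (cluster_eq_iff.1 (hother hya hyb v hv hd hov))
  · exact absurd ((hother hya hyb v hv hd h1).symm.trans (hother hya hyb v' hv' hd' h2)) h3

end LeveledGraph

section Passes

open LeveledGraph

variable {n : ℕ} {Λ : Layout n} {i : ℕ} {c M : Set (Fin n)} {S S' : LeveledGraph n}
variable {σ σ' : Config n} {N : ℕ} {Q : Config n → ℕ → Prop} {mem : ℕ → ℕ} {xa xb : Fin n}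

/-! ### Counting pushes during merging -/

/-- Each grown cluster has a lowered edge starting in it. The stored clusters are disjoint, so these
oriented edges are distinct. -/
theorem Stored.card_grown_le {m : ℕ} {o : ℕ → Fin n} (h : Stored S M i c mem m o)
    (hR : Reach i c S S') [DecidablePred fun q => S'.cluster i (o q) ≠ S.cluster i (o q)] :
    ((Finset.range m).filter fun q => S'.cluster i (o q) ≠ S.cluster i (o q)).card ≤
      2 * pushCount S S' := by
  have hex : ∀ q, ∃ p : Fin n × Fin n, S'.cluster i (o q) ≠ S.cluster i (o q) →
      p.1 ∈ S.cluster i (o q) ∧ S'.level s(p.1, p.2) ≠ S.level s(p.1, p.2) := by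
    intro q
    by_cases hq : S'.cluster i (o q) ≠ S.cluster i (o q)
    · obtain ⟨a, ha, b, hb⟩ := hR.exists_lowered hq
      exact ⟨(a, b), fun _ => ⟨ha, hb⟩⟩
    · exact ⟨(o q, o q), fun h1 => absurd h1 hq⟩
  choose f hf using hex
  refine hR.card_le _ f ?_ fun q hq => (hf q (Finset.mem_filter.1 hq).2).2
  intro q hq q' hq' heq
  have hq := Finset.mem_filter.1 (Finset.mem_coe.1 hq)
  have hq' := Finset.mem_filter.1 (Finset.mem_coe.1 hq')
  have h1 := (hf q hq.2).1
  have h2 := (hf q' hq'.2).1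
  rw [heq] at h1
  have h3 := (cluster_eq_of_mem h1).symm.trans (cluster_eq_of_mem h2)
  rcases lt_trichotomy q q' with h4 | h4 | h4
  · exact absurd h3.symm (h.ne q' (Finset.mem_range.1 hq'.1) q h4)
  · exact h4
  · exact absurd h3 (h.ne q (Finset.mem_range.1 hq.1) q' h4)

/-- When merging stops, most of the stored clusters have grown, unless the marked vertices outside
of the larger half fit into one cluster. -/
theorem LeveledGraph.Halves.merge_count (h : Halves S i c xa xb)
    (hH : ∀ v ∈ c, v ∉ S.cluster i xa → v ∉ S.cluster i xb →
      2 ^ i < S.size i v + S.size i xa + S.size i xb)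
    (hxa : xa ∈ M) (hxb : xb ∈ M) (hR : Reach i c S S') (hsep : Separated S i xb M S')
    (hscan_end : S.Exhausted i xb M ∨ ∃ g ∈ S.cluster i xb, ∃ g', S.IsBlocked i g g')
    (hend : MergeEnd S' M i c) {m : ℕ} {o : ℕ → Fin n} (hst : Stored S M i c mem m o) :
    m ≤ 2 * pushCount S S' + 2 ∨ ∃ D, S'.Closed i D ∧ D.ncard ≤ 2 ^ i ∧
      ∀ v ∈ c, v ∈ M → v ∉ S.cluster i xa → v ∈ D := by
  classical
  have hgrown := hst.card_grown_le hR
  have hsplit := Finset.card_filter_add_card_filter_not (s := Finset.range m)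
    (fun q => S'.cluster i (o q) ≠ S.cluster i (o q))
  rw [Finset.card_range] at hsplit
  set V := (Finset.range m).filter fun q => ¬ S'.cluster i (o q) ≠ S.cluster i (o q) with hV
  -- All stored clusters outside of `V` have grown and are counted by pushes. If `V` has three
  -- elements, at least two of them differ from the child where merging stopped, as `merge_event`
  -- requires.
  by_cases hV2 : V.card ≤ 2
  · left; omega
  right
  have hVm : ∀ q ∈ V, q < m ∧ S'.cluster i (o q) = S.cluster i (o q) := by
    intro q hq
    have := Finset.mem_filter.1 hq
    exact ⟨Finset.mem_range.1 this.1, not_not.1 this.2⟩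
  have hVd : ∀ q ∈ V, Disjoint (S'.cluster i (o q)) M := fun q hq => by
    rw [(hVm q hq).2]; exact hst.disj q (hVm q hq).1
  have hVinj : ∀ q ∈ V, ∀ q' ∈ V, S'.cluster i (o q) = S'.cluster i (o q') → q = q' := by
    intro q hq q' hq' heq
    rw [(hVm q hq).2, (hVm q' hq').2] at heq
    rcases lt_trichotomy q q' with h4 | h4 | h4
    · exact absurd heq.symm (hst.ne q' (hVm q' hq').1 q h4)
    · exact h4
    · exact absurd heq (hst.ne q (hVm q hq).1 q' h4)
  rcases hend with hend | ⟨p, hpc, hpd, hmin, hev⟩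
  · obtain ⟨q, hq⟩ : V.Nonempty := Finset.card_pos.1 (by omega)
    exact absurd (hVd q hq) (hend (o q) (hst.mem_c q (hVm q hq).1))
  have hone : (V.filter fun q => S'.cluster i p = S'.cluster i (o q)).card ≤ 1 := by
    refine Finset.card_le_one.2 fun q hq q' hq' => ?_
    have hq := Finset.mem_filter.1 hq
    have hq' := Finset.mem_filter.1 hq'
    exact hVinj q hq.1 q' hq'.1 (hq.2.symm.trans hq'.2)
  have hsplit' := Finset.card_filter_add_card_filter_not (s := V)
    (fun q => S'.cluster i p = S'.cluster i (o q))
  obtain ⟨q, hq, q', hq', hne⟩ := Finset.one_lt_card.1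
    (show 1 < (V.filter fun q => ¬ S'.cluster i p = S'.cluster i (o q)).card by omega)
  have hq := Finset.mem_filter.1 hq
  have hq' := Finset.mem_filter.1 hq'
  obtain ⟨-, hs⟩ := (h.merge_event hH hxa hxb hR hsep hscan_end hpc hpd hmin hev).2
    (o q) (hst.mem_c q (hVm q hq.1).1) (o q') (hst.mem_c q' (hVm q' hq'.1).1) (hVd q hq.1)
    (hVd q' hq'.1) hq.2 hq'.2 fun heq => hne (hVinj q hq.1 q' hq'.1 heq)
  have hcl := (h.closed.reach hR).pred
  have hpa : S'.cluster i p ≠ S'.cluster i xa := fun heq =>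
    Set.disjoint_left.1 hpd (heq ▸ self_mem_cluster _ _ _) hxa
  -- The two removed clusters exceed `2^i` together, which leaves less than `2^i` vertices of `c`.
  -- The first one is unmarked and the second one contains no marked vertex outside of the original
  -- `A`, by `Separated`.
  refine ⟨c \ (S'.cluster i p ∪ S'.cluster i xa),
    hcl.diff ((closed_cluster _ _ _).union (closed_cluster _ _ _)), ?_, ?_⟩
  · have h1 := size_eq_add (S := S') hpa rfl
    have h2 := Set.ncard_sdiff_add_ncard_of_subset
      (Set.union_subset (hcl p hpc) (hcl xa h.mem_left))
    have := h.card_le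
    omega
  · intro v hv hvM hva
    refine ⟨hv, ?_⟩
    rintro (h1 | h1)
    · exact Set.disjoint_left.1 hpd h1 hvM
    · exact hva (cluster_eq_iff.1 (hsep.1 xa hxa v hvM (cluster_eq_iff.2 h1)))

/-! ### Pushing all recorded edges -/

/-- Push the recorded edges of the bin in register 11, push the other recorded edges, and settle
the stored clusters. -/
def passesProgram : Program :=
  forProgram 10 recordBinProgram ;; forProgram 10 recordProgram ;; forProgram 16 settleStoredProgram

/-- The bin `J` comes first, while a closed set `D` with at most `2^i` vertices around its edges is
still intact: pushes inside `D` keep it closed, and two distinct clusters in `D` are never too large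
to merge, so no push fails. The results of each pass are preserved by the later ones. -/
theorem Runs.passes {e : ℕ → Fin n × Fin n} {o : ℕ → Fin n} {k m J : ℕ} (hb : Base i σ)
    (hc : σ.forest.Closed (i + 1) c) (hS : σ.forest.SizeInvariant) (hk : k ≤ n * n) (hmk : m ≤ k)
    (h10 : σ.reg 10 = 8 * k) (h11 : σ.reg 11 = J) (h16 : σ.reg 16 = 8 * m)
    (hfst : ∀ l < k, σ.mem (8 * l + 2) = (e l).1) (hsnd : ∀ l < k, σ.mem (8 * l + 3) = (e l).2)
    (hadj : ∀ l < k, σ.forest.graph.Adj (e l).1 (e l).2)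
    (hlev : ∀ l < k, σ.forest.level s((e l).1, (e l).2) ≤ i + 1)
    (hmem : ∀ l < k, (e l).1 ∈ c ∧ (e l).2 ∈ c) (hbin : ∀ l < k, σ.mem (8 * l + 4) ≤ 16 * n)
    (hJ : J ≤ 16 * n) (ho : ∀ l < m, σ.mem (8 * l + 5) = o l) (hoc : ∀ l < m, o l ∈ c)
    (h : ∀ σ' N', N' ≤ N + 150 * pushCount σ.forest σ'.forest + 480 * k + 30 → Frame 50 σ σ' →
      Reach i c σ.forest σ'.forest →
      (∀ D, σ.forest.Closed i D → D.ncard ≤ 2 ^ i →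
        (∀ l < k, σ.mem (8 * l + 4) = J → (e l).1 ∈ D ∧ (e l).2 ∈ D) →
        ∀ l < k, σ.mem (8 * l + 4) = J → σ'.forest.level s((e l).1, (e l).2) ≤ i) →
      (∀ l < k, σ'.forest.level s((e l).1, (e l).2) ≤ i ∨
        σ'.forest.IsBlocked i (e l).1 (e l).2) →
      (∀ l < m, σ'.forest.Settled i (o l)) → Q σ' N') :
    Runs Λ i c passesProgram σ N Q := by
  have hw : 8 * k + 8 < (n + 2) ^ 8 := lt_word (by nlinarith)
  unfold passesProgram
  refine Runs.seq (Runs.for (T := k) (by omega) hb h10 (by omega) hS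
    (fun r S => ∀ D, σ.forest.Closed i D → D.ncard ≤ 2 ^ i →
      (∀ l < k, σ.mem (8 * l + 4) = J → (e l).1 ∈ D ∧ (e l).2 ∈ D) →
      S.Closed i D ∧ ∀ l < r, σ.mem (8 * l + 4) = J → S.level s((e l).1, (e l).2) ≤ i)
    ?_ ?_ ?_)
  · exact fun D h1 _ _ => ⟨h1, by simp⟩
  · intro r hr σ₁ N₁ hF h40 hR hP
    have h11₁ : σ₁.reg 11 = J := (hF.reg 11 (by omega)).trans h11
    refine Runs.recordBin (r := r) (p := σ.mem (8 * r + 4)) (q := J) h40 (by omega)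
      (by rw [hF.mem]) (hbin r hr) h11₁ hJ ?_ ?_
    · intro hne σ₂ hF₂ hf₂
      refine ⟨hF.trans (hF₂.weaken (by omega)), (hF₂.reg 40 (by omega)).trans h40,
        by rw [hf₂]; exact Reach.refl hR.sizeInvariant, ?_, by omega⟩
      rw [hf₂]
      intro D h1 h2 h3
      refine ⟨(hP D h1 h2 h3).1, fun l hl hlJ => ?_⟩
      rcases Nat.lt_or_ge l r with h4 | h4
      · exact (hP D h1 h2 h3).2 l h4 hlJ
      · have : l = r := by omega
        subst this; exact absurd hlJ hne
    · intro heq σ₂ hF₂ hf₂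
      have hF₂' := hF.trans (hF₂.weaken (by omega : 40 ≤ 50))
      refine Runs.record (r := r) (a := (e r).1) (b := (e r).2) (hF₂'.base hb)
        ((hF₂.reg 40 (by omega)).trans h40) (by omega) (by rw [hF₂'.mem]; exact hfst r hr)
        (by rw [hF₂'.mem]; exact hsnd r hr) (by rw [hf₂, hR.graph_eq]; exact hadj r hr)
        (by rw [hf₂]; exact (hR.level_le _).trans (hlev r hr)) (hmem r hr).1 (hmem r hr).2
        (by rw [hf₂]; exact hR.sizeInvariant) ?_
      rw [hf₂]
      intro σ₃ N₃ hN₃ hF₃ hR₃ hpush hres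
      refine ⟨hF₂'.trans (hF₃.weaken (by omega)),
        (hF₃.reg 40 (by omega)).trans ((hF₂.reg 40 (by omega)).trans h40), hR₃, ?_, by omega⟩
      intro D h1 h2 h3
      obtain ⟨h4, h5⟩ := hP D h1 h2 h3
      obtain ⟨h6, h7⟩ := h3 r hr heq
      have hcl : σ₃.forest.Closed i D := by
        rcases hpush with h8 | h8
        · rw [h8]; exact h4
        · exact h8.closed h4 (by simp [h6, h7])
      refine ⟨hcl, fun l hl hlJ => ?_⟩
      rcases Nat.lt_or_ge l r with h8 | h8
      · exact (hR₃.level_le _).trans (h5 l h8 hlJ)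
      · have : l = r := by omega
        subst this
        refine hres.resolve_right fun hbl => ?_
        have := size_add_size_le hbl.2.1 (hcl _ h6) (hcl _ h7)
        have := hbl.2.2
        omega
  intro σ₁ N₁ hF₁ hR₁ hP₁ hN₁
  have hb₁ := hF₁.base hb
  refine Runs.seq (Runs.for (T := k) (by omega) hb₁ ((hF₁.reg 10 (by omega)).trans h10) (by omega)
    hR₁.sizeInvariant
    (fun r S => ∀ l < r, S.level s((e l).1, (e l).2) ≤ i ∨ S.IsBlocked i (e l).1 (e l).2)
    (by simp) ?_ ?_)
  · intro r hr σ₂ N₂ hF₂ h40 hR₂ hP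
    have hF₂' := hF₁.trans hF₂
    have hR₂' := hR₁.trans hR₂
    refine Runs.record (r := r) (a := (e r).1) (b := (e r).2) (hF₂'.base hb)
      h40 (by omega) (by rw [hF₂'.mem]; exact hfst r hr)
      (by rw [hF₂'.mem]; exact hsnd r hr) (by rw [hR₂'.graph_eq]; exact hadj r hr)
      ((hR₂'.level_le _).trans (hlev r hr)) (hmem r hr).1 (hmem r hr).2 hR₂'.sizeInvariant ?_
    intro σ₃ N₃ hN₃ hF₃ hR₃ _ hres
    refine ⟨hF₂.trans (hF₃.weaken (by omega)), (hF₃.reg 40 (by omega)).trans h40, hR₃, ?_,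
      by omega⟩
    intro l hl
    rcases Nat.lt_or_ge l r with h8 | h8
    · exact (hP l h8).imp (fun h => (hR₃.level_le _).trans h) (fun h => hR₃.isBlocked h)
    · have : l = r := by omega
      subst this; exact hres
  intro σ₂ N₂ hF₂ hR₂ hP₂ hN₂
  have hF₂' := hF₁.trans hF₂
  have hR₂' := hR₁.trans hR₂
  refine Runs.for (T := m) (by omega) (hF₂'.base hb) ((hF₂'.reg 16 (by omega)).trans h16)
    (by omega) hR₂.sizeInvariant (fun r S => ∀ l < r, S.Settled i (o l)) (by simp) ?_ ?_
  · intro r hr σ₃ N₃ hF₃ h40 hR₃ hP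
    have hF₃' := hF₂'.trans hF₃
    have hb₃ := hF₃'.base hb
    unfold settleStoredProgram
    refine Runs.seq (Runs.const (lt_word_of_le (by omega)) ?_)
    refine Runs.seq (Runs.add (8 * r + 5) (by simp [h40]) (by omega) ?_)
    refine Runs.seq (Runs.load (o r) (by simp [hF₃'.mem, ho r hr]) (fin_lt_word _) ?_)
    refine Runs.settle (v := o r) ⟨by simp [hb₃.level], by simp [hb₃.one], by simp [hb₃.zero]⟩
      (by simp) (hoc r hr) (hc.reach (hR₂'.trans hR₃)) (hR₂'.trans hR₃).sizeInvariant ?_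
    intro σ₄ N₄ hN₄ hF₄ hR₄ hset
    simp only [Config.put_forest] at hN₄ hR₄
    have hF₄' : Frame 50 σ₃ σ₄ := by
      refine Frame.trans ?_ (hF₄.weaken (by omega))
      simp [Frame.put_iff, Frame.refl]
    have h40₄ : σ₄.reg 40 = 8 * r := by
      rw [hF₄.reg 40 (by omega)]; simp [h40]
    refine ⟨hF₃.trans hF₄', h40₄, hR₄, ?_, by omega⟩
    intro l hl
    rcases Nat.lt_or_ge l r with h8 | h8
    · exact (hP l h8).reach hR₄
    · have : l = r := by omega
      subst this; exact hset
  · intro σ₃ N₃ hF₃ hR₃ hP₃ hN₃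
    have h1 := hR₁.pushCount_add hR₂
    have h2 := hR₂'.pushCount_add hR₃
    refine h σ₃ N₃ (by omega) (hF₂'.trans hF₃) (hR₂'.trans hR₃) ?_ ?_ hP₃
    · intro D h4 h5 h6 l hl hlJ
      exact ((hR₂.trans hR₃).level_le _).trans ((hP₁ D h4 h5 h6).2 l hl hlJ)
    · intro l hl
      exact (hP₂ l hl).imp (fun h => (hR₃.level_le _).trans h) (fun h => hR₃.isBlocked h)

end Passes

section Heavy

open LeveledGraph

variable {n : ℕ} {Λ : Layout n} {i : ℕ} {c M : Set (Fin n)} {S S' : LeveledGraph n}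
variable {σ σ' : Config n} {N : ℕ} {Q : Config n → ℕ → Prop} {mem : ℕ → ℕ} {xa xb : Fin n}

/-! ### Heavy children -/

/-- The scanned clusters lie in `c` and the smaller half has at most `2^i / 2` vertices, so there
are at most six bins and the pigeonhole principle applies. -/
theorem Scan.bound {k r ℓ J q : ℕ} (hs : Scan Λ S i xb mem k r ℓ J q)
    (h : Halves S i c xa xb) : k ≤ 6 * q := by
  have hW : S.cluster i xb ∪ scanned Λ S i xb k ⊆ c := by
    have hb := h.closed.pred xb h.mem_right
    rintro v (hv | ⟨l, hl, hv⟩)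
    · exact hb hv
    · obtain ⟨h1, h2⟩ := scanEdge_spec (hl.trans_le hs.le_length)
      exact h.closed.pred _ (h.closed.edge (hb h1) h2) hv
  have hr : r ≤ 6 := by
    refine hs.table.bin_le_six ((Set.ncard_le_ncard hW).trans h.card_le) ?_
    have := h.size_le
    have := h.add_le
    omega
  refine hs.records.card_le fun l hl => ?_
  rw [hs.bin_eq l hl]
  have h1 := hs.table.bin_le (scanEdge Λ S i xb l).2
  have h2 := (hs.table.ne_zero (scanEdge Λ S i xb l).2).2
    (Or.inr ⟨l, hl, self_mem_cluster _ _ _⟩)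
  omega

/-- Once all edges of the largest bin have been lowered, their number is bounded by the number of
pushes. -/
theorem Scan.count_le {k r ℓ J q : ℕ} (hs : Scan Λ S i xb mem k r ℓ J q)
    (h : Halves S i c xa xb) (hR : Reach i c S S')
    (hlow : ∀ l < k, mem (8 * l + 4) = J →
      S'.level s((scanEdge Λ S i xb l).1, (scanEdge Λ S i xb l).2) ≤ i) :
    k ≤ 12 * pushCount S S' := by
  have h1 := hs.bound h
  have h2 : q ≤ 2 * pushCount S S' := by
    rw [← hs.records.best, hs.records.count]
    refine hR.card_le _ (scanEdge Λ S i xb) ?_ ?_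
    · intro l hl l' hl' heq
      have hl := Finset.mem_range.1 (Finset.mem_filter.1 (Finset.mem_coe.1 hl)).1
      have hl' := Finset.mem_range.1 (Finset.mem_filter.1 (Finset.mem_coe.1 hl')).1
      exact scanEdge_injOn (hl.trans_le hs.le_length) (hl'.trans_le hs.le_length) heq
    · intro l hl
      obtain ⟨h3, h4⟩ := Finset.mem_filter.1 hl
      have h3 := Finset.mem_range.1 h3
      have h5 := hlow l h3 h4
      have h6 := (scanEdge_spec (h3.trans_le hs.le_length)).2.2
      omega
  omega

/-- If the two halves have been merged again, then every other child is adjacent to their cluster by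
a blocked edge, as far as it does not have another one. -/
theorem LeveledGraph.Halves.good_of_merged (h : Halves S i c xa xb) (hR : Reach i c S S')
    (hm : S'.cluster i xa = S'.cluster i xb) {v : Fin n} (hv : v ∈ c) :
    S'.Settled i v ∨ v ∈ S'.cluster i xa := by
  by_cases hva : v ∈ S.cluster i xa
  · exact Or.inr (hR.cluster_subset xa hva)
  by_cases hvb : v ∈ S.cluster i xb
  · exact Or.inr (hm ▸ hR.cluster_subset xb hvb)
  by_cases hv' : v ∈ S'.cluster i xa
  · exact Or.inr hv'
  left
  rcases h.free v hv hva hvb with h1 | ⟨h1, u, hu, w, hw, he⟩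
  · exact Or.inl (h1.reach hR)
  · have hw' : w ∈ S'.cluster i xa := by
      rcases hw with hw | hw
      · exact hR.cluster_subset xa hw
      · exact hm ▸ hR.cluster_subset xb hw
    have hu' := hR.cluster_subset v hu
    have hne : S'.cluster i v ≠ S'.cluster i xa := fun heq => hv' (heq ▸ self_mem_cluster _ _ _)
    have hs : S.size i xa + S.size i xb ≤ S'.size i xa :=
      size_add_size_le h.ne (hR.cluster_subset xa) (hm ▸ hR.cluster_subset xb)
    have hsv := hR.size_le v
    refine Or.inl (IsEdge.good (hR.isEdge he fun h2 => ?_) hu' hw' hne (by omega))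
    rw [cluster_eq_of_mem hu', ← cluster_eq_iff, cluster_eq_of_mem hw'] at h2
    exact hne h2

/-- Work on a cluster graph in which no child can be merged with both halves. -/
def heavyProgram : Program :=
  scanProgram ;; .instr (.cluster 20 1 0) ;; .instr (.add 20 20 20) ;; .instr (.add 20 20 20) ;;
  .instr (.add 20 20 20) ;; .instr (.load 21 20) ;; .instr (.sub 13 21 11) ;;
  .instr (.sub 14 11 21) ;; .instr (.add 13 13 14) ;; .instr (.const 16 0) ;;
  .ite 13
    (countProgram ;; .instr (.sub 15 10 16) ;; .ite 15 .skip (unmarkProgram ;; mergeProgram))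
    .skip ;;
  passesProgram

/-- Every child is covered in one of three ways. A marked one is a half or the far end of a record,
which is merged with `B` or blocked after the passes. An unmarked one is stored and settled, or
settled by merging, or repaired by the reunion of the halves. Each way also bounds the number `k` of
records by pushes. -/
theorem Runs.heavy (hb : Base i σ) (hi : i + 1 ≤ maxLevel n) (hS : σ.forest = S)
    (h : Halves S i c xa xb)
    (hH : ∀ v ∈ c, v ∉ S.cluster i xa → v ∉ S.cluster i xb →
      2 ^ i < S.size i v + S.size i xa + S.size i xb)
    (h1 : σ.reg 1 = xa) (h2 : σ.reg 2 = xb) (h3 : σ.reg 3 = 2 ^ i) (h5 : σ.reg 5 = S.size i xb)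
    (h0 : ∀ p, σ.mem p = 0) (hM : σ.marks = S.cluster i xa ∪ S.cluster i xb)
    (hQ : ∀ σ' N', N' ≤ N + 10000 * (pushCount S σ'.forest + 1) → Base i σ' → σ'.reg 1 = xa →
      σ'.reg 2 = xb → Reach i c S σ'.forest →
      (∀ v ∈ c, σ'.forest.Settled i v ∨ v ∈ σ'.forest.cluster i xa ∨
        v ∈ σ'.forest.cluster i xb) → Q σ' N') :
    Runs Λ i c heavyProgram σ N Q := by
  have hlen : (Λ.edgeList S i xb).length ≤ n * n := edgeList_length_le
  have hbc := h.closed.pred xb h.mem_right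
  unfold heavyProgram
  refine Runs.seq (Runs.scan hb hi hS h2 h3 h5 h.sizeInvariant h0 ?_)
  intro σ₁ N₁ k r ℓ J q hN₁ hf₁ hm₁ hreg₁ h10₁ h11₁ hsc hscan_end
  have hb₁ : Base i σ₁ := ⟨(hreg₁ 0 (by omega) (by omega)).trans hb.level,
    (hreg₁ 18 (by omega) (by omega)).trans hb.one, (hreg₁ 19 (by omega) (by omega)).trans hb.zero⟩
  have h1₁ : σ₁.reg 1 = xa := (hreg₁ 1 (by omega) (by omega)).trans h1
  have h2₁ : σ₁.reg 2 = xb := (hreg₁ 2 (by omega) (by omega)).trans h2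
  have hk := hsc.le_length
  have hn : 1 ≤ n := by have := xa.2; omega
  have hw : 8 * k + 8 < (n + 2) ^ 8 := lt_word (by nlinarith)
  have hspec : ∀ l < k, _ := fun l hl =>
    scanEdge_spec (Λ := Λ) (S := S) (i := i) (z := xb) (hl.trans_le hk)
  have hrb := hsc.table.bin_bound
  have hJr := hsc.le_r
  have hba := hsc.table.bin_le xa
  rw [hM] at hm₁
  have hxaM : xa ∈ σ₁.marks := hm₁ ▸ Or.inl (Or.inl (self_mem_cluster _ _ _))
  have hxbM : xb ∈ σ₁.marks := hm₁ ▸ Or.inl (Or.inr (self_mem_cluster _ _ _))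
  have hecM : ∀ l < k, (scanEdge Λ S i xb l).1 ∈ c ∧ (scanEdge Λ S i xb l).2 ∈ c := fun l hl =>
    ⟨hbc (hspec l hl).1, h.closed.edge (hbc (hspec l hl).1) (hspec l hl).2⟩
  have hscan_end' : S.Exhausted i xb σ₁.marks ∨
      ∃ g ∈ S.cluster i xb, ∃ g', S.IsBlocked i g g' := by
    rcases hscan_end with h6 | h6
    · left
      intro u hu w he
      obtain ⟨l, hl⟩ := List.mem_iff_getElem?.1 ((Λ.mem_edgeList S i xb u w).2 ⟨hu, he⟩)
      obtain ⟨h7, h8⟩ := scanEdge_of_getElem? hl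
      rw [hm₁]
      exact Or.inr ⟨l, by omega, by rw [h8]; exact self_mem_cluster _ _ _⟩
    · exact Or.inr ⟨_, h6.2, _, h6.1⟩
  -- the marked vertices are taken care of
  have hmarked : ∀ S', Reach i c S S' → (∀ l < k,
      S'.level s((scanEdge Λ S i xb l).1, (scanEdge Λ S i xb l).2) ≤ i ∨
        S'.IsBlocked i (scanEdge Λ S i xb l).1 (scanEdge Λ S i xb l).2) →
      ∀ v, ¬ Disjoint (S'.cluster i v) σ₁.marks →
        S'.Settled i v ∨ v ∈ S'.cluster i xa ∨ v ∈ S'.cluster i xb := by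
    intro S' hR hrec v hv
    obtain ⟨y, hyv, hyM⟩ := Set.not_disjoint_iff.1 hv
    have hvy := mem_cluster_comm.1 hyv
    rw [hm₁] at hyM
    rcases hyM with (hy | hy) | ⟨l, hl, hy⟩
    · right; left
      rw [← cluster_eq_of_mem (hR.cluster_subset xa hy)]; exact hvy
    · right; right
      rw [← cluster_eq_of_mem (hR.cluster_subset xb hy)]; exact hvy
    · have hy' := cluster_eq_of_mem (hR.cluster_subset _ hy)
      rw [hy'] at hvy
      rcases hrec l hl with h6 | h6
      · right; right
        have h7 := mem_cluster_of_level_le (by rw [hR.graph_eq]; exact (hspec l hl).2.1) h6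
        rw [← cluster_eq_of_mem (hR.cluster_subset xb (hspec l hl).1), ← cluster_eq_of_mem h7]
        exact hvy
      · exact Or.inl (Or.inl (h6.good_right.congr hvy))
  -- the last part of the program
  have hfin : ∀ (σ₂ : Config n) (N₂ m : ℕ) (o : ℕ → Fin n),
      N₂ ≤ N₁ + 24 * k + 100 * pushCount S σ₂.forest + 200 → Base i σ₂ → Reach i c S σ₂.forest →
      m ≤ k → (∀ p < 13, σ₂.reg p = σ₁.reg p) → σ₂.reg 16 = 8 * m →
      (∀ p, p % 8 ≠ 5 → σ₂.mem p = σ₁.mem p) → (∀ l < m, σ₂.mem (8 * l + 5) = o l) →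
      (∀ l < m, o l ∈ c) →
      (k ≤ 2 * pushCount S σ₂.forest + 2 ∨ ∃ D, σ₂.forest.Closed i D ∧ D.ncard ≤ 2 ^ i ∧
        ∀ l < k, σ₁.mem (8 * l + 4) = J →
          (scanEdge Λ S i xb l).1 ∈ D ∧ (scanEdge Λ S i xb l).2 ∈ D) →
      (∀ S', Reach i c S S' → Reach i c σ₂.forest S' → (∀ l < k,
        S'.level s((scanEdge Λ S i xb l).1, (scanEdge Λ S i xb l).2) ≤ i ∨
          S'.IsBlocked i (scanEdge Λ S i xb l).1 (scanEdge Λ S i xb l).2) →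
        (∀ l < m, S'.Settled i (o l)) →
        (∀ D, σ₂.forest.Closed i D → D.ncard ≤ 2 ^ i →
          (∀ l < k, σ₁.mem (8 * l + 4) = J →
            (scanEdge Λ S i xb l).1 ∈ D ∧ (scanEdge Λ S i xb l).2 ∈ D) →
          ∀ l < k, σ₁.mem (8 * l + 4) = J →
            S'.level s((scanEdge Λ S i xb l).1, (scanEdge Λ S i xb l).2) ≤ i) →
        ∀ v ∈ c, S'.Settled i v ∨ v ∈ S'.cluster i xa ∨ v ∈ S'.cluster i xb) →
      Runs Λ i c passesProgram σ₂ N₂ Q := by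
    intro σ₂ N₂ m o hN₂ hb₂ hR₂ hmk hreg₂ h16 hmem₂ ho hoc hcount hcover
    have hmem4 : ∀ l, σ₂.mem (8 * l + 4) = σ₁.mem (8 * l + 4) := fun l => hmem₂ _ (by omega)
    refine Runs.passes (e := scanEdge Λ S i xb) (o := o) (k := k) (m := m) (J := J) hb₂
      (h.closed.reach hR₂) hR₂.sizeInvariant (by omega) hmk ((hreg₂ 10 (by omega)).trans h10₁)
      ((hreg₂ 11 (by omega)).trans h11₁) h16
      (fun l hl => (hmem₂ _ (by omega)).trans (hsc.records.fst l hl))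
      (fun l hl => (hmem₂ _ (by omega)).trans (hsc.records.snd l hl))
      (fun l hl => by rw [hR₂.graph_eq]; exact (hspec l hl).2.1)
      (fun l hl => (hR₂.level_le _).trans (hspec l hl).2.2.le) hecM ?_ (by omega) ho hoc ?_
    · intro l hl
      rw [hmem4, hsc.bin_eq l hl]
      have := hsc.table.bin_le (scanEdge Λ S i xb l).2
      omega
    intro σ₃ N₃ hN₃ hF₃ hR₃ hD hrec hset
    simp only [hmem4] at hD
    have hR₃' := hR₂.trans hR₃
    have hadd := hR₂.pushCount_add hR₃
    -- Either merging has already made enough pushes, or all records of the fullest bin have been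
    -- lowered.
    have hcnt : k ≤ 12 * pushCount S σ₃.forest + 2 := by
      rcases hcount with h6 | ⟨D, h6, h7, h8⟩
      · omega
      · have := hsc.count_le h hR₃' (hD D h6 h7 h8)
        omega
    refine hQ σ₃ N₃ (by omega) (hF₃.base hb₂) ?_ ?_ hR₃' (hcover _ hR₃' hR₃ hrec hset hD)
    · rw [hF₃.reg 1 (by omega), hreg₂ 1 (by omega), h1₁]
    · rw [hF₃.reg 2 (by omega), hreg₂ 2 (by omega), h2₁]
  -- the bin of largest count as a closed set
  have hbinD : S.Closed i (binSet Λ S i xb σ₁.mem J) ∧ (binSet Λ S i xb σ₁.mem J).ncard ≤ 2 ^ i ∧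
      ∀ l < k, σ₁.mem (8 * l + 4) = J → (scanEdge Λ S i xb l).1 ∈ binSet Λ S i xb σ₁.mem J ∧
        (scanEdge Λ S i xb l).2 ∈ binSet Λ S i xb σ₁.mem J := by
    have hJ0 := hsc.one_le
    refine ⟨?_, hsc.table.card_le J (by omega), fun l hl hlJ => ⟨Or.inr (hspec l hl).1, Or.inl ?_⟩⟩
    · refine Closed.union (fun v hv y hy => ?_) (closed_cluster _ _ _)
      change σ₁.mem (8 * Λ.node S i y) = J
      rw [Λ.node_eq S i y v (cluster_eq_of_mem hy)]; exact hv
    · change σ₁.mem _ = J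
      rw [← hsc.bin_eq l hl]; exact hlJ
  have hnode := (Λ.node S i xa).2
  refine Runs.seq (Runs.cluster (a := xa) (j := i) h1₁ hb₁.level ?_)
  rw [hf₁]
  generalize hy : ((Λ.node S i xa : Fin n) : ℕ) = y at hnode
  rw [hy] at hba
  refine Runs.seq (Runs.add (2 * y) (by simp; ring) (lt_word_of_le (by omega)) ?_)
  refine Runs.seq (Runs.add (4 * y) (by simp; ring) (lt_word_of_le (by omega)) ?_)
  refine Runs.seq (Runs.add (8 * y) (by simp; ring) (lt_word_of_le (by omega)) ?_)
  refine Runs.seq (Runs.load (σ₁.mem (8 * y)) (by simp) (lt_word_of_le (by omega)) ?_)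
  -- The cell is zero if the scan has not met `A`. Since `J ≥ 1`, equality with `J` means that `A`
  -- is really in the fullest bin.
  generalize hbA : σ₁.mem (8 * y) = bA at hba
  refine Runs.seq (Runs.sub (bA - J) (by simp [h11₁]) (lt_word_of_le (by omega)) ?_)
  refine Runs.seq (Runs.sub (J - bA) (by simp [h11₁]) (lt_word_of_le (by omega)) ?_)
  refine Runs.seq (Runs.add (bA - J + (J - bA)) (by simp) (lt_word_of_le (by omega)) ?_)
  refine Runs.seq (Runs.const (lt_word_of_le (by omega)) ?_)
  generalize hσ₂ : Config.put _ 16 0 = σ₂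
  have hf₂ : σ₂.forest = S := by rw [← hσ₂]; simp [hf₁]
  have hm₂ : σ₂.marks = σ₁.marks := by rw [← hσ₂]; simp
  have hmem₂ : σ₂.mem = σ₁.mem := by rw [← hσ₂]; simp
  have hreg₂ : ∀ p < 20, p ≠ 13 → p ≠ 14 → p ≠ 16 → σ₂.reg p = σ₁.reg p := by
    intro p h6 h7 h8 h9
    rw [← hσ₂]
    simp [h7, h8, h9, show p ≠ 20 by omega, show p ≠ 21 by omega]
  have h13₂ : σ₂.reg 13 = bA - J + (J - bA) := by rw [← hσ₂]; simp
  have h16₂ : σ₂.reg 16 = 0 := by rw [← hσ₂]; simp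
  have hb₂ : Base i σ₂ := ⟨(hreg₂ 0 (by omega) (by omega) (by omega) (by omega)).trans hb₁.level,
    (hreg₂ 18 (by omega) (by omega) (by omega) (by omega)).trans hb₁.one,
    (hreg₂ 19 (by omega) (by omega) (by omega) (by omega)).trans hb₁.zero⟩
  clear hσ₂
  refine Runs.seq (Runs.ite (fun h13 => ?_) (fun h13 => Runs.skip ?_))
  · have hAJ : bA ≠ J := by omega
    refine Runs.seq (Runs.count xa (T := k) hb₂
      ((hreg₂ 10 (by omega) (by omega) (by omega) (by omega)).trans h10₁) hw ?_)
    rw [hf₂, hm₂, hmem₂]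
    intro σ₃ N₃ m o hN₃ hf₃ hreg₃ hmem₃ hmk h16₃ hst hm₃ hex
    have hreg₃' : ∀ p < 20, p ≠ 13 → p ≠ 14 → p ≠ 16 → σ₃.reg p = σ₁.reg p :=
      fun p h6 h7 h8 h9 => (hreg₃ p h6 h7 h8 h9).trans (hreg₂ p h6 h7 h8 h9)
    have hb₃ : Base i σ₃ :=
      ⟨(hreg₃' 0 (by omega) (by omega) (by omega) (by omega)).trans hb₁.level,
        (hreg₃' 18 (by omega) (by omega) (by omega) (by omega)).trans hb₁.one,
        (hreg₃' 19 (by omega) (by omega) (by omega) (by omega)).trans hb₁.zero⟩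
    refine Runs.seq (Runs.sub (8 * k - 8 * m) (by
      rw [hreg₃' 10 (by omega) (by omega) (by omega) (by omega), h10₁, h16₃]) (by omega) ?_)
    refine Runs.ite (fun h15 => Runs.skip ?_) (fun h15 => ?_)
    · -- all children have been stored
      simp at h15
      refine hfin _ _ m o ?_ ⟨?_, ?_, ?_⟩ ?_ hmk ?_ ?_ ?_ hst.mem_eq hst.mem_c ?_ ?_
      · simp only [Config.put_forest]; omega
      · simp [hb₃.level]
      · simp [hb₃.one]
      · simp [hb₃.zero]
      · simp only [Config.put_forest, hf₃]; exact Reach.refl h.sizeInvariant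
      · intro p hp
        rw [Config.put_reg, if_neg (by omega)]
        exact hreg₃' p (by omega) (by omega) (by omega) (by omega)
      · simp [h16₃]
      · exact hmem₃
      · right
        simp only [Config.put_forest, hf₃]
        exact ⟨_, hbinD⟩
      · intro S' hR _ hrec hset _ v hv
        have hnd := (hex.resolve_left (by omega)) v hv
        rw [hm₃] at hnd
        obtain ⟨p, hpv, hp | ⟨l, hl, hp⟩⟩ := Set.not_disjoint_iff.1 hnd
        · exact hmarked S' hR hrec v
            (Set.not_disjoint_iff.2 ⟨p, hR.cluster_subset v hpv, hp⟩)
        · left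
          refine (hset l hl).congr ?_
          rw [← cluster_eq_of_mem (hR.cluster_subset _ hp),
            cluster_eq_of_mem (hR.cluster_subset v hpv)]
          exact self_mem_cluster _ _ _
    -- There are as many stored children as records, so a bound on their number is a bound on `k`.
    -- They remain stored and are settled once more in the passes, at cost `O(k)`.
    · simp at h15
      have hmk' : m = k := by omega
      subst hmk'
      have hb₃' : Base i (σ₃.put 15 (8 * m - 8 * m)) :=
        ⟨by simp [hb₃.level], by simp [hb₃.one], by simp [hb₃.zero]⟩
      refine Runs.seq (Runs.unmark (S := S) (M := σ₁.marks) (m := m) (o := o) hb₃'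
        (by simp [h16₃]) hw hf₃ hst hm₃ ?_)
      intro σ₄ N₄ hN₄ hf₄ hreg₄ hmem₄ hm₄
      have hreg₄' : ∀ p < 20, p ≠ 13 → p ≠ 14 → p ≠ 15 → p ≠ 16 → σ₄.reg p = σ₁.reg p := by
        intro p h6 h7 h8 h9 h10
        rw [hreg₄ p h6 h7 h8, Config.put_reg, if_neg h9, hreg₃' p h6 h7 h8 h10]
      have hb₄ : Base i σ₄ :=
        ⟨(hreg₄ 0 (by omega) (by omega) (by omega)).trans hb₃'.level,
          (hreg₄ 18 (by omega) (by omega) (by omega)).trans hb₃'.one,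
          (hreg₄ 19 (by omega) (by omega) (by omega)).trans hb₃'.zero⟩
      refine Runs.merge hb₄ (by rw [hf₄]; exact h.closed) (by rw [hf₄]; exact h.sizeInvariant)
        (Separated S i xb σ₁.marks) ⟨?_, ?_⟩ ?_ ?_
      · rw [hf₄]; exact fun _ _ _ _ => id
      · rw [hf₄]; exact fun _ => rfl
      · rw [hf₄, hm₄]
        intro S₁ S₂ p x z hsep hR hd hx hp
        exact hsep.push hxbM hR hd hx hp
      rw [hf₄, hm₄]
      intro σ₅ N₅ hN₅ hF₅ hR₅ hsep hend
      refine hfin σ₅ N₅ m o (by omega) (hF₅.base hb₄) hR₅ le_rfl ?_ ?_ ?_ ?_ hst.mem_c ?_ ?_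
      · intro p hp
        rw [hF₅.reg p (by omega)]
        exact hreg₄' p (by omega) (by omega) (by omega) (by omega) (by omega)
      · rw [hF₅.reg 16 (by omega), hreg₄ 16 (by omega) (by omega) (by omega)]
        simp [h16₃]
      · intro p hp
        rw [hF₅.mem, hmem₄]
        exact hmem₃ p hp
      · intro l hl
        rw [hF₅.mem, hmem₄]
        exact hst.mem_eq l hl
      · refine (h.merge_count hH hxaM hxbM hR₅ hsep hscan_end' hend hst).imp id ?_
        rintro ⟨D, h6, h7, h8⟩
        refine ⟨D, h6, h7, fun l hl hlJ => ⟨?_, ?_⟩⟩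
        · refine h8 _ (hecM l hl).1 (hm₁ ▸ Or.inl (Or.inr (hspec l hl).1)) fun h9 => h.ne ?_
          rw [← cluster_eq_of_mem h9, cluster_eq_of_mem (hspec l hl).1]
        -- The far end of a record in bin `J` is not in `A`, whose bin is a different one.
        · refine h8 _ (hecM l hl).2 (hm₁ ▸ Or.inr ⟨l, hl, self_mem_cluster _ _ _⟩) fun h9 => hAJ ?_
          rw [← hlJ, hsc.bin_eq l hl, Λ.node_eq S i _ xa (cluster_eq_of_mem h9), hy, hbA]
      · intro S' hR hR' hrec _ _ v hv
        by_cases hd : Disjoint (σ₅.forest.cluster i v) σ₁.marks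
        · left; left
          rcases hend with hend | ⟨p, hpc, hpd, hmin, hev⟩
          · exact absurd hd (hend v hv)
          · exact ((h.merge_event hH hxaM hxbM hR₅ hsep hscan_end' hpc hpd hmin hev).1 v hv hd).reach hR'
        · obtain ⟨p, hpv, hp⟩ := Set.not_disjoint_iff.1 hd
          exact hmarked S' hR hrec v
            (Set.not_disjoint_iff.2 ⟨p, hR'.cluster_subset v hpv, hp⟩)
  · -- the bin contains the larger half
    have hAJ : bA = J := by omega
    refine hfin σ₂ _ 0 (fun _ => xa) ?_ hb₂ ?_ (by omega)
      (fun p hp => hreg₂ p (by omega) (by omega) (by omega) (by omega)) (by simp [h16₂])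
      (fun p _ => by rw [hmem₂]) (by simp) (by simp) ?_ ?_
    · omega
    · rw [hf₂]; exact Reach.refl h.sizeInvariant
    · right; rw [hf₂]; exact ⟨_, hbinD⟩
    · rw [hf₂]
      intro S' hR _ _ _ hD v hv
      have hlow := hD _ hbinD.1 hbinD.2.1 hbinD.2.2
      have hxaW : xa ∈ S.cluster i xb ∪ scanned Λ S i xb k := by
        refine (hsc.table.ne_zero xa).1 ?_
        rw [hy, hbA, hAJ]
        have := hsc.one_le
        omega
      -- Some recorded edge leads from `B` to `A`. It belongs to bin `J`, so it has been lowered and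
      -- the halves are one cluster again.
      obtain ⟨l, hl, hal⟩ := hxaW.resolve_left fun h6 => h.ne (cluster_eq_of_mem h6)
      have hlJ : σ₁.mem (8 * l + 4) = J := by
        rw [hsc.bin_eq l hl, ← Λ.node_eq S i xa _ (cluster_eq_of_mem hal), hy, hbA, hAJ]
      have h6 := mem_cluster_of_level_le (S := S')
        (by rw [hR.graph_eq]; exact (hspec l hl).2.1) (hlow l hl hlJ)
      have hmer : S'.cluster i xa = S'.cluster i xb := by
        rw [cluster_eq_of_mem (hR.cluster_subset _ hal), cluster_eq_of_mem h6,
          cluster_eq_of_mem (hR.cluster_subset _ (hspec l hl).1)]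
      exact (h.good_of_merged hR hmer hv).imp id Or.inl

end Heavy

/-! ### Light and heavy case combined; the whole program and its running time -/

section Repair

open LeveledGraph

variable {n : ℕ} {Λ : Layout n} {i : ℕ} {c : Set (Fin n)} {S : LeveledGraph n}
variable {σ : Config n} {N : ℕ} {Q : Config n → ℕ → Prop} {xa xb : Fin n}

/-- Restore the invariant, where the registers 1 and 2 hold vertices of the larger and the smaller
half, the registers 4 and 5 their sizes and register 3 the capacity. -/
def repairProgram : Program :=
  .instr (.mark 1) ;; .instr (.mark 2) ;; .instr (.smallest 6 7) ;;
  .ite 6 (.instr (.size 20 7 0) ;; .instr (.add 20 20 4) ;; .instr (.add 20 20 5) ;;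
    .instr (.sub 6 20 3)) .skip ;;
  .ite 6 heavyProgram .skip ;;
  .instr (.add 43 1 19) ;; settleProgram ;; .instr (.add 43 2 19) ;; settleProgram

/-- A smallest child other than the halves decides between the light and the heavy case. After
either of them, only the clusters of the two halves may still be unsettled. -/
theorem Runs.repair (hb : Base i σ) (hi : i + 1 ≤ maxLevel n) (hS : σ.forest = S)
    (h : Halves S i c xa xb) (h1 : σ.reg 1 = xa) (h2 : σ.reg 2 = xb) (h3 : σ.reg 3 = 2 ^ i)
    (h4 : σ.reg 4 = S.size i xa) (h5 : σ.reg 5 = S.size i xb)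
    (h0 : ∀ p, σ.mem p = 0) (hM : σ.marks = ∅)
    (hQ : ∀ σ' N', N' ≤ N + 10300 * (pushCount S σ'.forest + 1) → Reach i c S σ'.forest →
      (∀ v ∈ c, σ'.forest.Settled i v) → Q σ' N') :
    Runs Λ i c repairProgram σ N Q := by
  have hi' := two_pow_lt hi
  have hsa := S.size_le i xa
  have hsb := S.size_le i xb
  -- the last part of the program
  have hfin : ∀ σ₁ N₁, N₁ ≤ N + 20 + 10000 * (pushCount S σ₁.forest + 1) → Base i σ₁ →
      σ₁.reg 1 = xa → σ₁.reg 2 = xb → Reach i c S σ₁.forest →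
      (∀ v ∈ c, σ₁.forest.Settled i v ∨ v ∈ σ₁.forest.cluster i xa ∨
        v ∈ σ₁.forest.cluster i xb) →
      Runs Λ i c (.instr (.add 43 1 19) ;; settleProgram ;; .instr (.add 43 2 19) ;;
        settleProgram) σ₁ N₁ Q := by
    intro σ₁ N₁ hN₁ hb₁ h1₁ h2₁ hR₁ hset
    refine Runs.seq (Runs.add xa (by rw [h1₁, hb₁.zero, add_zero]) (fin_lt_word _) ?_)
    refine Runs.seq (Runs.settle (v := xa) ⟨by simp [hb₁.level], by simp [hb₁.one],
      by simp [hb₁.zero]⟩ (by simp) h.mem_left (h.closed.reach hR₁) hR₁.sizeInvariant ?_)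
    intro σ₂ N₂ hN₂ hF₂ hR₂ hset₂
    simp only [Config.put_forest] at hN₂ hR₂
    have hR₂' := hR₁.trans hR₂
    have hreg₂ : ∀ p < 20, σ₂.reg p = σ₁.reg p := fun p hp => by
      rw [hF₂.reg p (Or.inl hp), Config.put_reg, if_neg (by omega)]
    refine Runs.seq (Runs.add xb (by
      rw [hreg₂ 2 (by omega), hreg₂ 19 (by omega), h2₁, hb₁.zero, add_zero]) (fin_lt_word _) ?_)
    refine Runs.settle (v := xb) ⟨by simp [hreg₂, hb₁.level], by simp [hreg₂, hb₁.one],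
      by simp [hreg₂, hb₁.zero]⟩ (by simp) h.mem_right (h.closed.reach hR₂') hR₂.sizeInvariant ?_
    intro σ₃ N₃ hN₃ hF₃ hR₃ hset₃
    simp only [Config.put_forest] at hN₃ hR₃
    have hadd₁ := hR₁.pushCount_add hR₂
    have hadd₂ := hR₂'.pushCount_add hR₃
    refine hQ σ₃ N₃ (by omega) (hR₂'.trans hR₃) fun v hv => ?_
    rcases hset v hv with h6 | h6 | h6
    · exact h6.reach (hR₂.trans hR₃)
    · exact (hset₂.reach hR₃).congr ((hR₂.trans hR₃).cluster_subset xa h6)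
    · exact hset₃.congr ((hR₂.trans hR₃).cluster_subset xb h6)
  unfold repairProgram
  refine Runs.seq (Runs.step (Step.mark _ 1 xa h1) ?_)
  refine Runs.seq (Runs.step (Step.mark _ 2 xb h2) ?_)
  rw [hM, Set.empty_union, hS]
  generalize hσ₁ : (Config.mk S _ σ.reg σ.mem) = σ₁
  have hf₁ : σ₁.forest = S := by rw [← hσ₁]
  have hm₁ : σ₁.marks = S.cluster i xa ∪ S.cluster i xb := by rw [← hσ₁]
  have hreg₁ : σ₁.reg = σ.reg := by rw [← hσ₁]
  have hmem₁ : σ₁.mem = σ.mem := by rw [← hσ₁]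
  clear hσ₁
  have hfree : ∀ {v}, Disjoint (S.cluster i v) (S.cluster i xa ∪ S.cluster i xb) ↔
      v ∉ S.cluster i xa ∧ v ∉ S.cluster i xb := by
    intro v
    rw [Set.disjoint_union_right]
    refine and_congr ⟨fun h6 => Set.disjoint_left.1 h6 (self_mem_cluster _ _ _),
      fun h6 => disjoint_cluster fun h7 => h6 (h7 ▸ self_mem_cluster _ _ _)⟩
      ⟨fun h6 => Set.disjoint_left.1 h6 (self_mem_cluster _ _ _),
      fun h6 => disjoint_cluster fun h7 => h6 (h7 ▸ self_mem_cluster _ _ _)⟩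
  refine Runs.seq (Runs.smallest ?_ ?_)
  · intro hsm
    rw [hf₁, hm₁] at hsm
    refine Runs.seq (Runs.ite (fun h6 => by simp at h6) (fun _ => Runs.skip ?_))
    refine Runs.seq (Runs.ite (fun h6 => by simp at h6) (fun _ => Runs.skip ?_))
    refine hfin _ _ ?_ ⟨by simp [hreg₁, hb.level], by simp [hreg₁, hb.one],
      by simp [hreg₁, hb.zero]⟩ (by simp [hreg₁, h1]) (by simp [hreg₁, h2]) ?_ ?_
    · omega
    · rw [Config.put_forest, hf₁]; exact Reach.refl h.sizeInvariant
    · intro v hv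
      rw [Config.put_forest, hf₁]
      right
      have := Λ.smallest_none _ _ _ _ hsm v hv
      rw [hfree] at this
      tauto
  · intro f hsm
    rw [hf₁, hm₁] at hsm
    obtain ⟨hfc, hfd, hmin⟩ := Λ.smallest_some _ _ _ _ _ hsm
    rw [hfree] at hfd
    have hsf := S.size_le i f
    refine Runs.seq (Runs.ite (fun _ => ?_) (fun h6 => by simp at h6))
    refine Runs.seq (Runs.size (a := f) (j := i) (by simp) (by simp [hreg₁, hb.level]) ?_)
    simp only [Config.put_forest, hf₁]
    refine Runs.seq (Runs.add (S.size i f + S.size i xa) (by simp [hreg₁, h4])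
      (lt_word_of_le (by omega)) ?_)
    refine Runs.seq (Runs.add (S.size i f + S.size i xa + S.size i xb) (by simp [hreg₁, h5])
      (lt_word_of_le (by omega)) ?_)
    refine Runs.sub (S.size i f + S.size i xa + S.size i xb - 2 ^ i) (by simp [hreg₁, h3])
      (lt_word_of_le (by omega)) ?_
    refine Runs.seq (Runs.ite (fun h6 => ?_) (fun h6 => Runs.skip ?_))
    · simp at h6
      refine Runs.heavy (xa := xa) (xb := xb) ⟨by simp [hreg₁, hb.level], by simp [hreg₁, hb.one],
        by simp [hreg₁, hb.zero]⟩ hi (by simp [hf₁]) h ?_ (by simp [hreg₁, h1])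
        (by simp [hreg₁, h2]) (by simp [hreg₁, h3]) (by simp [hreg₁, h5])
        (by simp [hmem₁, h0]) (by simp [hm₁]) ?_
      · intro v hv hva hvb
        have := hmin v hv (hfree.2 ⟨hva, hvb⟩)
        omega
      · intro σ₂ N₂ hN₂ hb₂ h1₂ h2₂ hR₂ hset
        exact hfin σ₂ N₂ (by linarith) hb₂ h1₂ h2₂ hR₂ hset
    · simp at h6
      refine hfin _ _ ?_ ⟨by simp [hreg₁, hb.level], by simp [hreg₁, hb.one],
        by simp [hreg₁, hb.zero]⟩ (by simp [hreg₁, h1]) (by simp [hreg₁, h2]) ?_ ?_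
      · omega
      · simp only [Config.put_forest, hf₁]; exact Reach.refl h.sizeInvariant
      · intro v hv
        simp only [Config.put_forest, hf₁]
        by_cases hva : v ∈ S.cluster i xa
        · exact Or.inr (Or.inl hva)
        by_cases hvb : v ∈ S.cluster i xb
        · exact Or.inr (Or.inr hvb)
        exact Or.inl (Or.inl (h.good_of_light hfc hfd.1 hfd.2 (by omega) hv hva hvb))

/-- The whole program. -/
def splitProgram : Program :=
  .instr (.const 18 1) ;; .instr (.add 23 0 19) ;; powProgram ;; .instr (.add 3 24 19) ;;
  .instr (.size 4 1 0) ;; .instr (.size 5 2 0) ;; .instr (.sub 20 5 4) ;;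
  .ite 20
    (.instr (.add 21 1 19) ;; .instr (.add 1 2 19) ;; .instr (.add 2 21 19) ;;
      .instr (.add 21 4 19) ;; .instr (.add 4 5 19) ;; .instr (.add 5 21 19))
    .skip ;;
  repairProgram

/-- Which half is larger is found out at run time, so both orders have to be provided for. -/
theorem Runs.split {x₁ x₂ : Fin n} (hi : i + 1 ≤ maxLevel n)
    (h12 : S.size i x₂ ≤ S.size i x₁ → Halves S i c x₁ x₂)
    (h21 : S.size i x₁ ≤ S.size i x₂ → Halves S i c x₂ x₁) :
    Runs Λ i c splitProgram (Config.init S i x₁ x₂) 0 fun σ N =>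
      N ≤ 10400 * (pushCount S σ.forest + 1) ∧ Reach i c S σ.forest ∧
        ∀ v ∈ c, σ.forest.Settled i v := by
  have hi' := two_pow_lt hi
  have hii : i < 2 ^ i := Nat.lt_two_pow_self
  have hs₁ := S.size_le i x₁
  have hs₂ := S.size_le i x₂
  have hx₁ := fin_lt_word x₁
  have hx₂ := fin_lt_word x₂
  have hσ : ∃ σ, σ = Config.init S i x₁ x₂ := ⟨_, rfl⟩
  obtain ⟨σ, hσ⟩ := hσ
  have hf : σ.forest = S := by rw [hσ]; rfl
  have hm : σ.marks = ∅ := by rw [hσ]; rfl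
  have hmem : ∀ p, σ.mem p = 0 := by rw [hσ]; exact fun _ => rfl
  have hr0 : σ.reg 0 = i := by rw [hσ]; rfl
  have hr1 : σ.reg 1 = x₁ := by rw [hσ]; rfl
  have hr2 : σ.reg 2 = x₂ := by rw [hσ]; rfl
  have hr19 : σ.reg 19 = 0 := by rw [hσ]; rfl
  rw [← hσ]
  clear hσ
  unfold splitProgram
  refine Runs.seq (Runs.const (lt_word_of_le (by omega)) ?_)
  refine Runs.seq (Runs.add i (by simp [hr0, hr19]) (lt_word_of_le (by omega)) ?_)
  refine Runs.seq (Runs.pow hi (by simp) (by simp) ?_)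
  refine Runs.seq (Runs.add (2 ^ i) (by simp [hr19]) (lt_word_of_le (by omega)) ?_)
  refine Runs.seq (Runs.size (a := x₁) (j := i) (by simp [hr1]) (by simp [hr0]) ?_)
  refine Runs.seq (Runs.size (a := x₂) (j := i) (by simp [hr2]) (by simp [hr0]) ?_)
  simp only [Config.put_forest, hf]
  refine Runs.seq (Runs.sub (S.size i x₂ - S.size i x₁) (by simp) (lt_word_of_le (by omega)) ?_)
  refine Runs.seq (Runs.ite (fun h20 => ?_) (fun h20 => Runs.skip ?_))
  · simp at h20
    refine Runs.seq (Runs.add x₁ (by simp [hr1, hr19]) hx₁ ?_)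
    refine Runs.seq (Runs.add x₂ (by simp [hr2, hr19]) hx₂ ?_)
    refine Runs.seq (Runs.add x₁ (by simp [hr19]) hx₁ ?_)
    refine Runs.seq (Runs.add (S.size i x₁) (by simp [hr19]) (lt_word_of_le (by omega)) ?_)
    refine Runs.seq (Runs.add (S.size i x₂) (by simp [hr19]) (lt_word_of_le (by omega)) ?_)
    refine Runs.add (S.size i x₁) (by simp [hr19]) (lt_word_of_le (by omega)) ?_
    refine Runs.repair (S := S) (xa := x₂) (xb := x₁)
      ⟨by simp [hr0], by simp, by simp [hr19]⟩ hi (by simp [hf]) (h21 (by omega))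
      (by simp) (by simp) (by simp) (by simp) (by simp) (by simp [hmem]) (by simp [hm]) ?_
    intro σ' N' hN' hR hset
    exact ⟨by linarith, hR, hset⟩
  · simp at h20
    refine Runs.repair (S := S) (xa := x₁) (xb := x₂)
      ⟨by simp [hr0], by simp, by simp [hr19]⟩ hi (by simp [hf]) (h12 (by omega))
      (by simp [hr1]) (by simp [hr2]) (by simp) (by simp) (by simp) (by simp [hmem])
      (by simp [hm]) ?_
    intro σ' N' hN' hR hset
    exact ⟨by linarith, hR, hset⟩

/-- Rounding up adds at most one, so the left side is at most `log₂ n + 2`; and `log₂ n ≥ 1`, since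
the existence of level `i + 1` forces `n ≥ 2`. -/
theorem clog_add_one_le {n i : ℕ} (h : i + 1 ≤ maxLevel n) :
    ((Nat.clog 2 n + 1 : ℕ) : ℝ) ≤ 3 * Real.logb 2 n := by
  have hn : 2 ≤ n := by
    have := two_pow_lt h
    have := Nat.one_le_two_pow (n := i)
    omega
  have h1 : (1 : ℝ) ≤ Real.logb 2 n := by
    rw [Real.le_logb_iff_rpow_le (by norm_num) (by positivity), Real.rpow_one]
    exact_mod_cast hn
  obtain ⟨j, hj⟩ : ∃ j, Nat.clog 2 n = j + 1 := ⟨Nat.clog 2 n - 1, by unfold maxLevel at h; omega⟩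
  have h2 : 2 ^ j < n := two_pow_lt (by unfold maxLevel; omega)
  have h3 : (j : ℝ) ≤ Real.logb 2 n := by
    rw [Real.le_logb_iff_rpow_le (by norm_num) (by positivity), Real.rpow_natCast]
    exact_mod_cast h2.le
  rw [hj]
  push_cast
  linarith

end Repair

theorem mainTheorem11 :
    ∃ (p : Program) (K : ℝ),
      ∀ (n i : ℕ) (Λ : Layout n) (S₀ S₁ : LeveledGraph n) (c X X₁ X₂ : Set (Fin n))
        (x₁ x₂ : Fin n),
        i + 1 ≤ maxLevel n → S₀.SizeInvariant → S₁.SizeInvariant →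
        LeveledGraph.IsSplit S₀ S₁ i c X X₁ X₂ → S₀.BlockedInvariant i c →
        x₁ ∈ X₁ → x₂ ∈ X₂ →
        ∃ (σ : Config n) (t : ℕ),
          Exec Λ i c p (Config.init S₁ i x₁ x₂) σ t ∧
          (t : ℝ) ≤ K * ((LeveledGraph.pushCount S₁ σ.forest : ℝ) + 1) * Real.logb 2 n ∧
          LeveledGraph.PushedWithin S₁ σ.forest i c ∧
          σ.forest.SizeInvariant ∧
          (∀ A ⊆ c, σ.forest.IsCluster (i + 1) A → σ.forest.BlockedInvariant i A) ∧
          (S₁.BlockedBelow i c → σ.forest.BlockedBelow i c) := by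
  -- The constant is `3 · 10400`: `10400 (k + 1)` units by `Runs.split`, each of at most `3 log₂ n`
  -- by `clog_add_one_le`.
  refine ⟨splitProgram, 31200, ?_⟩
  intro n i Λ S₀ S₁ c X X₁ X₂ x₁ x₂ hi hS₀ hS₁ hsplit hblocked hx₁ hx₂
  obtain ⟨σ, t, k, hexec, ht, hk, hR, hset⟩ := Runs.split (Λ := Λ) (c := c) (S := S₁)
    (x₁ := x₁) (x₂ := x₂) hi (fun h => hsplit.halves hS₀ hS₁ hblocked hx₁ hx₂ h)
    (fun h => hsplit.symm.halves hS₀ hS₁ hblocked hx₂ hx₁ h)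
  refine ⟨σ, t, hexec, ?_, hR.pushedWithin, hR.sizeInvariant,
    fun A hA hcl => LeveledGraph.blockedInvariant_of_settled hset hA hcl, hR.below⟩
  rw [zero_add] at hk
  have hlog := clog_add_one_le hi
  have hlog0 : (0 : ℝ) ≤ ((Nat.clog 2 n + 1 : ℕ) : ℝ) := Nat.cast_nonneg _
  calc (t : ℝ) ≤ ((k * (Nat.clog 2 n + 1) : ℕ) : ℝ) := by exact_mod_cast ht
    _ = (k : ℝ) * ((Nat.clog 2 n + 1 : ℕ) : ℝ) := by push_cast; ring
    _ ≤ (10400 * ((LeveledGraph.pushCount S₁ σ.forest : ℝ) + 1)) *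
        ((Nat.clog 2 n + 1 : ℕ) : ℝ) := by
      refine mul_le_mul_of_nonneg_right ?_ hlog0
      exact_mod_cast hk
    _ ≤ (10400 * ((LeveledGraph.pushCount S₁ σ.forest : ℝ) + 1)) * (3 * Real.logb 2 n) := by
      refine mul_le_mul_of_nonneg_left hlog ?_
      positivity
    _ = 31200 * ((LeveledGraph.pushCount S₁ σ.forest : ℝ) + 1) * Real.logb 2 n := by ring
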